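/- **Notation.** Let $r\in\mathbb C$ with $\operatorname{Re} r>0$, let $\beta\in\mathbb C$ and $x=i\beta/\pi$. Assume $x\neq\pm(m+nr)$ and $x\neq\pm(1-nr)$ for all integers $m,n\ge 0$ (so no Gamma function below is evaluated at a pole). Let $\Gamma_N(x\,|\,\omega_1,\dots,\omega_N)=\exp\big(\partial_s\sum_{n_1,\dots,n_N\ge0}(x+n_1\omega_1+\dots+n_N\omega_N)^{-s}\big|_{s=0}\big)$, where the series, convergent for $\operatorname{Re}s>N$, is continued analytically to $s=0$; let $S_2(x\,|\,\omega_1,\omega_2)=\Gamma_2(\omega_1+\omega_2-x\,|\,\omega_1,\omega_2)/\Gamma_2(x\,|\,\omega_1,\omega_2)$; and let $(z;p_1,\dots,p_m)_\infty=\prod_{n_i\ge0}(1-zp_1^{n_1}\cdots p_m^{n_m})$. Matrices are written in the basis $e_1\otimes e_1,e_1\otimes e_2,e_2\otimes e_1,e_2\otimes e_2$ of $\mathbb C^2\otimes\mathbb C^2$; $A_{12}=A$ and $A_{21}=PAP$ with $P$ the flip. Write $$M_8(a,b,c,d)=\begin{pmatrix}a&0&0&d\\0&b&c&0\\0&c&b&0\\d&0&0&a\end{pmatrix},\qquad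 M_6(b,c,c')=\begin{pmatrix}1&0&0&0\\0&b&c&0\\0&c'&b&0\\0&0&0&1\end{pmatrix}.$$ The $R$-matrices of $DY$, $DY_r^{V8}$, $DY_r^{V6}$, $DY_r^{F}$ are $$R[DY](\beta)=\frac{\Gamma_1(x|2)\,\Gamma_1(2+x|2)}{\Gamma_1(1+x|2)^2}\;M_6\Big(\tfrac{i\beta}{i\beta+\pi},\tfrac{\pi}{i\beta+\pi},\tfrac{\pi}{i\beta+\pi}\Big),$$ $$R[DY_r^{V8}](\beta)=\rho_{V8}\,M_8\Big(\tfrac{\cos\frac{i\beta}{2r}\cos\frac{\pi}{2r}}{\cos\frac{\pi+i\beta}{2r}},\ \tfrac{\sin\frac{i\beta}{2r}\cos\frac{\pi}{2r}}{\sin\frac{\pi+i\beta}{2r}},\ \tfrac{\cos\frac{i\beta}{2r}\sin\frac{\pi}{2r}}{\sin\frac{\pi+i\beta}{2r}},\ -\tfrac{\sin\frac{i\beta}{2r}\sin\frac{\pi}{2r}}{\cos\frac{\pi+i\beta}{2r}}\Big),$$ $$R[DY_r^{V6}](\beta)=\rho_{V8}\,M_6\Big(\tfrac{\sin\frac{i\beta}{r}}{\sin\frac{\pi+i\beta}{r}},\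 \tfrac{\sin\frac{\pi}{r}}{\sin\frac{\pi+i\beta}{r}},\ \tfrac{\sin\frac{\pi}{r}}{\sin\frac{\pi+i\beta}{r}}\Big),$$ $$R[DY_r^{F}](\beta)=\rho_{F}\,M_6\Big(\tfrac{\sin\frac{i\beta}{r}}{\sin\frac{\pi+i\beta}{r}},\ e^{\beta/r}\tfrac{\sin\frac{\pi}{r}}{\sin\frac{\pi+i\beta}{r}},\ e^{-\beta/r}\tfrac{\sin\frac{\pi}{r}}{\sin\frac{\pi+i\beta}{r}}\Big),$$ $$\rho_{V8}=-\frac{S_2(-x|r,2)\,S_2(1+x|r,2)}{S_2(x|r,2)\,S_2(1-x|r,2)}\cot\frac{i\beta}{2},\qquad \rho_F=\frac{S_2(1+x|r,2)^2}{S_2(x|r,2)\,S_2(2+x|r,2)}.$$ Let $E^{(2)}(\beta;r)=\rho_E(\beta;r)\,M_8(a_E,b_E,c_E,d_E)$ with $$a_E+d_E=1,\quad a_E-d_E=\frac{\Gamma_1(r-1+x\,|\,2r)}{\Gamma_1(r+1+x\,|\,2r)},\quad b_E+c_E=1,\quad b_E-c_E=\frac{\Gamma_1(2r-1+x\,|\,2r)}{\Gamma_1(2r+1+x\,|\,2r)},$$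 $$\rho_E(\beta;r)=\frac{\Gamma_2(r+1+x\,|\,r,2)^2}{\Gamma_2(r+x\,|\,r,2)\,\Gamma_2(r+2+x\,|\,r,2)}.$$ Frønsdal's twist is $E^{(1)}(z;p)=\rho_E^{(1)}M_8(a,b,c,d)$ (depending also on $q$) with $$a\pm d=\frac{(\mp p^{1/2}qz;p)_\infty}{(\mp p^{1/2}q^{-1}z;p)_\infty},\quad b\pm c=\frac{(\mp pqz;p)_\infty}{(\mp pq^{-1}z;p)_\infty},\quad \rho_E^{(1)}=\frac{(pz^2;p,q^4)_\infty(pq^4z^2;p,q^4)_\infty}{(pq^2z^2;p,q^4)_\infty^2},$$ and the vertex $R$-matrix of the quantum affine algebra $U_q$ is $$R[U_q](z)=q^{-1/2}\tfrac{(q^2z^2;q^4)_\infty^2}{(z^2;q^4)_\infty(q^4z^2;q^4)_\infty}\,M_6\Big(\tfrac{q(1-z^2)}{1-q^2z^2},\tfrac{z(1-q^2)}{1-q^2z^2},\tfrac{z(1-q^2)}{1-q^2z^2}\Big).$$ For $0<q<1$ let $C(q;r)=\big(\tfrac{-\log q}{2}\big)^{-(\sigma_1\otimes\sigma_1)/(2r)}$,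 with $\sigma_1$ the Pauli matrix $\begin{pmatrix}0&1\\1&0\end{pmatrix}$; that is, with $u=(\frac{-\log q}{2})^{1/(2r)}$, $C$ acts by $u^{\mp1}$ on the $\pm1$-eigenspace of $\sigma_1\otimes\sigma_1$. Finally let $$K=\frac12\begin{pmatrix}1&-i&-i&-1\\-1&-i&i&-1\\-1&i&-i&-1\\1&i&i&-1\end{pmatrix},\qquad K^{(6)}(\beta)=\operatorname{diag}(1,e^{\beta/2r},e^{-\beta/2r},1),\qquad K^{(8)}=K^{(6)}K^{-1},$$ $E^{(3)}=K^{-1}E^{(2)}$ and $F^{(7)}=K^{(8)}E^{(2)}=K^{(6)}K^{-1}E^{(2)}$. **Theorem.** 1. $E^{(2)}(\beta;r)$ is invertible and $R[DY_r^{V8}](\beta)=E^{(2)}_{21}(-\beta;r)\,R[DY](\beta)\,E^{(2)}_{12}(\beta;r)^{-1}$. 2. $E^{(2)}$ is the scaling limit of $E^{(1)}$, up to the constant (independent of the spectral parameter) factor $C$: $$\lim_{q\to1^-}C(q;r)\,E^{(1)}(z;p)\Big|_{z=q^{i\beta/\pi},\ p=q^{2r}}=E^{(2)}(\beta;r).$$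 The factor $C$ is invertible and does not affect the twisted $R$-matrix: for all $0<q<1$ and all $z,p$, $$(CE^{(1)}(z^{-1};p))_{21}\,R[U_q](z)\,(CE^{(1)}(z;p))_{12}^{-1}=E^{(1)}_{21}(z^{-1};p)\,R[U_q](z)\,E^{(1)}_{12}(z;p)^{-1}.$$ (An inverse occurring in the last identity is read as $0$ if the matrix is singular; both sides are singular or regular together.) 3. $K$ is invertible, $R[DY_r^{V8}]=K_{21}R[DY_r^{V6}]K_{12}^{-1}$, and $R[DY_r^{V6}](\beta)=E^{(3)}_{21}(-\beta;r)\,R[DY](\beta)\,E^{(3)}_{12}(\beta;r)^{-1}$, where explicitly $$E^{(3)}=\tfrac12\rho_E\begin{pmatrix}1&-1&-1&1\\ i(a_E-d_E)&i(b_E-c_E)&i(c_E-b_E)&i(d_E-a_E)\\ i(a_E-d_E)&i(c_E-b_E)&i(b_E-c_E)&i(d_E-a_E)\\-1&-1&-1&-1\end{pmatrix}.$$ 4. $R[DY_r^F](\beta)=K^{(6)}_{21}(-\beta)R[DY_r^{V6}](\beta)K^{(6)}_{12}(\beta)^{-1}=K^{(8)}_{21}(-\beta)R[DY_r^{V8}](\beta)K^{(8)}_{12}(\beta)^{-1}=F^{(7)}_{21}(-\beta;r)\,R[DY](\beta)\,F^{(7)}_{12}(\beta;r)^{-1}$,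 where $F^{(7)}$ is the matrix displayed for $E^{(3)}$ with its second row multiplied by $e^{\beta/2r}$ and its third row by $e^{-\beta/2r}$. -/

import Mathlib

namespace DoubleYangian

/-- The half plane `Re s > -1` with the possible poles `1, …, N` removed. -/
def zetaDomain (N : ℕ) : Set ℂ :=
  {s : ℂ | -1 < s.re} \ {s : ℂ | ∃ k : ℕ, 1 ≤ k ∧ k ≤ N ∧ s = (k : ℂ)}

/-- `Z` is the analytic continuation of the Barnes zeta series
`∑_{n₁,…,n_N ≥ 0} (x + n₁ω₁ + ⋯ + n_Nω_N)^{-s}` from the half plane `Re s > N` to a domain that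
contains `s = 0`. -/
structure IsBarnesZeta {N : ℕ} (ω : Fin N → ℂ) (x : ℂ) (Z : ℂ → ℂ) : Prop where
  differentiableOn : DifferentiableOn ℂ Z (zetaDomain N)
  hasSum : ∀ s : ℂ, (N : ℝ) < s.re →
    HasSum (fun n : Fin N → ℕ => (x + ∑ i, (n i : ℂ) * ω i) ^ (-s)) (Z s)

theorem isOpen_zetaDomain (N : ℕ) : IsOpen (zetaDomain N) := by
  refine (isOpen_lt continuous_const Complex.continuous_re).sdiff ?_
  have hfin : Set.Finite {s : ℂ | ∃ k : ℕ, 1 ≤ k ∧ k ≤ N ∧ s = (k : ℂ)} := by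
    refine ((Set.finite_Icc 1 N).image (fun k : ℕ => (k : ℂ))).subset ?_
    rintro s ⟨k, h1, h2, rfl⟩
    exact ⟨k, ⟨h1, h2⟩, rfl⟩
  exact hfin.isClosed

theorem isPreconnected_zetaDomain (N : ℕ) : IsPreconnected (zetaDomain N) := by
  let f : ℂ → ℂ := fun z => ⟨Real.exp z.re - 1, z.im⟩
  have hf : Continuous f := by
    have h : f = fun z : ℂ => ((Real.exp z.re - 1 : ℝ) : ℂ) + (z.im : ℂ) * Complex.I := by
      funext z
      apply Complex.ext <;> simp [f, Complex.exp_ofReal_re]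
    rw [h]
    fun_prop
  have hinj : Function.Injective f := by
    intro z w h
    have h1 := congrArg Complex.re h
    have h2 := congrArg Complex.im h
    simp only [f] at h1 h2
    exact Complex.ext (Real.exp_injective (by linarith)) h2
  have hfin : Set.Finite {s : ℂ | ∃ k : ℕ, 1 ≤ k ∧ k ≤ N ∧ s = (k : ℂ)} := by
    refine ((Set.finite_Icc 1 N).image (fun k : ℕ => (k : ℂ))).subset ?_
    rintro s ⟨k, h1, h2, rfl⟩
    exact ⟨k, ⟨h1, h2⟩, rfl⟩
  have hpre := (hfin.preimage hinj.injOn).countable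
  have hconn := (hpre.isConnected_compl_of_one_lt_rank
    (Complex.rank_real_complex ▸ Nat.one_lt_ofNat)).isPreconnected
  convert hconn.image f hf.continuousOn using 1
  ext s
  constructor
  · rintro ⟨h1, h2⟩
    have h1' : 0 < s.re + 1 := by
      have : -1 < s.re := h1
      linarith
    have hs : f ⟨Real.log (s.re + 1), s.im⟩ = s := by
      apply Complex.ext <;> simp [f, Real.exp_log h1']
    exact ⟨_, fun h => h2 (hs ▸ h), hs⟩
  · rintro ⟨z, h1, rfl⟩
    refine ⟨?_, h1⟩
    have := Real.exp_pos z.re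
    change -1 < Real.exp z.re - 1
    linarith

/-- The continuation is unique on its domain. -/
theorem IsBarnesZeta.eqOn {N : ℕ} {ω : Fin N → ℂ} {x : ℂ} {Z W : ℂ → ℂ}
    (hZ : IsBarnesZeta ω x Z) (hW : IsBarnesZeta ω x W) : Set.EqOn Z W (zetaDomain N) := by
  have hmem : ((N + 1 : ℕ) : ℂ) ∈ zetaDomain N := by
    refine ⟨?_, ?_⟩
    · change -1 < (((N + 1 : ℕ) : ℂ)).re
      rw [Complex.natCast_re]
      have : (0 : ℝ) ≤ ((N + 1 : ℕ) : ℝ) := Nat.cast_nonneg _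
      linarith
    · rintro ⟨k, -, h2, h3⟩
      have : N + 1 = k := by exact_mod_cast h3
      omega
  refine (hZ.differentiableOn.analyticOnNhd (isOpen_zetaDomain N)).eqOn_of_preconnected_of_eventuallyEq
    (hW.differentiableOn.analyticOnNhd (isOpen_zetaDomain N)) (isPreconnected_zetaDomain N) hmem ?_
  have hopen : IsOpen {s : ℂ | (N : ℝ) < s.re} := isOpen_lt continuous_const Complex.continuous_re
  have hN : ((N + 1 : ℕ) : ℂ) ∈ {s : ℂ | (N : ℝ) < s.re} := by
    change (N : ℝ) < (((N + 1 : ℕ) : ℂ)).re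
    rw [Complex.natCast_re]
    push_cast
    linarith
  filter_upwards [hopen.mem_nhds hN] with s hs
  exact (hZ.hasSum s hs).unique (hW.hasSum s hs)

/-- The Barnes zeta function `s ↦ ζ_N(s, x | ω)`, continued analytically. -/
noncomputable def barnesZeta {N : ℕ} (ω : Fin N → ℂ) (x : ℂ) : ℂ → ℂ :=
  Classical.epsilon (IsBarnesZeta ω x)

/-- The multiple Gamma function `Γ_N(x | ω) = exp (∂/∂s ζ_N(s, x | ω) at s = 0)`. -/
noncomputable def multiGamma {N : ℕ} (ω : Fin N → ℂ) (x : ℂ) : ℂ :=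
  Complex.exp (deriv (barnesZeta ω x) 0)

/-- `Γ₁(x | ω)`. -/
noncomputable def Gamma1 (x ω : ℂ) : ℂ := multiGamma ![ω] x

/-- `Γ₂(x | ω₁, ω₂)`. -/
noncomputable def Gamma2 (x ω₁ ω₂ : ℂ) : ℂ := multiGamma ![ω₁, ω₂] x

/-- Barnes' double sine function `S₂(x | ω₁, ω₂)`. -/
noncomputable def S2 (x ω₁ ω₂ : ℂ) : ℂ := Gamma2 (ω₁ + ω₂ - x) ω₁ ω₂ / Gamma2 x ω₁ ω₂

/-- The multiple infinite product `(z; p₁, …, p_m)_∞`. -/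
noncomputable def qProd {m : ℕ} (z : ℂ) (p : Fin m → ℂ) : ℂ :=
  ∏' n : Fin m → ℕ, (1 - z * ∏ i, p i ^ n i)

/-- Matrices are written in the ordered basis `e₁⊗e₁, e₁⊗e₂, e₂⊗e₁, e₂⊗e₂` of `ℂ² ⊗ ℂ²`. -/
abbrev Mat4 : Type := Matrix (Fin 4) (Fin 4) ℂ

/-- The flip `v ⊗ w ↦ w ⊗ v`. -/
def flipP : Mat4 :=
  !![1, 0, 0, 0;
     0, 0, 1, 0;
     0, 1, 0, 0;
     0, 0, 0, 1]

/-- `A₂₁` for `A = A₁₂`. -/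
def op21 (A : Mat4) : Mat4 := flipP * A * flipP

/-- The symmetric eight-vertex matrix with entries `a, b, c, d`. -/
def eightVertex (a b c d : ℂ) : Mat4 :=
  !![a, 0, 0, d;
     0, b, c, 0;
     0, c, b, 0;
     d, 0, 0, a]

/-- The six-vertex matrix with diagonal `1, b, b, 1` and off-diagonal entries `c, c'`. -/
def sixVertex (b c c' : ℂ) : Mat4 :=
  !![1, 0, 0, 0;
     0, b, c, 0;
     0, c', b, 0;
     0, 0, 0, 1]

/-- The spectral variable `x = iβ/π`. -/
noncomputable def spec (β : ℂ) : ℂ := Complex.I * β / Real.pi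

/-- `β` avoids the poles of all the Gamma functions that occur in the formulae below:
`iβ/π` is none of `±(m + n r)`, `±(1 - n r)` with integers `m, n ≥ 0`. -/
def Generic (β r : ℂ) : Prop :=
  ∀ m n : ℕ,
    spec β ≠ m + n * r ∧ spec β ≠ -(m + n * r) ∧
    spec β ≠ 1 - n * r ∧ spec β ≠ -(1 - n * r)

/-! ### R-matrices -/

/-- Normalization of the `R`-matrix of the double Yangian. -/
noncomputable def rhoDY (β : ℂ) : ℂ :=
  Gamma1 (spec β) 2 * Gamma1 (2 + spec β) 2 / Gamma1 (1 + spec β) 2 ^ 2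

/-- The `R`-matrix of the double Yangian `DY`. -/
noncomputable def RDY (β : ℂ) : Mat4 :=
  rhoDY β • sixVertex
    (Complex.I * β / (Complex.I * β + Real.pi))
    (Real.pi / (Complex.I * β + Real.pi))
    (Real.pi / (Complex.I * β + Real.pi))

/-- Normalization of the `R`-matrices of `DY_r^{V8}` and `DY_r^{V6}`. -/
noncomputable def rhoV8 (β r : ℂ) : ℂ :=
  -(S2 (-spec β) r 2 * S2 (1 + spec β) r 2 / (S2 (spec β) r 2 * S2 (1 - spec β) r 2)
    * Complex.cot (Complex.I * β / 2))

/-- The `R`-matrix of `DY_r^{V8}`. -/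
noncomputable def RV8 (β r : ℂ) : Mat4 :=
  rhoV8 β r • eightVertex
    (Complex.cos (Complex.I * β / (2 * r)) * Complex.cos (Real.pi / (2 * r))
      / Complex.cos ((Real.pi + Complex.I * β) / (2 * r)))
    (Complex.sin (Complex.I * β / (2 * r)) * Complex.cos (Real.pi / (2 * r))
      / Complex.sin ((Real.pi + Complex.I * β) / (2 * r)))
    (Complex.cos (Complex.I * β / (2 * r)) * Complex.sin (Real.pi / (2 * r))
      / Complex.sin ((Real.pi + Complex.I * β) / (2 * r)))
    (-(Complex.sin (Complex.I * β / (2 * r)) * Complex.sin (Real.pi / (2 * r))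
      / Complex.cos ((Real.pi + Complex.I * β) / (2 * r))))

/-- The `R`-matrix of `DY_r^{V6}`. -/
noncomputable def RV6 (β r : ℂ) : Mat4 :=
  rhoV8 β r • sixVertex
    (Complex.sin (Complex.I * β / r) / Complex.sin ((Real.pi + Complex.I * β) / r))
    (Complex.sin (Real.pi / r) / Complex.sin ((Real.pi + Complex.I * β) / r))
    (Complex.sin (Real.pi / r) / Complex.sin ((Real.pi + Complex.I * β) / r))

/-- Normalization of the `R`-matrix of `DY_r^F`. -/
noncomputable def rhoF (β r : ℂ) : ℂ :=
  S2 (1 + spec β) r 2 ^ 2 / (S2 (spec β) r 2 * S2 (2 + spec β) r 2)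

/-- The `R`-matrix of `DY_r^F`. -/
noncomputable def RF (β r : ℂ) : Mat4 :=
  rhoF β r • sixVertex
    (Complex.sin (Complex.I * β / r) / Complex.sin ((Real.pi + Complex.I * β) / r))
    (Complex.exp (β / r) *
      (Complex.sin (Real.pi / r) / Complex.sin ((Real.pi + Complex.I * β) / r)))
    (Complex.exp (-(β / r)) *
      (Complex.sin (Real.pi / r) / Complex.sin ((Real.pi + Complex.I * β) / r)))

/-- The (vertex type) `R`-matrix of the quantum affine algebra `U_q`. -/
noncomputable def RUq (z q : ℂ) : Mat4 :=
  (q ^ (-(1 / 2) : ℂ) * (qProd (q ^ 2 * z ^ 2) ![q ^ 4] ^ 2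
      / (qProd (z ^ 2) ![q ^ 4] * qProd (q ^ 4 * z ^ 2) ![q ^ 4]))) •
    sixVertex
      (q * (1 - z ^ 2) / (1 - q ^ 2 * z ^ 2))
      (z * (1 - q ^ 2) / (1 - q ^ 2 * z ^ 2))
      (z * (1 - q ^ 2) / (1 - q ^ 2 * z ^ 2))

/-! ### The elliptic twist -/

/-- `a_E + d_E`. -/
noncomputable def ellAPlus (z p q : ℂ) : ℂ :=
  qProd (-(p ^ (1 / 2 : ℂ) * q * z)) ![p] / qProd (-(p ^ (1 / 2 : ℂ) * q⁻¹ * z)) ![p]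

/-- `a_E - d_E`. -/
noncomputable def ellAMinus (z p q : ℂ) : ℂ :=
  qProd (p ^ (1 / 2 : ℂ) * q * z) ![p] / qProd (p ^ (1 / 2 : ℂ) * q⁻¹ * z) ![p]

/-- `b_E + c_E`. -/
noncomputable def ellBPlus (z p q : ℂ) : ℂ :=
  qProd (-(p * q * z)) ![p] / qProd (-(p * q⁻¹ * z)) ![p]

/-- `b_E - c_E`. -/
noncomputable def ellBMinus (z p q : ℂ) : ℂ :=
  qProd (p * q * z) ![p] / qProd (p * q⁻¹ * z) ![p]

/-- Normalization of the elliptic twist. -/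
noncomputable def ellRho (z p q : ℂ) : ℂ :=
  qProd (p * z ^ 2) ![p, q ^ 4] * qProd (p * q ^ 4 * z ^ 2) ![p, q ^ 4]
    / qProd (p * q ^ 2 * z ^ 2) ![p, q ^ 4] ^ 2

/-- The twist `E^{(1)}(z; p)`. -/
noncomputable def E1 (z p q : ℂ) : Mat4 :=
  ellRho z p q • eightVertex
    ((ellAPlus z p q + ellAMinus z p q) / 2)
    ((ellBPlus z p q + ellBMinus z p q) / 2)
    ((ellBPlus z p q - ellBMinus z p q) / 2)
    ((ellAPlus z p q - ellAMinus z p q) / 2)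

/-! ### The scaled twist -/

/-- `a_E - d_E`. -/
noncomputable def aMinus (β r : ℂ) : ℂ :=
  Gamma1 (r - 1 + spec β) (2 * r) / Gamma1 (r + 1 + spec β) (2 * r)

/-- `b_E - c_E`. -/
noncomputable def bMinus (β r : ℂ) : ℂ :=
  Gamma1 (2 * r - 1 + spec β) (2 * r) / Gamma1 (2 * r + 1 + spec β) (2 * r)

/-- `a_E`, from `a_E + d_E = 1`. -/
noncomputable def aE (β r : ℂ) : ℂ := (1 + aMinus β r) / 2

/-- `d_E`, from `a_E + d_E = 1`. -/
noncomputable def dE (β r : ℂ) : ℂ := (1 - aMinus β r) / 2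

/-- `b_E`, from `b_E + c_E = 1`. -/
noncomputable def bE (β r : ℂ) : ℂ := (1 + bMinus β r) / 2

/-- `c_E`, from `b_E + c_E = 1`. -/
noncomputable def cE (β r : ℂ) : ℂ := (1 - bMinus β r) / 2

/-- Normalization of the scaled twist. -/
noncomputable def rhoE (β r : ℂ) : ℂ :=
  Gamma2 (r + 1 + spec β) r 2 ^ 2 / (Gamma2 (r + spec β) r 2 * Gamma2 (r + 2 + spec β) r 2)

/-- The twist `E^{(2)}(β; r)`. -/
noncomputable def E2 (β r : ℂ) : Mat4 :=
  rhoE β r • eightVertex (aE β r) (bE β r) (cE β r) (dE β r)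

/-- The scaling gauge `((-log q)/2)^{-(σ₁⊗σ₁)/(2r)}`: it acts as `u⁻¹` on the `+1` eigenspace and
as `u` on the `-1` eigenspace of `σ₁ ⊗ σ₁`, where `u = ((-log q)/2)^{1/(2r)}`.
It does not depend on the spectral parameter. -/
noncomputable def scalingGauge (q : ℝ) (r : ℂ) : Mat4 :=
  let u : ℂ := ((-Real.log q / 2 : ℝ) : ℂ) ^ (1 / (2 * r))
  eightVertex ((u⁻¹ + u) / 2) ((u⁻¹ + u) / 2) ((u⁻¹ - u) / 2) ((u⁻¹ - u) / 2)

/-! ### Composition with the rigid twist -/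

/-- The rigid twist `K`. -/
noncomputable def K : Mat4 :=
  (1 / 2 : ℂ) • !![1, -Complex.I, -Complex.I, -1;
                   -1, -Complex.I, Complex.I, -1;
                   -1, Complex.I, -Complex.I, -1;
                   1, Complex.I, Complex.I, -1]

/-- The diagonal twist `K^{(6)}(β)`. -/
noncomputable def K6 (β r : ℂ) : Mat4 :=
  !![1, 0, 0, 0;
     0, Complex.exp (β / (2 * r)), 0, 0;
     0, 0, Complex.exp (-(β / (2 * r))), 0;
     0, 0, 0, 1]

/-- `K^{(8)} = K^{(6)} K⁻¹`. -/
noncomputable def K8 (β r : ℂ) : Mat4 := K6 β r * K⁻¹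

/-- `E^{(3)} = K⁻¹ E^{(2)}`. -/
noncomputable def E3 (β r : ℂ) : Mat4 := K⁻¹ * E2 β r

/-- `F^{(7)} = K^{(8)} E^{(2)}`. -/
noncomputable def F7 (β r : ℂ) : Mat4 := K8 β r * E2 β r

end DoubleYangian

/-!
Up to the rigid twist `K` and the diagonal twist `K6`, all matrices in the theorem are symmetric
eight-vertex matrices. These commute, are fixed by the flip, and are diagonal in the basis `e₁⊗e₁ ±
e₂⊗e₂`, `e₁⊗e₂ ± e₂⊗e₁`. The matrix identities therefore reduce to scalar identities between the
eigenvalues (`aMinus_neg_mul_cos`, `bMinus_neg_mul_sin`) and between the normalizations (`rhoV8_eq`,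
`rhoF_eq`), and the remaining twists are obtained by composing and inverting (`twist_comp`,
`twist_inv`).

The scalar identities use only the existence of the Barnes Gamma functions, the functional equation
`Γ_N(x) = Γ_{N-1}(x) Γ_N(x + ω₁)` (`multiGamma_shift`), and the fact that
`Γ₁(y | ω) Γ₁(ω - y | ω) sin(πy/ω)` is independent of `y` (`Gamma1_mul_Gamma1_sub_mul_sin`). All
factors depend on the Gamma functions only through ratios, so the constant is never needed.

The analysis rests on the kernel `h(t) = e^{-xt} ∏ (1 - e^{-ω_i t})⁻¹`. For `Re x > 0` it gives
`Γ(s) ζ_N(s, x) = ∫₀^∞ t^{s-1} h(t) dt`, and subtracting the Taylor polynomial of `t^N e^t h(t)`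
continues the zeta function to `Re s > -1`; other `x` are reached by the functional equation. In an
integral combination `H = ∑ mᵢ h_{xᵢ}` that stays bounded at the origin, with limit `c`, both the
Gamma functions and the infinite products `P(x, t) = ∏ₙ (1 - e^{-t(x + n·ω)})` are controlled by the
same integral `J = ∫₀^∞ (H(u) - c e^{-u}) du/u`: on the one hand `∏ Γ_N(xᵢ)^{mᵢ} = e^J`
(`prod_multiGamma_zpow`), on the other hand `∏ P(xᵢ, t)^{mᵢ} = exp (-∑_{k ≥ 1} H(kt)/k)`, where the
sum is `-c log (1 - e^{-t})` plus a Riemann sum for `J`. Hence `t^{-c} ∏ P(xᵢ, t)^{mᵢ}` tends to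
`∏ Γ_N(xᵢ)^{-mᵢ}` (`tendsto_prod_coneProd`). With `t = -log q` this is the scaling limit; it is
applied to a first difference of `log Γ₁` for the matrix entries (`tendsto_coneProd_div`) and to a
second difference of `log Γ₂` for the normalization (`tendsto_coneProd_two`). The products
with a `+` sign are quotients `P(x, 2t) / P(x, t)`, so that their ratios tend to a power of `2`; the
gauge `scalingGauge` absorbs the remaining powers of `t` and `2`.
-/

namespace DoubleYangian

open Complex Filter Topology MeasureTheory

/-! ### Exponential sums over the cone of periods -/

/-- The point `x + n₁ω₁ + ⋯ + n_Nω_N` of the cone with apex `x`. -/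
noncomputable def conePoint {N : ℕ} (ω : Fin N → ℂ) (x : ℂ) (n : Fin N → ℕ) : ℂ :=
  x + ∑ i, (n i : ℂ) * ω i

/-- The closed form `e^{-xt} ∏ (1 - e^{-ω_i t})⁻¹` of the exponential sum `∑ₙ e^{-t(x + n·ω)}`,
whose Mellin transform is `Γ(s) ζ_N(s, x | ω)`. -/
noncomputable def expKernel {N : ℕ} (ω : Fin N → ℂ) (x : ℂ) (t : ℝ) : ℂ :=
  exp (-(x * t)) * ∏ i, (1 - exp (-(ω i * t)))⁻¹

theorem conePoint_cons {N : ℕ} (ω : Fin (N + 1) → ℂ) (x : ℂ) (k : ℕ) (n : Fin N → ℕ) :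
    conePoint ω x (Fin.cons k n) = k * ω 0 + conePoint (Fin.tail ω) x n := by
  simp only [conePoint, Fin.sum_univ_succ, Fin.cons_zero, Fin.cons_succ, Fin.tail]
  ring

theorem conePoint_cons_succ {N : ℕ} (ω : Fin (N + 1) → ℂ) (x : ℂ) (k : ℕ) (n : Fin N → ℕ) :
    conePoint ω x (Fin.cons (k + 1) n) = conePoint ω (x + ω 0) (Fin.cons k n) := by
  simp only [conePoint, Fin.sum_univ_succ, Fin.cons_zero, Fin.cons_succ]
  push_cast
  ring

theorem conePoint_re {N : ℕ} (ω : Fin N → ℂ) (x : ℂ) (n : Fin N → ℕ) :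
    (conePoint ω x n).re = x.re + ∑ i, (n i : ℝ) * (ω i).re := by
  simp [conePoint]

theorem conePoint_re_ge {N : ℕ} {ω : Fin N → ℂ} (hω : ∀ i, 0 < (ω i).re) (x : ℂ)
    (n : Fin N → ℕ) : x.re ≤ (conePoint ω x n).re := by
  rw [conePoint_re]
  have : 0 ≤ ∑ i, (n i : ℝ) * (ω i).re :=
    Finset.sum_nonneg fun i _ => mul_nonneg (Nat.cast_nonneg _) (hω i).le
  linarith

/-- The multi-indices with first entry `0`, and the remaining ones lowered by one in the first
entry. -/
def splitFirst (N : ℕ) : (Fin N → ℕ) ⊕ (Fin (N + 1) → ℕ) ≃ (Fin (N + 1) → ℕ) where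
  toFun := Sum.elim (fun n => Fin.cons 0 n) (fun n => Fin.cons (n 0 + 1) (Fin.tail n))
  invFun n := if n 0 = 0 then Sum.inl (Fin.tail n) else Sum.inr (Fin.cons (n 0 - 1) (Fin.tail n))
  left_inv := by
    rintro (n | n) <;> simp
  right_inv := by
    intro n
    by_cases h : n 0 = 0
    · simp only [h, if_true, Sum.elim_inl]
      conv_rhs => rw [← Fin.cons_self_tail n, h]
    · have h' : n 0 - 1 + 1 = n 0 := by omega
      simp [h, h']

theorem conePoint_splitFirst_inl {N : ℕ} (ω : Fin (N + 1) → ℂ) (x : ℂ) (n : Fin N → ℕ) :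
    conePoint ω x (splitFirst N (Sum.inl n)) = conePoint (Fin.tail ω) x n := by
  change conePoint ω x (Fin.cons 0 n) = _
  rw [conePoint_cons]
  simp

theorem conePoint_splitFirst_inr {N : ℕ} (ω : Fin (N + 1) → ℂ) (x : ℂ) (n : Fin (N + 1) → ℕ) :
    conePoint ω x (splitFirst N (Sum.inr n)) = conePoint ω (x + ω 0) n := by
  change conePoint ω x (Fin.cons (n 0 + 1) (Fin.tail n)) = _
  rw [conePoint_cons_succ, Fin.cons_self_tail]

theorem norm_exp_neg_mul_lt_one {w : ℂ} (hw : 0 < w.re) {t : ℝ} (ht : 0 < t) :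
    ‖exp (-(w * t))‖ < 1 := by
  rw [norm_exp, Real.exp_lt_one_iff]
  simp only [neg_re, re_mul_ofReal]
  have := mul_pos hw ht
  linarith

theorem one_sub_exp_neg_ne_zero {w : ℂ} (hw : 0 < w.re) {t : ℝ} (ht : 0 < t) :
    1 - exp (-(w * t)) ≠ 0 := by
  intro h
  have h1 := norm_exp_neg_mul_lt_one hw ht
  rw [← sub_eq_zero.mp h] at h1
  simp at h1

theorem hasSum_expKernel {N : ℕ} {ω : Fin N → ℂ} (hω : ∀ i, 0 < (ω i).re) (x : ℂ)
    {t : ℝ} (ht : 0 < t) :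
    HasSum (fun n : Fin N → ℕ => exp (-(conePoint ω x n * t))) (expKernel ω x t) := by
  induction N with
  | zero =>
    convert hasSum_unique (fun n : Fin 0 → ℕ => exp (-(conePoint ω x n * t))) using 1
    simp [expKernel, conePoint]
  | succ N ih =>
    have h1 := ih (ω := Fin.tail ω) (fun i => hω i.succ)
    have h2 := hasSum_geometric_of_norm_lt_one (norm_exp_neg_mul_lt_one (hω 0) ht)
    have hs : Summable fun p : ℕ × (Fin N → ℕ) =>
        exp (-(ω 0 * t)) ^ p.1 * exp (-(conePoint (Fin.tail ω) x p.2 * t)) :=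
      summable_mul_of_summable_norm (f := fun k : ℕ => exp (-(ω 0 * t)) ^ k)
        (g := fun n => exp (-(conePoint (Fin.tail ω) x n * t)))
        (summable_norm_iff.mpr h2.summable) (summable_norm_iff.mpr h1.summable)
    have h3 := h2.mul h1 hs
    have e1 : expKernel ω x t =
        (1 - exp (-(ω 0 * t)))⁻¹ * expKernel (Fin.tail ω) x t := by
      simp only [expKernel, Fin.prod_univ_succ, Fin.tail]
      ring
    have e2 : (fun n : Fin (N + 1) → ℕ => exp (-(conePoint ω x n * t))) ∘
        (Fin.consEquiv fun _ : Fin (N + 1) => ℕ) = fun p =>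
        exp (-(ω 0 * t)) ^ p.1 * exp (-(conePoint (Fin.tail ω) x p.2 * t)) := by
      funext p
      change exp (-(conePoint ω x (Fin.cons p.1 p.2) * t)) = _
      rw [conePoint_cons, ← exp_nat_mul, ← exp_add]
      congr 1
      ring
    rw [← (Fin.consEquiv fun _ : Fin (N + 1) => ℕ).hasSum_iff, e1, e2]
    exact h3

/-- The absolute values of the exponential sum form the same sum for the real parts of the
parameters. -/
theorem hasSum_norm_exp {N : ℕ} {ω : Fin N → ℂ} (hω : ∀ i, 0 < (ω i).re) (x : ℂ)
    {t : ℝ} (ht : 0 < t) :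
    HasSum (fun n : Fin N → ℕ => Real.exp (-((conePoint ω x n).re * t)))
      (expKernel (fun i => ((ω i).re : ℂ)) x.re t).re := by
  have h := hasSum_expKernel (ω := fun i => ((ω i).re : ℂ)) (by simpa using hω) (x.re : ℂ) ht
  convert hasSum_re h using 1
  funext n
  rw [conePoint_re, ← exp_ofReal_re]
  congr 2
  simp [conePoint]

theorem expKernel_shift {N : ℕ} (ω : Fin N → ℂ) (x y : ℂ) (t : ℝ) :
    expKernel ω (x + y) t = exp (-(y * t)) * expKernel ω x t := by
  simp only [expKernel, ← mul_assoc, ← exp_add]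
  congr 2
  ring

theorem continuousOn_expKernel {N : ℕ} {ω : Fin N → ℂ} (hω : ∀ i, 0 < (ω i).re) (x : ℂ) :
    ContinuousOn (expKernel ω x) (Set.Ioi 0) := by
  unfold expKernel
  refine ContinuousOn.mul (by fun_prop) (continuousOn_finsetProd _ fun i _ => ?_)
  exact ContinuousOn.inv₀ (by fun_prop) fun t ht => one_sub_exp_neg_ne_zero (hω i) ht

theorem exp_neg_mul_isBigO {a b : ℝ} (h : a ≤ b) :
    (fun t : ℝ => Real.exp (-b * t)) =O[atTop] fun t => Real.exp (-a * t) := by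
  refine Asymptotics.IsBigO.of_bound 1 ?_
  filter_upwards [eventually_ge_atTop 0] with t ht
  rw [one_mul, Real.norm_eq_abs, Real.norm_eq_abs, Real.abs_exp, Real.abs_exp, Real.exp_le_exp]
  nlinarith

/-- Decay of the exponential kernel at infinity. -/
theorem expKernel_isBigO_atTop {N : ℕ} {ω : Fin N → ℂ} (hω : ∀ i, 0 < (ω i).re) (x : ℂ) :
    expKernel ω x =O[atTop] fun t => Real.exp (-x.re * t) := by
  have h1 : (fun t : ℝ => exp (-(x * t))) =O[atTop] fun t => Real.exp (-x.re * t) := by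
    refine Asymptotics.isBigO_of_le _ fun t => ?_
    simp [norm_exp]
  have h2 : (fun t : ℝ => ∏ i, (1 - exp (-(ω i * t)))⁻¹) =O[atTop] fun _ => (1 : ℝ) := by
    have hlim : Tendsto (fun t : ℝ => ∏ i, (1 - exp (-(ω i * t)))⁻¹) atTop
        (𝓝 (∏ _i : Fin N, (1 - 0 : ℂ)⁻¹)) := by
      refine tendsto_finsetProd _ fun i _ => (tendsto_const_nhds.sub ?_).inv₀ (by simp)
      rw [tendsto_zero_iff_norm_tendsto_zero]
      simp only [norm_exp, neg_re, re_mul_ofReal]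
      exact Real.tendsto_exp_neg_atTop_nhds_zero.comp (tendsto_id.const_mul_atTop (hω i))
    exact hlim.isBigO_one ℝ
  have h3 := h1.mul h2
  simp only [mul_one] at h3
  exact h3

/-- The Taylor expansion of an analytic function at the origin. -/
theorem exists_taylor_isBigO {g : ℂ → ℂ} (hg : AnalyticAt ℂ g 0) (n : ℕ) :
    ∃ c : ℕ → ℂ, (fun z => g z - ∑ k ∈ Finset.range n, c k * z ^ k) =O[𝓝 0] fun z => ‖z‖ ^ n := by
  obtain ⟨p, hp⟩ := hg
  refine ⟨p.coeff, ?_⟩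
  have h := hp.isBigO_sub_partialSum_pow n
  simpa only [zero_add, FormalMultilinearSeries.partialSum,
    FormalMultilinearSeries.apply_eq_pow_smul_coeff, smul_eq_mul, mul_comm] using h

theorem tendsto_ofReal_nhdsGT_zero : Tendsto (fun t : ℝ => (t : ℂ)) (𝓝[>] 0) (𝓝 0) := by
  have h : Tendsto (fun t : ℝ => (t : ℂ)) (𝓝 0) (𝓝 ((0 : ℝ) : ℂ)) := continuous_ofReal.tendsto 0
  rw [ofReal_zero] at h
  exact h.mono_left nhdsWithin_le_nhds

/-- `(1 - e^{-δz}) / z` extends analytically across the origin. -/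
theorem exists_analyticAt_one_sub_exp_div (δ : ℂ) :
    ∃ d : ℂ → ℂ, AnalyticAt ℂ d 0 ∧ d 0 = δ ∧ ∀ z, 1 - exp (-(δ * z)) = z * d z := by
  have hd : Differentiable ℂ fun z => 1 - exp (-(δ * z)) := by fun_prop
  have hderiv : HasDerivAt (fun z => 1 - exp (-(δ * z))) δ 0 := by
    simpa using ((((hasDerivAt_id (0 : ℂ)).const_mul δ).neg.cexp).const_sub 1)
  refine ⟨dslope (fun z => 1 - exp (-(δ * z))) 0, ?_, ?_, fun z => ?_⟩
  · have h1 : DifferentiableOn ℂ (dslope (fun z => 1 - exp (-(δ * z))) 0) Set.univ :=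
      (differentiableOn_dslope Filter.univ_mem).mpr hd.differentiableOn
    exact h1.analyticAt Filter.univ_mem
  · rw [dslope_same, hderiv.deriv]
  · have h := sub_smul_dslope (fun z => 1 - exp (-(δ * z))) 0 z
    simp only [sub_zero, mul_zero, neg_zero, exp_zero, sub_self, smul_eq_mul] at h
    exact h.symm

/-- `z / (1 - e^{-ωz})` extends analytically across the origin. -/
theorem exists_analyticAt_div_one_sub_exp {ω : ℂ} (hω : ω ≠ 0) :
    ∃ g : ℂ → ℂ, AnalyticAt ℂ g 0 ∧ g 0 = ω⁻¹ ∧ ∀ z ≠ 0, g z = z * (1 - exp (-(ω * z)))⁻¹ := by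
  obtain ⟨d, hd, hd0, hd'⟩ := exists_analyticAt_one_sub_exp_div ω
  refine ⟨fun z => (d z)⁻¹, hd.inv (by rwa [hd0]), by simp only [hd0], fun z hz => ?_⟩
  rw [hd', mul_inv, mul_inv_cancel_left₀ hz]

theorem exists_analyticAt_expKernel {N : ℕ} {ω : Fin N → ℂ} (hω : ∀ i, ω i ≠ 0) (x : ℂ) :
    ∃ g : ℂ → ℂ, AnalyticAt ℂ g 0 ∧
      ∀ t : ℝ, t ≠ 0 → g t = (t : ℂ) ^ N * expKernel ω x t := by
  choose g hg _ hg' using fun i => exists_analyticAt_div_one_sub_exp (hω i)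
  refine ⟨fun z => exp (-(x * z)) * ∏ i, g i z, ?_, fun t ht => ?_⟩
  · refine AnalyticAt.mul (by fun_prop) ?_
    exact Finset.analyticAt_fun_prod _ fun i _ => hg i
  · simp only [hg' _ _ (ofReal_ne_zero.mpr ht), expKernel, Finset.prod_mul_distrib]
    simp
    ring

theorem expKernel_isBigO_zero {N : ℕ} {ω : Fin N → ℂ} (hω : ∀ i, ω i ≠ 0) (x : ℂ) :
    expKernel ω x =O[𝓝[>] 0] fun t => t ^ (-(N : ℝ)) := by
  obtain ⟨g, hg, hg'⟩ := exists_analyticAt_expKernel hω x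
  have h1 : (fun t : ℝ => g t) =O[𝓝[>] 0] fun _ => (1 : ℝ) :=
    (hg.continuousAt.tendsto.comp tendsto_ofReal_nhdsGT_zero).isBigO_one ℝ
  have h2 := h1.norm_left.mul (Asymptotics.isBigO_refl (fun t : ℝ => ‖t ^ (-(N : ℝ))‖) (𝓝[>] 0))
  refine ((h2.congr' ?_ ?_).of_norm_left).of_norm_right
  · filter_upwards [self_mem_nhdsWithin] with t ht
    have ht' : (0 : ℝ) < t := ht
    rw [hg' t ht'.ne', norm_mul, Real.rpow_neg ht'.le, Real.rpow_natCast]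
    simp only [norm_pow, norm_real, norm_inv, Real.norm_eq_abs, abs_of_pos ht']
    field_simp
  · filter_upwards with t using by simp

/-! ### Analytic continuation of the Barnes zeta function for apices in the right half plane -/

theorem mellinConvergent_exp_neg_mul {w s : ℂ} (hw : 0 < w.re) (hs : 0 < s.re) :
    MellinConvergent (fun t : ℝ => exp (-(w * t))) s := by
  refine mellinConvergent_of_isBigO_rpow_exp (a := w.re) (b := 0) hw ?_ ?_ ?_ hs
  · exact (Continuous.continuousOn (by fun_prop)).locallyIntegrableOn measurableSet_Ioi
  · refine Asymptotics.isBigO_of_le _ fun t => ?_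
    simp [norm_exp]
  · have h : Tendsto (fun t : ℝ => exp (-(w * t))) (𝓝[>] 0) (𝓝 (exp (-(w * (0 : ℝ))))) :=
      ((by fun_prop : Continuous fun t : ℝ => exp (-(w * t))).tendsto 0).mono_left
        nhdsWithin_le_nhds
    simpa using h.isBigO_one ℝ

/-- Euler's integral `∫₀^∞ t^{s-1} e^{-wt} dt = Γ(s) w^{-s}` in the half plane `Re w > 0`, from the
case of real `w` by analytic continuation in `w`. -/
theorem mellin_exp_neg_mul {w s : ℂ} (hw : 0 < w.re) (hs : 0 < s.re) :
    mellin (fun t : ℝ => exp (-(w * t))) s = Gamma s * w ^ (-s) := by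
  have hopen : IsOpen {w : ℂ | 0 < w.re} := isOpen_lt continuous_const continuous_re
  have hL : AnalyticOnNhd ℂ (fun w => mellin (fun t : ℝ => exp (-(w * t))) s)
      {w : ℂ | 0 < w.re} := by
    refine DifferentiableOn.analyticOnNhd (fun w₀ hw₀ => ?_) hopen
    have hw₀' : 0 < w₀.re := hw₀
    have hmeas : ∀ (a : ℂ) (f : ℝ → ℂ), Continuous f →
        AEStronglyMeasurable (fun t : ℝ => (t : ℂ) ^ a • f t) (volume.restrict (Set.Ioi 0)) := by
      intro a f hf
      refine ContinuousOn.aestronglyMeasurable (fun t ht => ?_) measurableSet_Ioi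
      exact ((continuousAt_ofReal_cpow_const t a (Or.inr (ne_of_gt ht))).smul
        hf.continuousAt).continuousWithinAt
    have hbound := (mellinConvergent_exp_neg_mul (w := ((w₀.re / 2 : ℝ) : ℂ)) (s := s + 1)
      (by simpa using hw₀') (by simp; linarith)).norm
    have key := hasDerivAt_integral_of_dominated_loc_of_deriv_le (𝕜 := ℂ)
      (μ := volume.restrict (Set.Ioi (0 : ℝ)))
      (F := fun w t => (t : ℂ) ^ (s - 1) • exp (-(w * t)))
      (F' := fun w t => (t : ℂ) ^ (s - 1) • (exp (-(w * t)) * (-t)))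
      (x₀ := w₀) (s := {w : ℂ | w₀.re / 2 < w.re})
      ((isOpen_lt continuous_const continuous_re).mem_nhds (by
        change w₀.re / 2 < w₀.re
        linarith))
      (Eventually.of_forall fun w => hmeas _ _ (by fun_prop))
      (mellinConvergent_exp_neg_mul hw₀' hs) (hmeas _ _ (by fun_prop)) ?_ hbound ?_
    · exact key.2.differentiableAt.differentiableWithinAt
    · filter_upwards [ae_restrict_mem measurableSet_Ioi] with t ht w hw
      have ht' : (0 : ℝ) < t := ht
      have hw' : w₀.re / 2 < w.re := hw
      simp only [norm_smul, norm_mul, norm_exp, norm_cpow_eq_rpow_re_of_pos ht', norm_neg,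
        norm_real, Real.norm_eq_abs, abs_of_pos ht', neg_re, re_mul_ofReal, ofReal_re, sub_re,
        one_re, add_sub_cancel_right]
      have h1 : t ^ s.re = t ^ (s.re - 1) * t := by
        rw [← Real.rpow_add_one ht'.ne', sub_add_cancel]
      rw [h1]
      have h2 : Real.exp (-(w.re * t)) ≤ Real.exp (-(w₀.re / 2 * t)) := by
        rw [Real.exp_le_exp, neg_le_neg_iff]
        exact mul_le_mul_of_nonneg_right hw'.le ht'.le
      calc t ^ (s.re - 1) * (Real.exp (-(w.re * t)) * t)
          ≤ t ^ (s.re - 1) * (Real.exp (-(w₀.re / 2 * t)) * t) := by gcongr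
        _ = _ := by ring
    · filter_upwards with t w _
      have h := (((hasDerivAt_id w).mul_const (t : ℂ)).neg.cexp).const_mul ((t : ℂ) ^ (s - 1))
      simpa using h
  have hR : AnalyticOnNhd ℂ (fun w => Gamma s * w ^ (-s)) {w : ℂ | 0 < w.re} := by
    refine DifferentiableOn.analyticOnNhd (fun w₀ hw₀ => ?_) hopen
    exact ((differentiableAt_id.cpow_const (Or.inl hw₀)).const_mul _).differentiableWithinAt
  have hpre : IsPreconnected {w : ℂ | 0 < w.re} := (convex_halfSpace_re_gt 0).isPreconnected
  have hreal : ∀ r : ℝ, 0 < r → mellin (fun t : ℝ => exp (-((r : ℂ) * t))) s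
      = Gamma s * (r : ℂ) ^ (-s) := by
    intro r hr
    rw [mellin, cpow_neg, ← inv_cpow _ _ (by rw [arg_ofReal_of_nonneg hr.le]; exact Real.pi_pos.ne),
      ← one_div, mul_comm, ← integral_cpow_mul_exp_neg_mul_Ioi hs hr]
    simp only [smul_eq_mul]
  refine hL.eqOn_of_preconnected_of_frequently_eq hR hpre (z₀ := 1) (by simp) ?_ hw
  have htend : Tendsto (fun r : ℝ => (r : ℂ)) (𝓝[>] 1) (𝓝[≠] 1) := by
    refine tendsto_nhdsWithin_iff.mpr ⟨?_, ?_⟩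
    · have h : Tendsto (fun t : ℝ => (t : ℂ)) (𝓝 1) (𝓝 ((1 : ℝ) : ℂ)) := continuous_ofReal.tendsto 1
      rw [ofReal_one] at h
      exact h.mono_left nhdsWithin_le_nhds
    · filter_upwards [self_mem_nhdsWithin] with r hr
      have : (1 : ℝ) < r := hr
      simpa using this.ne'
  refine htend.frequently (Eventually.frequently ?_)
  filter_upwards [self_mem_nhdsWithin] with r hr
  exact hreal r (lt_trans one_pos hr)

theorem mellinConvergent_expKernel {N : ℕ} {ω : Fin N → ℂ} (hω : ∀ i, 0 < (ω i).re) {x s : ℂ}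
    (hx : 0 < x.re) (hs : (N : ℝ) < s.re) : MellinConvergent (expKernel ω x) s :=
  mellinConvergent_of_isBigO_rpow_exp hx
    ((continuousOn_expKernel hω x).locallyIntegrableOn measurableSet_Ioi)
    (expKernel_isBigO_atTop hω x)
    (expKernel_isBigO_zero (fun i h => by simpa [h] using hω i) x) hs

/-- The Barnes zeta series as a Mellin transform: `Γ(s) ζ_N(s, x | ω) = ∫₀^∞ t^{s-1} h(t) dt`. -/
theorem hasSum_conePoint_cpow {N : ℕ} {ω : Fin N → ℂ} (hω : ∀ i, 0 < (ω i).re) {x s : ℂ}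
    (hx : 0 < x.re) (hs : (N : ℝ) < s.re) :
    HasSum (fun n : Fin N → ℕ => conePoint ω x n ^ (-s))
      ((Gamma s)⁻¹ * mellin (expKernel ω x) s) := by
  have hs0 : 0 < s.re := lt_of_le_of_lt (Nat.cast_nonneg N) hs
  have hre : ∀ n, 0 < (conePoint ω x n).re := fun n => hx.trans_le (conePoint_re_ge hω x n)
  have key := hasSum_integral_of_dominated_convergence
    (μ := volume.restrict (Set.Ioi (0 : ℝ)))
    (F := fun (n : Fin N → ℕ) t => (t : ℂ) ^ (s - 1) • exp (-(conePoint ω x n * t)))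
    (f := fun t => (t : ℂ) ^ (s - 1) • expKernel ω x t)
    (fun n t => t ^ (s.re - 1) * Real.exp (-((conePoint ω x n).re * t)))
    (fun n => (mellinConvergent_exp_neg_mul (hre n) hs0).aestronglyMeasurable) ?_ ?_ ?_ ?_
  · have h := key.mul_left (Gamma s)⁻¹
    refine h.congr_fun ?_
    intro n
    have h1 := mellin_exp_neg_mul (hre n) hs0
    rw [mellin] at h1
    rw [h1, inv_mul_cancel_left₀ (Gamma_ne_zero_of_re_pos hs0)]
  · intro n
    filter_upwards [ae_restrict_mem measurableSet_Ioi] with t ht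
    rw [norm_smul, norm_cpow_eq_rpow_re_of_pos ht, norm_exp]
    simp
  · filter_upwards [ae_restrict_mem measurableSet_Ioi] with t ht
    exact (hasSum_norm_exp hω x ht).summable.mul_left _
  · have h := mellinConvergent_expKernel (ω := fun i => ((ω i).re : ℂ)) (x := (x.re : ℂ))
      (s := (s.re : ℂ)) (by simpa using hω) (by simpa using hx) (by simpa using hs)
    refine (Integrable.re h).congr ?_
    filter_upwards [ae_restrict_mem measurableSet_Ioi] with t ht
    have ht' : (0 : ℝ) < t := ht
    rw [tsum_mul_left, (hasSum_norm_exp hω x ht').tsum_eq]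
    have h2 : (t : ℂ) ^ ((s.re : ℂ) - 1) = ((t ^ (s.re - 1) : ℝ) : ℂ) := by
      rw [ofReal_cpow ht'.le]
      simp
    rw [h2]
    simp
  · filter_upwards [ae_restrict_mem measurableSet_Ioi] with t ht
    exact (hasSum_expKernel hω x ht).const_smul _

theorem Gamma_sub_natCast {s : ℂ} (m : ℕ) (hs : (m : ℝ) < s.re) :
    Gamma (s - m) = Gamma s * ∏ j ∈ Finset.range m, (s - (j + 1 : ℕ))⁻¹ := by
  induction m with
  | zero => simp
  | succ m ih =>
    have hm : (m : ℝ) < s.re := by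
      push_cast at hs
      linarith
    have hne : s - (m + 1 : ℕ) ≠ 0 := by
      intro h
      rw [sub_eq_zero.mp h, natCast_re] at hs
      exact lt_irrefl _ hs
    rw [Finset.prod_range_succ, ← mul_assoc, ← ih hm,
      show s - (m : ℂ) = (s - (m + 1 : ℕ)) + 1 by push_cast; ring, Gamma_add_one _ hne]
    field_simp

/-- A Mellin transform is holomorphic in `Re s > -1` if the function vanishes to first order at the
origin and decays exponentially. -/
theorem differentiableAt_mellin_of_isBigO {F : ℝ → ℂ} {a : ℝ} (ha : 0 < a)
    (hc : ContinuousOn F (Set.Ioi 0)) (htop : F =O[atTop] fun t => Real.exp (-a * t))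
    (hzero : F =O[𝓝[>] 0] fun t => t) {s : ℂ} (hs : -1 < s.re) :
    DifferentiableAt ℂ (mellin F) s :=
  mellin_differentiableAt_of_isBigO_rpow_exp ha (hc.locallyIntegrableOn measurableSet_Ioi) htop
    (by simpa using hzero) hs

theorem mellinConvergent_of_isBigO_id {F : ℝ → ℂ} {a : ℝ} (ha : 0 < a)
    (hc : ContinuousOn F (Set.Ioi 0)) (htop : F =O[atTop] fun t => Real.exp (-a * t))
    (hzero : F =O[𝓝[>] 0] fun t => t) {s : ℂ} (hs : -1 < s.re) :
    MellinConvergent F s :=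
  mellinConvergent_of_isBigO_rpow_exp ha (hc.locallyIntegrableOn measurableSet_Ioi) htop
    (by simpa using hzero) hs

theorem mellin_cpow_mul_exp_neg {s a : ℂ} (hs : 0 < (s + a).re) :
    MellinConvergent (fun t : ℝ => (t : ℂ) ^ a • exp (-t)) s ∧
      mellin (fun t : ℝ => (t : ℂ) ^ a • exp (-t)) s = Gamma (s + a) := by
  have h1 := mellinConvergent_exp_neg_mul (w := 1) (by simp) hs
  have h2 := mellin_exp_neg_mul (w := 1) (by simp) hs
  simp only [one_mul, one_cpow, mul_one] at h1 h2
  exact ⟨MellinConvergent.cpow_smul.mpr h1, by rw [mellin_cpow_smul, h2]⟩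

/-- The analytic continuation of the Barnes zeta series for `Re x > 0`: the Taylor polynomial of
`t^N e^t h(t)` at `0` contributes the rational part, and the remainder has a Mellin transform that
is holomorphic in `Re s > -1`. -/
theorem exists_isBarnesZeta_of_re_pos {N : ℕ} {ω : Fin N → ℂ} (hω : ∀ i, 0 < (ω i).re) {x : ℂ}
    (hx : 0 < x.re) : ∃ Z, IsBarnesZeta ω x Z := by
  have hω0 : ∀ i, ω i ≠ 0 := fun i h => by simpa [h] using hω i
  -- the shift of `x` by `1` accounts for the factor `e^t`
  obtain ⟨g, hg, hg'⟩ := exists_analyticAt_expKernel hω0 (x - 1)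
  obtain ⟨c, hc⟩ := exists_taylor_isBigO hg (N + 1)
  set F : ℝ → ℂ := fun t => expKernel ω x t -
    ∑ k ∈ Finset.range (N + 1), c k * ((t : ℂ) ^ ((k : ℂ) - N) • exp (-t)) with hF
  have hFc : ContinuousOn F (Set.Ioi 0) := by
    refine (continuousOn_expKernel hω x).sub (continuousOn_finsetSum _ fun k _ => ?_)
    refine ContinuousOn.mul continuousOn_const (fun t ht => ?_)
    exact ((continuousAt_ofReal_cpow_const t _ (Or.inr (ne_of_gt ht))).smul
      (by fun_prop : Continuous fun t : ℝ => exp (-(t : ℂ))).continuousAt).continuousWithinAt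
  have hpow : ∀ k : ℕ, ∀ t : ℝ, 0 < t → (t : ℂ) ^ ((k : ℂ) - N) = (t : ℂ) ^ k / (t : ℂ) ^ N := by
    intro k t ht
    rw [cpow_sub _ _ (ofReal_ne_zero.mpr ht.ne'), cpow_natCast, cpow_natCast]
  have hFzero : F =O[𝓝[>] 0] fun t => t := by
    have h1 := hc.comp_tendsto tendsto_ofReal_nhdsGT_zero
    have h2 : (fun t : ℝ => exp (-(t : ℂ)) / (t : ℂ) ^ N) =O[𝓝[>] 0]
        fun t : ℝ => (1 / t ^ N : ℝ) := by
      have h3 : Tendsto (fun t : ℝ => exp (-(t : ℂ))) (𝓝[>] 0) (𝓝 (exp (-(0 : ℝ)))) :=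
        ((by fun_prop : Continuous fun t : ℝ => exp (-(t : ℂ))).tendsto 0).mono_left
          nhdsWithin_le_nhds
      have h4 := (h3.isBigO_one ℝ).mul
        (Asymptotics.isBigO_of_le (l := 𝓝[>] (0 : ℝ)) (f := fun t : ℝ => 1 / (t : ℂ) ^ N)
          (g := fun t : ℝ => (1 / t ^ N : ℝ)) (fun t => by simp))
      simpa [div_eq_mul_inv] using h4
    refine (h1.mul h2).congr' ?_ ?_
    · filter_upwards [self_mem_nhdsWithin] with t ht
      have ht' : (0 : ℝ) < t := ht
      have ht0 : (t : ℂ) ≠ 0 := ofReal_ne_zero.mpr ht'.ne'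
      simp only [Function.comp, hg' t ht'.ne', hF, smul_eq_mul, hpow _ t ht']
      have h5 : expKernel ω x t = exp (-t) * expKernel ω (x - 1) t := by
        rw [← one_mul (t : ℂ), ← expKernel_shift, sub_add_cancel]
      rw [h5, sub_mul, Finset.sum_mul]
      congr 1
      · field_simp
      · refine Finset.sum_congr rfl fun k _ => ?_
        ring
    · filter_upwards [self_mem_nhdsWithin] with t ht
      have ht' : (0 : ℝ) < t := ht
      simp only [Function.comp, norm_real, Real.norm_eq_abs, abs_of_pos ht']
      field_simp
      ring
  set a : ℝ := min x.re 1 with ha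
  have hapos : 0 < a := lt_min hx one_pos
  have hFtop : F =O[atTop] fun t => Real.exp (-a * t) := by
    refine ((expKernel_isBigO_atTop hω x).trans (exp_neg_mul_isBigO (min_le_left _ _))).sub
      (Asymptotics.IsBigO.fun_sum fun k hk => ?_)
    refine Asymptotics.IsBigO.const_mul_left (.trans ?_ (exp_neg_mul_isBigO (min_le_right _ _))) _
    refine Asymptotics.IsBigO.of_bound 1 ?_
    filter_upwards [eventually_ge_atTop 1] with t ht
    have hkN : (k : ℝ) ≤ N := by
      exact_mod_cast Nat.lt_succ_iff.mp (Finset.mem_range.mp hk)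
    rw [norm_smul, norm_cpow_eq_rpow_re_of_pos (by linarith), norm_exp]
    simp only [sub_re, natCast_re, neg_re, ofReal_re, Real.norm_eq_abs, Real.abs_exp, neg_mul,
      one_mul]
    exact mul_le_of_le_one_left (Real.exp_pos _).le
      (Real.rpow_le_one_of_one_le_of_nonpos ht (by linarith))
  refine ⟨fun s => ∑ k ∈ Finset.range (N + 1), c k * ∏ j ∈ Finset.range (N - k),
    (s - (j + 1 : ℕ))⁻¹ + (Gamma s)⁻¹ * mellin F s, ⟨fun s hs => ?_, fun s hs => ?_⟩⟩
  · have hM := differentiableAt_mellin_of_isBigO hapos hFc hFtop hFzero hs.1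
    refine DifferentiableAt.differentiableWithinAt (DifferentiableAt.add ?_
      (differentiable_one_div_Gamma.differentiableAt.mul hM))
    refine DifferentiableAt.fun_sum fun k _ => DifferentiableAt.const_mul ?_ _
    refine DifferentiableAt.fun_finsetProd fun j hj => ?_
    refine DifferentiableAt.inv (by fun_prop) fun h => hs.2 ⟨j + 1, by omega, ?_, sub_eq_zero.mp h⟩
    have := Finset.mem_range.mp hj
    omega
  · have hs0 : 0 < s.re := lt_of_le_of_lt (Nat.cast_nonneg N) hs
    change HasSum (fun n : Fin N → ℕ => conePoint ω x n ^ (-s)) _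
    convert hasSum_conePoint_cpow hω hx hs using 1
    have hterm : ∀ k : ℕ, 0 < (s + ((k : ℂ) - N)).re := by
      intro k
      have : (0 : ℝ) ≤ k := Nat.cast_nonneg k
      simp
      linarith
    have hint : ∀ k ∈ Finset.range (N + 1), MellinConvergent
        (fun t : ℝ => c k * ((t : ℂ) ^ ((k : ℂ) - N) • exp (-t))) s := fun k _ =>
      (mellin_cpow_mul_exp_neg (hterm k)).1.const_smul (c k)
    have h1 : mellin F s = mellin (expKernel ω x) s -
        ∑ k ∈ Finset.range (N + 1), c k * Gamma (s + ((k : ℂ) - N)) := by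
      have h2 : mellin (fun t : ℝ => ∑ k ∈ Finset.range (N + 1),
          c k * ((t : ℂ) ^ ((k : ℂ) - N) • exp (-t))) s =
          ∑ k ∈ Finset.range (N + 1), c k * Gamma (s + ((k : ℂ) - N)) := by
        simp only [mellin, Finset.smul_sum]
        rw [integral_finsetSum _ hint]
        refine Finset.sum_congr rfl fun k _ => ?_
        rw [← (mellin_cpow_mul_exp_neg (hterm k)).2]
        exact mellin_const_smul (fun t : ℝ => (t : ℂ) ^ ((k : ℂ) - N) • exp (-t)) s (c k)
      have h3 : MellinConvergent (fun t : ℝ => ∑ k ∈ Finset.range (N + 1),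
          c k * ((t : ℂ) ^ ((k : ℂ) - N) • exp (-t))) s := by
        simp only [MellinConvergent, Finset.smul_sum]
        exact integrable_finsetSum _ hint
      rw [← h2]
      exact (hasMellin_sub (mellinConvergent_expKernel hω hx hs) h3).2
    rw [h1, mul_sub, Finset.mul_sum]
    suffices h : ∀ k ∈ Finset.range (N + 1), c k * ∏ j ∈ Finset.range (N - k),
        (s - (j + 1 : ℕ))⁻¹ = (Gamma s)⁻¹ * (c k * Gamma (s + ((k : ℂ) - N))) by
      rw [Finset.sum_congr rfl h]
      ring
    intro k hk
    have hk' : k ≤ N := Nat.lt_succ_iff.mp (Finset.mem_range.mp hk)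
    have h4 : s + ((k : ℂ) - N) = s - (N - k : ℕ) := by
      rw [Nat.cast_sub hk']
      ring
    have h5 : ((N - k : ℕ) : ℝ) < s.re :=
      lt_of_le_of_lt (by exact_mod_cast Nat.sub_le N k) hs
    rw [h4, Gamma_sub_natCast _ h5]
    field_simp [Gamma_ne_zero_of_re_pos hs0]

/-! ### Multiple Gamma functions: functional equation and integral formula -/

theorem zero_mem_zetaDomain (N : ℕ) : (0 : ℂ) ∈ zetaDomain N := by
  refine ⟨by simp, ?_⟩
  rintro ⟨k, hk, -, h⟩
  have : (k : ℂ) ≠ 0 := Nat.cast_ne_zero.mpr (by omega)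
  exact this h.symm

theorem zetaDomain_succ_subset (N : ℕ) : zetaDomain (N + 1) ⊆ zetaDomain N := by
  rintro s ⟨h1, h2⟩
  exact ⟨h1, fun ⟨k, hk, hk', h⟩ => h2 ⟨k, hk, hk'.trans N.le_succ, h⟩⟩

/-- Splitting the cone with apex `x` into its face `n₁ = 0` and the cone with apex `x + ω₁`. -/
theorem IsBarnesZeta.add_face {N : ℕ} {ω : Fin (N + 1) → ℂ} {x : ℂ} {Z W : ℂ → ℂ}
    (hZ : IsBarnesZeta ω (x + ω 0) Z) (hW : IsBarnesZeta (Fin.tail ω) x W) :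
    IsBarnesZeta ω x (fun s => W s + Z s) := by
  refine ⟨(hW.differentiableOn.mono (zetaDomain_succ_subset N)).add hZ.differentiableOn,
    fun s hs => ?_⟩
  have hs' : (N : ℝ) < s.re := by
    push_cast at hs
    linarith
  rw [← (splitFirst N).hasSum_iff]
  refine HasSum.sum ?_ ?_
  · convert hW.hasSum s hs' using 1
    funext n
    exact congrArg (fun w => w ^ (-s)) (conePoint_splitFirst_inl ω x n)
  · convert hZ.hasSum s hs using 1
    funext n
    exact congrArg (fun w => w ^ (-s)) (conePoint_splitFirst_inr ω x n)

theorem isBarnesZeta_cpow {ω : Fin 0 → ℂ} {x : ℂ} (hx : x ≠ 0) :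
    IsBarnesZeta ω x (fun s => x ^ (-s)) := by
  refine ⟨fun s _ => ?_, fun s _ => ?_⟩
  · exact (DifferentiableAt.const_cpow (by fun_prop) (Or.inl hx)).differentiableWithinAt
  · convert hasSum_unique (fun n : Fin 0 → ℕ => (x + ∑ i, (n i : ℂ) * ω i) ^ (-s)) using 1
    simp

theorem exists_nat_re_pos {ω : ℂ} (hω : 0 < ω.re) (y : ℂ) :
    ∃ k : ℕ, ∀ n : ℕ, k ≤ n → 0 < (y + n * ω).re := by
  obtain ⟨k, hk⟩ := exists_nat_gt (-y.re / ω.re)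
  refine ⟨k, fun n hn => ?_⟩
  rw [div_lt_iff₀ hω] at hk
  have hn' : (k : ℝ) ≤ n := by exact_mod_cast hn
  simp
  nlinarith

theorem exists_isBarnesZeta {N : ℕ} {ω : Fin N → ℂ} (hω : ∀ i, 0 < (ω i).re) (x : ℂ) :
    ∃ Z, IsBarnesZeta ω x Z := by
  induction N generalizing x with
  | zero =>
    by_cases hx : x = 0
    -- the only term of the series is `0 ^ (-s) = 0`
    · refine ⟨fun _ => 0, differentiableOn_const _, fun s hs => ?_⟩
      have hs0 : -s ≠ 0 := by
        intro h
        simp [neg_eq_zero.mp h] at hs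
      simp only [hx, Finset.univ_eq_empty, Finset.sum_empty, add_zero, zero_cpow hs0]
      exact hasSum_zero
    · exact ⟨_, isBarnesZeta_cpow hx⟩
  | succ N ih =>
    have hshift : ∀ k : ℕ, ∀ x : ℂ, 0 < (x + k * ω 0).re → ∃ Z, IsBarnesZeta ω x Z := by
      intro k
      induction k with
      | zero =>
        intro x hx
        exact exists_isBarnesZeta_of_re_pos hω (by simpa using hx)
      | succ k ihk =>
        intro x hx
        obtain ⟨Z, hZ⟩ := ihk (x + ω 0) (by
          convert hx using 2
          push_cast
          ring)
        obtain ⟨W, hW⟩ := ih (ω := Fin.tail ω) (fun i => hω i.succ) x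
        exact ⟨_, hZ.add_face hW⟩
    obtain ⟨k, hk⟩ := exists_nat_re_pos (hω 0) x
    exact hshift k x (hk k le_rfl)

theorem isBarnesZeta_barnesZeta {N : ℕ} {ω : Fin N → ℂ} (hω : ∀ i, 0 < (ω i).re) (x : ℂ) :
    IsBarnesZeta ω x (barnesZeta ω x) :=
  Classical.epsilon_spec (exists_isBarnesZeta hω x)

theorem IsBarnesZeta.differentiableAt_zero {N : ℕ} {ω : Fin N → ℂ} {x : ℂ} {Z : ℂ → ℂ}
    (hZ : IsBarnesZeta ω x Z) : DifferentiableAt ℂ Z 0 :=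
  hZ.differentiableOn.differentiableAt ((isOpen_zetaDomain N).mem_nhds (zero_mem_zetaDomain N))

theorem IsBarnesZeta.multiGamma_eq {N : ℕ} {ω : Fin N → ℂ} {x : ℂ} {Z : ℂ → ℂ}
    (hω : ∀ i, 0 < (ω i).re) (hZ : IsBarnesZeta ω x Z) : multiGamma ω x = exp (deriv Z 0) := by
  have h : barnesZeta ω x =ᶠ[𝓝 0] Z :=
    ((isBarnesZeta_barnesZeta hω x).eqOn hZ).eventuallyEq_of_mem
      ((isOpen_zetaDomain N).mem_nhds (zero_mem_zetaDomain N))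
  rw [multiGamma, h.deriv_eq]

theorem multiGamma_ne_zero {N : ℕ} (ω : Fin N → ℂ) (x : ℂ) : multiGamma ω x ≠ 0 := exp_ne_zero _

theorem multiGamma_shift {N : ℕ} {ω : Fin (N + 1) → ℂ} (hω : ∀ i, 0 < (ω i).re) (x : ℂ) :
    multiGamma ω x = multiGamma (Fin.tail ω) x * multiGamma ω (x + ω 0) := by
  have hZ := isBarnesZeta_barnesZeta hω (x + ω 0)
  have hW := isBarnesZeta_barnesZeta (ω := Fin.tail ω) (fun i => hω i.succ) x
  rw [(hZ.add_face hW).multiGamma_eq hω,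
    deriv_fun_add hW.differentiableAt_zero hZ.differentiableAt_zero, exp_add, multiGamma,
    multiGamma]

theorem multiGamma_of_isEmpty {ω : Fin 0 → ℂ} {x : ℂ} (hx : x ≠ 0) : multiGamma ω x = x⁻¹ := by
  rw [(isBarnesZeta_cpow hx).multiGamma_eq (fun i => i.elim0)]
  have h : HasDerivAt (fun s : ℂ => x ^ (-s)) (x ^ (-(0 : ℂ)) * log x * (-1)) 0 :=
    (hasDerivAt_neg (0 : ℂ)).const_cpow (Or.inl hx)
  rw [h.deriv]
  simp [exp_neg, exp_log hx]

/-- An integral combination `∑ mᵢ h_{xᵢ}` of exponential kernels. -/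
noncomputable def kernelSum {N : ℕ} (ω : Fin N → ℂ) {ι : Type*} [Fintype ι] (m : ι → ℤ)
    (x : ι → ℂ) (t : ℝ) : ℂ :=
  ∑ i, (m i : ℂ) * expKernel ω (x i) t

/-- The combination `∑ mᵢ h_{xᵢ}` with its limit `c` at the origin removed by subtracting
`c e^{-t}`, which does not spoil the decay at infinity. -/
noncomputable def kernelReg {N : ℕ} (ω : Fin N → ℂ) {ι : Type*} [Fintype ι] (m : ι → ℤ)
    (x : ι → ℂ) (c : ℂ) (t : ℝ) : ℂ :=
  kernelSum ω m x t - c * exp (-t)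

section Combination

variable {N : ℕ} {ω : Fin N → ℂ} {ι : Type*} [Fintype ι] {m : ι → ℤ} {x : ι → ℂ} {c : ℂ}

theorem continuousOn_kernelReg (hω : ∀ i, 0 < (ω i).re) :
    ContinuousOn (kernelReg ω m x c) (Set.Ioi 0) := by
  unfold kernelReg kernelSum
  refine ContinuousOn.sub (continuousOn_finsetSum _ fun i _ => ?_) (by fun_prop)
  exact continuousOn_const.mul (continuousOn_expKernel hω _)

theorem exists_kernelReg_isBigO_atTop (hω : ∀ i, 0 < (ω i).re) (hx : ∀ i, 0 < (x i).re) :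
    ∃ a : ℝ, 0 < a ∧ kernelReg ω m x c =O[atTop] fun t => Real.exp (-a * t) := by
  obtain ⟨a, ha, hax⟩ : ∃ a : ℝ, 0 < a ∧ a ≤ 1 ∧ ∀ i, a ≤ (x i).re := by
    have h : ∀ s : Finset ι, ∃ a : ℝ, 0 < a ∧ a ≤ 1 ∧ ∀ i ∈ s, a ≤ (x i).re := by
      classical
      intro s
      induction s using Finset.induction_on with
      | empty => exact ⟨1, one_pos, le_rfl, by simp⟩
      | insert j s _ ih =>
        obtain ⟨a, h1, h2, h3⟩ := ih
        refine ⟨min a (x j).re, lt_min h1 (hx j), (min_le_left _ _).trans h2, fun i hi => ?_⟩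
        rcases Finset.mem_insert.mp hi with rfl | hi
        · exact min_le_right _ _
        · exact (min_le_left _ _).trans (h3 i hi)
    obtain ⟨a, h1, h2, h3⟩ := h Finset.univ
    exact ⟨a, h1, h2, fun i => h3 i (Finset.mem_univ i)⟩
  refine ⟨a, ha, ?_⟩
  unfold kernelReg kernelSum
  refine (Asymptotics.IsBigO.fun_sum fun i _ => ?_).sub ?_
  · exact ((expKernel_isBigO_atTop hω (x i)).trans (exp_neg_mul_isBigO (hax.2 i))).const_mul_left _
  · refine Asymptotics.IsBigO.const_mul_left (.trans ?_ (exp_neg_mul_isBigO hax.1)) _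
    refine Asymptotics.isBigO_of_le _ fun t => ?_
    simp [norm_exp]

theorem kernelReg_isBigO_zero
    (hc : (fun t => kernelSum ω m x t - c) =O[𝓝[>] 0] fun t => t) :
    kernelReg ω m x c =O[𝓝[>] 0] fun t => t := by
  have h1 : (fun t : ℝ => c * (1 - exp (-(t : ℂ)))) =O[𝓝[>] 0] fun t : ℝ => t := by
    refine Asymptotics.IsBigO.const_mul_left ?_ _
    have hd : HasDerivAt (fun z : ℂ => 1 - exp (-z)) (1 : ℂ) 0 := by
      simpa using ((hasDerivAt_neg (0 : ℂ)).cexp).const_sub 1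
    have h := hd.differentiableAt.isBigO_sub
    simp only [neg_zero, exp_zero, sub_self, sub_zero] at h
    exact (h.comp_tendsto tendsto_ofReal_nhdsGT_zero).trans
      (Asymptotics.isBigO_of_le _ fun t => by simp)
  refine (hc.add h1).congr_left fun t => ?_
  simp only [kernelReg]
  ring

theorem hasDerivAt_id_mul {φ : ℂ → ℂ} (hφ : DifferentiableAt ℂ φ 0) :
    HasDerivAt (fun s => s * φ s) (φ 0) 0 := by
  simpa using (hasDerivAt_id' (0 : ℂ)).fun_mul hφ.hasDerivAt

/-- If the kernel `∑ mᵢ h_{xᵢ}` is bounded at the origin, then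
`∑ mᵢ ∂ₛζ(0, xᵢ) = ∫₀^∞ (∑ mᵢ h_{xᵢ}(t) - c e^{-t}) dt / t`. -/
theorem prod_multiGamma_zpow (hω : ∀ i, 0 < (ω i).re) (hx : ∀ i, 0 < (x i).re)
    (hc : (fun t => kernelSum ω m x t - c) =O[𝓝[>] 0] fun t => t) :
    ∏ i, multiGamma ω (x i) ^ m i = exp (mellin (kernelReg ω m x c) 0) := by
  obtain ⟨a, ha, htop⟩ := exists_kernelReg_isBigO_atTop (m := m) (c := c) hω hx
  have hcont := continuousOn_kernelReg (m := m) (x := x) (c := c) hω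
  have hzero := kernelReg_isBigO_zero hc
  have hM : ∀ s : ℂ, -1 < s.re → DifferentiableAt ℂ (mellin (kernelReg ω m x c)) s := fun s hs =>
    differentiableAt_mellin_of_isBigO ha hcont htop hzero hs
  set D : ℂ → ℂ := fun s => ∑ i, (m i : ℂ) * barnesZeta ω (x i) s with hD
  set W : ℂ → ℂ := fun s => c + (Gamma s)⁻¹ * mellin (kernelReg ω m x c) s with hW
  have hZ := fun i => isBarnesZeta_barnesZeta hω (x i)
  have hDd : DifferentiableOn ℂ D (zetaDomain N) :=
    DifferentiableOn.fun_sum fun i _ => (hZ i).differentiableOn.const_mul _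
  have hWd : DifferentiableOn ℂ W (zetaDomain N) := fun s hs =>
    ((differentiable_one_div_Gamma.differentiableAt.mul (hM s hs.1)).const_add
      c).differentiableWithinAt
  have hDW : ∀ s : ℂ, (N : ℝ) < s.re → D s = W s := by
    intro s hs
    have hs0 : 0 < s.re := lt_of_le_of_lt (Nat.cast_nonneg N) hs
    have h1 : ∀ i, barnesZeta ω (x i) s = (Gamma s)⁻¹ * mellin (expKernel ω (x i)) s := fun i =>
      ((hZ i).hasSum s hs).unique (hasSum_conePoint_cpow hω (hx i) hs)
    have hint : ∀ i ∈ Finset.univ, MellinConvergent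
        (fun t : ℝ => (m i : ℂ) * expKernel ω (x i) t) s := fun i _ =>
      (mellinConvergent_expKernel hω (hx i) hs).const_smul (m i : ℂ)
    have h2 : mellin (kernelSum ω m x) s = ∑ i, (m i : ℂ) * mellin (expKernel ω (x i)) s := by
      simp only [mellin, kernelSum, Finset.smul_sum]
      rw [integral_finsetSum _ hint]
      exact Finset.sum_congr rfl fun i _ => mellin_const_smul (expKernel ω (x i)) s (m i : ℂ)
    have h3 : MellinConvergent (kernelSum ω m x) s := by
      simp only [MellinConvergent, kernelSum, Finset.smul_sum]
      exact integrable_finsetSum _ hint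
    have h4 : MellinConvergent (fun t : ℝ => exp (-(t : ℂ))) s := by
      simpa using mellinConvergent_exp_neg_mul (w := 1) (by simp) hs0
    have h5 : mellin (fun t : ℝ => exp (-(t : ℂ))) s = Gamma s := by
      simpa using mellin_exp_neg_mul (w := 1) (by simp) hs0
    have h6 : mellin (kernelReg ω m x c) s = mellin (kernelSum ω m x) s - c * Gamma s := by
      have h7 := (hasMellin_sub h3 (h4.const_smul c)).2
      rw [mellin_const_smul, h5] at h7
      exact h7
    simp only [hD, hW, h1, h6, h2, mul_sub, Finset.mul_sum]
    have hG := Gamma_ne_zero_of_re_pos hs0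
    rw [show (Gamma s)⁻¹ * (c * Gamma s) = c by field_simp, add_sub_cancel]
    exact Finset.sum_congr rfl fun i _ => by ring
  have heq : Set.EqOn D W (zetaDomain N) := by
    have hmem : ((N + 1 : ℕ) : ℂ) ∈ zetaDomain N := by
      refine ⟨?_, ?_⟩
      · change -1 < (((N + 1 : ℕ) : ℂ)).re
        rw [natCast_re]
        have : (0 : ℝ) ≤ ((N + 1 : ℕ) : ℝ) := Nat.cast_nonneg _
        linarith
      · rintro ⟨k, -, h2, h3⟩
        have : N + 1 = k := by exact_mod_cast h3
        omega
    refine (hDd.analyticOnNhd (isOpen_zetaDomain N)).eqOn_of_preconnected_of_eventuallyEq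
      (hWd.analyticOnNhd (isOpen_zetaDomain N)) (isPreconnected_zetaDomain N) hmem ?_
    have hopen : IsOpen {s : ℂ | (N : ℝ) < s.re} := isOpen_lt continuous_const continuous_re
    have hN : ((N + 1 : ℕ) : ℂ) ∈ {s : ℂ | (N : ℝ) < s.re} := by
      change (N : ℝ) < (((N + 1 : ℕ) : ℂ)).re
      rw [natCast_re]
      push_cast
      linarith
    filter_upwards [hopen.mem_nhds hN] with s hs using hDW s hs
  have h0 := (isOpen_zetaDomain N).mem_nhds (zero_mem_zetaDomain N)
  have hderiv : deriv D 0 = mellin (kernelReg ω m x c) 0 := by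
    rw [(heq.eventuallyEq_of_mem h0).deriv_eq]
    have h1 : W = fun s => c + s * ((Gamma (s + 1))⁻¹ * mellin (kernelReg ω m x c) s) := by
      funext s
      rw [← mul_assoc, ← one_div_Gamma_eq_self_mul_one_div_Gamma_add_one s]
    have h2 : DifferentiableAt ℂ
        (fun s => (Gamma (s + 1))⁻¹ * mellin (kernelReg ω m x c) s) 0 := by
      refine DifferentiableAt.mul ?_ (hM 0 (by simp))
      exact (differentiable_one_div_Gamma.comp
        (by fun_prop : Differentiable ℂ fun s : ℂ => s + 1)) 0
    rw [h1, ((hasDerivAt_id_mul h2).const_add c).deriv]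
    simp
  have hderiv' : deriv D 0 = ∑ i, (m i : ℂ) * deriv (barnesZeta ω (x i)) 0 := by
    rw [hD, deriv_fun_sum fun i _ => ((hZ i).differentiableAt_zero.const_mul _)]
    exact Finset.sum_congr rfl fun i _ => deriv_const_mul _ (hZ i).differentiableAt_zero
  rw [← hderiv, hderiv', exp_sum]
  exact Finset.prod_congr rfl fun i _ => by rw [multiGamma, ← exp_int_mul]

end Combination

/-! ### Infinite products over the cone of periods as `t → 0` -/

/-- Right Riemann sums over the half line converge for a continuous function with exponential
bound; the sum is the integral of `u ↦ φ (t⌈u/t⌉)`, to which dominated convergence applies. -/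
theorem tendsto_tsum_riemann {φ : ℝ → ℂ} (hφ : ContinuousOn φ (Set.Ioi 0)) {C a : ℝ} (ha : 0 < a)
    (hC : ∀ u, 0 < u → ‖φ u‖ ≤ C * Real.exp (-a * u)) :
    Tendsto (fun t : ℝ => ∑' k : ℕ, (t : ℂ) * φ ((k + 1) * t)) (𝓝[>] 0)
      (𝓝 (∫ u in Set.Ioi 0, φ u)) := by
  have hC0 : 0 ≤ C := by
    have h := (norm_nonneg _).trans (hC 1 one_pos)
    exact nonneg_of_mul_nonneg_left h (Real.exp_pos _)
  have hbd : IntegrableOn (fun u : ℝ => C * Real.exp (-a * u)) (Set.Ioi 0) :=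
    (exp_neg_integrableOn_Ioi 0 ha).const_mul C
  have hceil : ∀ t u : ℝ, 0 < t → 0 < u → u ≤ t * ⌈u / t⌉₊ ∧ t * ⌈u / t⌉₊ < u + t := by
    intro t u ht hu
    have h1 := Nat.le_ceil (u / t)
    have h2 := Nat.ceil_lt_add_one (div_pos hu ht).le
    rw [div_le_iff₀ ht] at h1
    have h3 : t * (⌈u / t⌉₊ : ℝ) < t * (u / t + 1) := mul_lt_mul_of_pos_left h2 ht
    rw [mul_add, mul_div_cancel₀ _ ht.ne', mul_one] at h3
    exact ⟨by linarith, h3⟩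
  have hmeas : ∀ t : ℝ, Measurable fun u : ℝ => φ (t * ⌈u / t⌉₊) := fun t =>
    (measurable_from_top (f := fun n : ℕ => φ (t * n))).comp
      (Nat.measurable_ceil.comp (measurable_id.div_const t))
  have hle : ∀ t : ℝ, 0 < t → ∀ u, 0 < u → ‖φ (t * ⌈u / t⌉₊)‖ ≤ C * Real.exp (-a * u) := by
    intro t ht u hu
    obtain ⟨h1, -⟩ := hceil t u ht hu
    refine (hC _ (hu.trans_le h1)).trans (mul_le_mul_of_nonneg_left ?_ hC0)
    rw [Real.exp_le_exp]
    nlinarith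
  have hsum : ∀ t : ℝ, 0 < t →
      ∑' k : ℕ, (t : ℂ) * φ ((k + 1) * t) = ∫ u in Set.Ioi 0, φ (t * ⌈u / t⌉₊) := by
    intro t ht
    have hmono : Monotone fun k : ℕ => (k : ℝ) * t := fun i j hij =>
      mul_le_mul_of_nonneg_right (by exact_mod_cast hij) ht.le
    have hU : (⋃ k : ℕ, Set.Ioc ((k : ℝ) * t) ((Order.succ k : ℕ) * t)) = Set.Ioi 0 := by
      ext u
      simp only [Set.mem_iUnion, Set.mem_Ioc, Set.mem_Ioi]
      constructor
      · rintro ⟨k, h1, -⟩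
        exact lt_of_le_of_lt (mul_nonneg (Nat.cast_nonneg _) ht.le) h1
      · intro hu
        obtain ⟨h1, h2⟩ := hceil t u ht hu
        have hpos : 0 < ⌈u / t⌉₊ := Nat.ceil_pos.mpr (div_pos hu ht)
        refine ⟨⌈u / t⌉₊ - 1, ?_, ?_⟩
        · rw [Nat.cast_sub hpos]
          push_cast
          linarith
        · rw [Nat.succ_eq_succ, Nat.succ_eq_add_one, Nat.sub_add_cancel hpos]
          linarith
    have hint : IntegrableOn (fun u : ℝ => φ (t * ⌈u / t⌉₊)) (Set.Ioi 0) := by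
      refine Integrable.mono' hbd (hmeas t).aestronglyMeasurable ?_
      filter_upwards [ae_restrict_mem measurableSet_Ioi] with u hu using hle t ht u hu
    have h := hasSum_integral_iUnion (fun k : ℕ => measurableSet_Ioc)
      (hmono.pairwise_disjoint_on_Ioc_succ) (by rw [hU]; exact hint)
    rw [hU] at h
    rw [← h.tsum_eq]
    refine tsum_congr fun k => ?_
    have hk : ∀ u ∈ Set.Ioc ((k : ℝ) * t) ((Order.succ k : ℕ) * t),
        φ (t * ⌈u / t⌉₊) = φ ((k + 1) * t) := by
      rintro u ⟨h1, h2⟩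
      have h3 : ⌈u / t⌉₊ = k + 1 := by
        rw [Nat.ceil_eq_iff (by omega), lt_div_iff₀ ht, div_le_iff₀ ht]
        exact ⟨by simpa using h1, by simpa using h2⟩
      rw [h3]
      congr 1
      push_cast
      ring
    rw [setIntegral_congr_fun measurableSet_Ioc hk, setIntegral_const, Real.volume_real_Ioc_of_le
      (hmono (Order.le_succ k))]
    rw [Nat.succ_eq_succ, ← sub_mul]
    simp
  have hlim : Tendsto (fun t : ℝ => ∫ u in Set.Ioi 0, φ (t * ⌈u / t⌉₊)) (𝓝[>] 0)
      (𝓝 (∫ u in Set.Ioi 0, φ u)) := by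
    refine tendsto_integral_filter_of_dominated_convergence
      (fun u => C * Real.exp (-a * u)) (Eventually.of_forall fun t =>
        (hmeas t).aestronglyMeasurable) ?_ hbd ?_
    · filter_upwards [self_mem_nhdsWithin] with t ht
      filter_upwards [ae_restrict_mem measurableSet_Ioi] with u hu using hle t ht u hu
    · filter_upwards [ae_restrict_mem measurableSet_Ioi] with u hu
      refine ((hφ.continuousAt (Ioi_mem_nhds hu)).tendsto).comp ?_
      have h1 : Tendsto (fun t : ℝ => u + t) (𝓝[>] 0) (𝓝 u) := by
        have h := ((by fun_prop : Continuous fun t : ℝ => u + t).tendsto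
          0).mono_left (nhdsWithin_le_nhds (s := Set.Ioi 0))
        simpa using h
      refine tendsto_of_tendsto_of_tendsto_of_le_of_le' tendsto_const_nhds h1 ?_ ?_
      · filter_upwards [self_mem_nhdsWithin] with t ht using (hceil t u ht hu).1
      · filter_upwards [self_mem_nhdsWithin] with t ht using (hceil t u ht hu).2.le
  refine hlim.congr' ?_
  filter_upwards [self_mem_nhdsWithin] with t ht using (hsum t ht).symm

/-- Bounds at the origin and at infinity combine to a bound on the whole half line. -/
theorem exists_norm_div_le_exp {F : ℝ → ℂ} {a : ℝ} (hc : ContinuousOn F (Set.Ioi 0))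
    (htop : F =O[atTop] fun t => Real.exp (-a * t)) (hzero : F =O[𝓝[>] 0] fun t => t) :
    ∃ C, ∀ u, 0 < u → ‖F u / u‖ ≤ C * Real.exp (-a * u) := by
  set ψ : ℝ → ℂ := fun u => F u / u * Real.exp (a * u) with hψ
  suffices h : ∃ C, ∀ u, 0 < u → ‖ψ u‖ ≤ C by
    obtain ⟨C, hC⟩ := h
    refine ⟨C, fun u hu => ?_⟩
    have h1 := hC u hu
    rw [hψ, norm_mul, norm_real, Real.norm_eq_abs, Real.abs_exp] at h1
    rw [neg_mul, Real.exp_neg, ← div_eq_mul_inv, le_div_iff₀ (Real.exp_pos _)]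
    exact h1
  have hψc : ContinuousOn ψ (Set.Ioi 0) := by
    refine ContinuousOn.mul (hc.div (by fun_prop) fun u hu => ?_) (by fun_prop)
    exact ofReal_ne_zero.mpr (ne_of_gt hu)
  have h0 : ψ =O[𝓝[>] 0] fun _ => (1 : ℝ) := by
    have h1 := hzero.mul (Asymptotics.isBigO_of_le (l := 𝓝[>] (0 : ℝ)) (f := fun u : ℝ => (u : ℂ)⁻¹)
      (g := fun u : ℝ => u⁻¹) (fun u => by simp))
    have h2 : (fun u : ℝ => (Real.exp (a * u) : ℂ)) =O[𝓝[>] 0] fun _ => (1 : ℝ) :=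
      (((by fun_prop : Continuous fun u : ℝ => (Real.exp (a * u) : ℂ)).tendsto 0).mono_left
        nhdsWithin_le_nhds).isBigO_one ℝ
    refine (h1.mul h2).congr' ?_ ?_
    · filter_upwards with u
      simp [hψ, div_eq_mul_inv]
    · filter_upwards [self_mem_nhdsWithin] with u hu
      have hu' : (0 : ℝ) < u := hu
      field_simp
  have h1 : ψ =O[atTop] fun _ => (1 : ℝ) := by
    have h2 := (htop.mul (Asymptotics.isBigO_of_le (l := atTop)
      (f := fun u : ℝ => (Real.exp (a * u) : ℂ)) (g := fun u : ℝ => Real.exp (a * u))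
      (fun u => by simp only [norm_real, le_refl])))
    have h3 : (fun u : ℝ => (u : ℂ)⁻¹) =O[atTop] fun _ => (1 : ℝ) := by
      refine Asymptotics.IsBigO.of_bound 1 ?_
      filter_upwards [eventually_ge_atTop 1] with u hu
      simp only [norm_inv, norm_real, Real.norm_eq_abs, abs_one, mul_one]
      exact inv_le_one_of_one_le₀ (hu.trans (le_abs_self u))
    refine (h2.mul h3).congr (fun u => ?_) (fun u => ?_)
    · simp only [hψ]
      ring
    · rw [← Real.exp_add]
      simp
  obtain ⟨C₀, hC₀⟩ := h0.bound
  obtain ⟨C₁, hC₁⟩ := h1.bound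
  obtain ⟨ε, hε, hε'⟩ := mem_nhdsGT_iff_exists_Ioo_subset.mp hC₀
  obtain ⟨T, hT⟩ := eventually_atTop.mp hC₁
  have hε0 : (0 : ℝ) < ε := hε
  obtain ⟨C₂, hC₂⟩ := (isCompact_Icc (a := ε) (b := T)).exists_bound_of_continuousOn
    (hψc.mono fun u hu => lt_of_lt_of_le hε0 hu.1)
  refine ⟨max C₀ (max C₁ C₂), fun u hu => ?_⟩
  rcases lt_or_ge u ε with h | h
  · have := hε' ⟨hu, h⟩
    simp only [Set.mem_ofPred_eq, norm_one, mul_one] at this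
    exact this.trans (le_max_left _ _)
  · rcases le_or_gt u T with h' | h'
    · exact (hC₂ u ⟨h, h'⟩).trans ((le_max_right _ _).trans (le_max_right _ _))
    · have := hT u h'.le
      simp only [norm_one, mul_one] at this
      exact this.trans ((le_max_left _ _).trans (le_max_right _ _))

/-- The product `∏ₙ (1 - e^{-t(x + n·ω)})`, a multiple `q`-Pochhammer symbol in additive
notation. -/
noncomputable def coneProd {N : ℕ} (ω : Fin N → ℂ) (x : ℂ) (t : ℝ) : ℂ :=
  ∏' n : Fin N → ℕ, (1 - exp (-(conePoint ω x n * t)))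

theorem multipliable_coneProd {N : ℕ} {ω : Fin N → ℂ} (hω : ∀ i, 0 < (ω i).re) (x : ℂ)
    {t : ℝ} (ht : 0 < t) :
    Multipliable fun n : Fin N → ℕ => (1 - exp (-(conePoint ω x n * t))) := by
  have h := Complex.multipliable_one_add_of_summable (hasSum_expKernel hω x ht).summable.neg
  simpa only [← sub_eq_add_neg] using h

theorem coneProd_shift {N : ℕ} {ω : Fin (N + 1) → ℂ} (hω : ∀ i, 0 < (ω i).re) (x : ℂ)
    {t : ℝ} (ht : 0 < t) :
    coneProd ω x t = coneProd (Fin.tail ω) x t * coneProd ω (x + ω 0) t := by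
  have h1 : HasProd _ (coneProd (Fin.tail ω) x t) :=
    (multipliable_coneProd (ω := Fin.tail ω) (fun i => hω i.succ) x ht).hasProd
  have h2 : HasProd _ (coneProd ω (x + ω 0) t) :=
    (multipliable_coneProd hω (x + ω 0) ht).hasProd
  have h3 : HasProd (fun n : Fin (N + 1) → ℕ => (1 - exp (-(conePoint ω x n * t))))
      (coneProd (Fin.tail ω) x t * coneProd ω (x + ω 0) t) := by
    rw [← (splitFirst N).hasProd_iff]
    refine HasProd.sum ?_ ?_
    · convert h1 using 1
      funext n
      simp only [Function.comp, conePoint_splitFirst_inl]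
    · convert h2 using 1
      funext n
      simp only [Function.comp, conePoint_splitFirst_inr]
  exact h3.tprod_eq

theorem coneProd_of_isEmpty (ω : Fin 0 → ℂ) (x : ℂ) (t : ℝ) :
    coneProd ω x t = 1 - exp (-(x * t)) := by
  have h := (hasProd_unique fun n : Fin 0 → ℕ => (1 - exp (-(conePoint ω x n * t)))).tprod_eq
  rw [coneProd, h]
  simp [conePoint]

/-- Expanding the logarithms, `∏ₙ (1 - e^{-t(x + n·ω)}) = exp (-∑_{k ≥ 1} h(kt) / k)`. -/
theorem exists_hasSum_coneProd {N : ℕ} {ω : Fin N → ℂ} (hω : ∀ i, 0 < (ω i).re) {x : ℂ}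
    (hx : 0 < x.re) {t : ℝ} (ht : 0 < t) :
    ∃ S, HasSum (fun k : ℕ => expKernel ω x ((k + 1) * t) / (k + 1)) S ∧
      coneProd ω x t = exp (-S) := by
  have hre : ∀ n, 0 < (conePoint ω x n).re := fun n => hx.trans_le (conePoint_re_ge hω x n)
  set e : (Fin N → ℕ) → ℂ := fun n => exp (-(conePoint ω x n * t)) with he
  have hlt : ∀ n, ‖e n‖ < 1 := fun n => norm_exp_neg_mul_lt_one (hre n) ht
  have hle : ∀ n, ‖e n‖ ≤ ‖exp (-(x * t))‖ := by
    intro n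
    simp only [he, norm_exp, neg_re, re_mul_ofReal, Real.exp_le_exp, neg_le_neg_iff]
    exact mul_le_mul_of_nonneg_right (conePoint_re_ge hω x n) ht.le
  have hsum : Summable fun p : (Fin N → ℕ) × ℕ => e p.1 ^ (p.2 + 1) / (p.2 + 1) := by
    have h1 : Summable fun n => ‖e n‖ := (hasSum_expKernel hω x ht).summable.norm
    have h2 : Summable fun k : ℕ => ‖exp (-(x * t))‖ ^ k :=
      summable_geometric_of_lt_one (norm_nonneg _) (norm_exp_neg_mul_lt_one hx ht)
    have h3 : Summable fun p : (Fin N → ℕ) × ℕ => ‖e p.1‖ * ‖exp (-(x * t))‖ ^ p.2 :=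
      h1.mul_of_nonneg h2 (fun _ => norm_nonneg _) fun _ => by positivity
    refine h3.of_norm_bounded fun p => ?_
    have hp : (1 : ℝ) ≤ ‖(p.2 : ℂ) + 1‖ := by
      have h4 : (p.2 : ℂ) + 1 = ((p.2 + 1 : ℕ) : ℂ) := by push_cast; ring
      rw [h4, norm_natCast]
      exact_mod_cast Nat.le_add_left 1 p.2
    rw [norm_div, norm_pow, pow_succ']
    refine (div_le_self (by positivity) hp).trans ?_
    exact mul_le_mul_of_nonneg_left (pow_le_pow_left₀ (norm_nonneg _) (hle _) _) (norm_nonneg _)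
  obtain ⟨S, hS⟩ := hsum
  refine ⟨S, ?_, ?_⟩
  · have hS' := (Equiv.prodComm ℕ (Fin N → ℕ)).hasSum_iff.mpr hS
    refine hS'.prod_fiberwise fun k => ?_
    have hk : (0 : ℝ) < (k + 1) * t := by positivity
    refine ((hasSum_expKernel hω x hk).div_const ((k : ℂ) + 1)).congr_fun fun n => ?_
    simp only [Function.comp, Equiv.prodComm_apply, Prod.swap, he, ← exp_nat_mul]
    congr 2
    push_cast
    ring
  · have h1 : HasSum (fun n => -log (1 - e n)) S := by
      refine hS.prod_fiberwise fun n => ?_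
      have h := hasSum_taylorSeries_neg_log' (z := e n) (hlt n)
      exact h
    have h2 : HasSum (fun n => log (1 - e n)) (-S) := by
      have h := h1.neg
      simp only [neg_neg] at h
      exact h
    refine (hasProd_of_hasSum_log (fun n => ?_) h2).tprod_eq
    exact one_sub_exp_neg_ne_zero (hre n) ht

section Combination

variable {N : ℕ} {ω : Fin N → ℂ} {ι : Type*} [Fintype ι] {m : ι → ℤ} {x : ι → ℂ} {c : ℂ}

theorem exists_hasSum_prod_coneProd (hω : ∀ i, 0 < (ω i).re) (hx : ∀ i, 0 < (x i).re) {t : ℝ}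
    (ht : 0 < t) :
    ∃ S, HasSum (fun k : ℕ => kernelSum ω m x ((k + 1) * t) / (k + 1)) S ∧
      ∏ i, coneProd ω (x i) t ^ m i = exp (-S) := by
  choose S hS hS' using fun i => exists_hasSum_coneProd hω (hx i) ht
  refine ⟨∑ i, (m i : ℂ) * S i, ?_, ?_⟩
  · have h := hasSum_sum (s := Finset.univ) fun i _ => (hS i).mul_left (m i : ℂ)
    refine h.congr_fun fun k => ?_
    rw [kernelSum, Finset.sum_div]
    exact Finset.sum_congr rfl fun i _ => by ring
  · rw [← Finset.sum_neg_distrib, exp_sum]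
    refine Finset.prod_congr rfl fun i _ => ?_
    rw [hS' i, ← exp_int_mul]
    congr 1
    ring

theorem tendsto_one_sub_exp_div :
    Tendsto (fun t : ℝ => (1 - Real.exp (-t)) / t) (𝓝[>] 0) (𝓝 1) := by
  have h : HasDerivAt (fun t : ℝ => 1 - Real.exp (-t)) 1 0 := by
    simpa using ((hasDerivAt_neg (0 : ℝ)).exp).const_sub 1
  have h1 := (hasDerivAt_iff_tendsto_slope.mp h).mono_left
    (nhdsWithin_mono 0 (s := Set.Ioi 0) fun t (ht : 0 < t) => ht.ne')
  refine h1.congr fun t => ?_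
  simp [slope_def_field]

/-- The small `t` behaviour of a combination of products whose kernel `∑ mᵢ h_{xᵢ}` has the limit
`c` at the origin, when all apices lie in the right half plane. -/
theorem tendsto_prod_coneProd (hω : ∀ i, 0 < (ω i).re) (hx : ∀ i, 0 < (x i).re)
    (hc : (fun t => kernelSum ω m x t - c) =O[𝓝[>] 0] fun t => t) :
    Tendsto (fun t : ℝ => (t : ℂ) ^ (-c) * ∏ i, coneProd ω (x i) t ^ m i) (𝓝[>] 0)
      (𝓝 (∏ i, multiGamma ω (x i) ^ m i)⁻¹) := by
  obtain ⟨a, ha, htop⟩ := exists_kernelReg_isBigO_atTop (m := m) (c := c) hω hx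
  have hcont := continuousOn_kernelReg (m := m) (x := x) (c := c) hω
  have hzero := kernelReg_isBigO_zero hc
  obtain ⟨C, hC⟩ := exists_norm_div_le_exp hcont htop hzero
  have hφ : ContinuousOn (fun u : ℝ => kernelReg ω m x c u / u) (Set.Ioi 0) :=
    hcont.div (by fun_prop) fun u hu => ofReal_ne_zero.mpr (ne_of_gt hu)
  have hR := tendsto_tsum_riemann hφ ha hC
  have hint : ∫ u in Set.Ioi 0, kernelReg ω m x c u / (u : ℂ) = mellin (kernelReg ω m x c) 0 := by
    rw [mellin]
    refine setIntegral_congr_fun measurableSet_Ioi fun u _ => ?_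
    simp [cpow_neg_one, div_eq_inv_mul]
  rw [hint] at hR
  rw [prod_multiGamma_zpow hω hx hc, ← exp_neg]
  have hL : Tendsto (fun t : ℝ => exp (c * (Real.log ((1 - Real.exp (-t)) / t) : ℝ))) (𝓝[>] 0)
      (𝓝 1) := by
    have h1 := (Real.continuousAt_log one_ne_zero).tendsto.comp tendsto_one_sub_exp_div
    rw [Real.log_one] at h1
    have h2 := (continuous_exp.tendsto _).comp
      (((continuous_ofReal.tendsto (0 : ℝ)).comp h1).const_mul c)
    simp only [ofReal_zero, mul_zero, exp_zero] at h2
    exact h2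
  have hE := (continuous_exp.tendsto _).comp hR.neg
  have hlim := hL.mul hE
  rw [one_mul] at hlim
  refine hlim.congr' ?_
  filter_upwards [self_mem_nhdsWithin] with t ht
  have ht' : (0 : ℝ) < t := ht
  have ht0 : (t : ℂ) ≠ 0 := ofReal_ne_zero.mpr ht'.ne'
  obtain ⟨S, hS, hS'⟩ := exists_hasSum_prod_coneProd (m := m) hω hx ht'
  have hlt : ‖exp (-(t : ℂ))‖ < 1 := by
    simpa using norm_exp_neg_mul_lt_one (w := 1) (by simp) ht'
  have hlog := (hasSum_taylorSeries_neg_log' hlt).mul_left c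
  have hpos : 0 < 1 - Real.exp (-t) := by
    rw [sub_pos, Real.exp_lt_one_iff]
    linarith
  have hlogeq : log (1 - exp (-(t : ℂ))) = (Real.log (1 - Real.exp (-t)) : ℝ) := by
    rw [ofReal_log hpos.le]
    push_cast
    rfl
  have hreg : ∑' k : ℕ, (t : ℂ) * (kernelReg ω m x c ((k + 1) * t) / (((k + 1) * t : ℝ) : ℂ)) =
      S - c * (-log (1 - exp (-(t : ℂ)))) := by
    rw [← (hS.sub hlog).tsum_eq]
    refine tsum_congr fun k => ?_
    have hk : (k : ℂ) + 1 ≠ 0 := Nat.cast_add_one_ne_zero k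
    rw [kernelReg, ← exp_nat_mul]
    push_cast
    rw [show ((k : ℂ) + 1) * -t = -((k + 1) * t) by ring]
    field_simp
  simp only [Function.comp]
  rw [hreg, hS', ← exp_add, cpow_def_of_ne_zero ht0, ← exp_add, hlogeq,
    Real.log_div hpos.ne' ht'.ne', ← ofReal_log ht'.le]
  congr 1
  push_cast
  ring

end Combination

/-! ### Scaling limits of ratios of Pochhammer symbols -/

theorem Gamma1_ne_zero (y ω : ℂ) : Gamma1 y ω ≠ 0 := multiGamma_ne_zero _ _

theorem Gamma2_ne_zero (y ω₁ ω₂ : ℂ) : Gamma2 y ω₁ ω₂ ≠ 0 := multiGamma_ne_zero _ _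

theorem Gamma1_add {y ω : ℂ} (hω : 0 < ω.re) (hy : y ≠ 0) :
    Gamma1 (y + ω) ω = y * Gamma1 y ω := by
  have h := multiGamma_shift (ω := ![ω]) (by simpa using hω) y
  rw [multiGamma_of_isEmpty hy] at h
  rw [Gamma1, Gamma1, h, mul_inv_cancel_left₀ hy]
  simp

theorem Gamma1_add_nat {y ω : ℂ} (hω : 0 < ω.re) (hy : ∀ n : ℕ, y + n * ω ≠ 0) (n : ℕ) :
    Gamma1 (y + n * ω) ω = (∏ k ∈ Finset.range n, (y + k * ω)) * Gamma1 y ω := by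
  induction n with
  | zero => simp
  | succ n ih =>
    rw [show y + (n + 1 : ℕ) * ω = y + n * ω + ω by push_cast; ring, Gamma1_add hω (hy n), ih,
      Finset.prod_range_succ]
    ring

theorem Gamma2_eq {y ω₁ ω₂ : ℂ} (h₁ : 0 < ω₁.re) (h₂ : 0 < ω₂.re) :
    Gamma2 y ω₁ ω₂ = Gamma1 y ω₂ * Gamma2 (y + ω₁) ω₁ ω₂ := by
  have h := multiGamma_shift (ω := ![ω₁, ω₂]) (by
    intro i
    fin_cases i
    · exact h₁
    · exact h₂) y
  exact h

theorem coneProd_one_eq {y ω : ℂ} (hω : 0 < ω.re) {t : ℝ} (ht : 0 < t) :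
    coneProd ![ω] y t = (1 - exp (-(y * t))) * coneProd ![ω] (y + ω) t := by
  have h := coneProd_shift (ω := ![ω]) (by simpa using hω) y ht
  rw [coneProd_of_isEmpty] at h
  exact h

theorem coneProd_two_eq {y ω₁ ω₂ : ℂ} (h₁ : 0 < ω₁.re) (h₂ : 0 < ω₂.re) {t : ℝ} (ht : 0 < t) :
    coneProd ![ω₁, ω₂] y t = coneProd ![ω₂] y t * coneProd ![ω₁, ω₂] (y + ω₁) t := by
  have h := coneProd_shift (ω := ![ω₁, ω₂]) (by
    intro i
    fin_cases i
    · exact h₁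
    · exact h₂) y ht
  exact h

theorem isBigO_sub_of_analyticAt {g : ℂ → ℂ} (hg : AnalyticAt ℂ g 0) {h : ℝ → ℂ}
    (hh : ∀ t : ℝ, 0 < t → h t = g t) :
    (fun t => h t - g 0) =O[𝓝[>] 0] fun t => t := by
  have h1 := hg.differentiableAt.isBigO_sub
  simp only [sub_zero] at h1
  have h2 := (h1.comp_tendsto tendsto_ofReal_nhdsGT_zero).trans
    (Asymptotics.isBigO_of_le (𝓝[>] (0 : ℝ)) (g := fun t : ℝ => t) fun t => by simp)
  refine h2.congr' ?_ EventuallyEq.rfl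
  filter_upwards [self_mem_nhdsWithin] with t ht
  simp [hh t ht]

theorem expKernel_one (ω y : ℂ) (t : ℝ) :
    expKernel ![ω] y t = exp (-(y * t)) * (1 - exp (-(ω * t)))⁻¹ := by
  simp [expKernel]

theorem expKernel_two (ω₁ ω₂ y : ℂ) (t : ℝ) :
    expKernel ![ω₁, ω₂] y t =
      exp (-(y * t)) * ((1 - exp (-(ω₁ * t)))⁻¹ * (1 - exp (-(ω₂ * t)))⁻¹) := by
  rw [expKernel, Fin.prod_univ_two]
  rfl

theorem expKernel_sub_isBigO {ω : ℂ} (hω : 0 < ω.re) (a b : ℂ) :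
    (fun t => expKernel ![ω] b t - expKernel ![ω] a t - (a - b) / ω) =O[𝓝[>] 0] fun t => t := by
  have hω0 : ω ≠ 0 := fun h => by simp [h] at hω
  obtain ⟨g, hg, hg0, hg'⟩ := exists_analyticAt_div_one_sub_exp hω0
  obtain ⟨d, hd, hd0, hd'⟩ := exists_analyticAt_one_sub_exp_div (a - b)
  have h := isBigO_sub_of_analyticAt (g := fun z => exp (-(b * z)) * d z * g z)
    (((by fun_prop : AnalyticAt ℂ (fun z => exp (-(b * z))) 0).mul hd).mul hg)
    (h := fun t => expKernel ![ω] b t - expKernel ![ω] a t) (fun t ht => by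
      have ht0 : (t : ℂ) ≠ 0 := ofReal_ne_zero.mpr ht.ne'
      have h1 : exp (-(a * t)) = exp (-(b * t)) * exp (-((a - b) * t)) := by
        rw [← exp_add]
        congr 1
        ring
      have h2 : d t = (1 - exp (-((a - b) * t))) / t := by
        rw [hd', mul_div_cancel_left₀ _ ht0]
      simp only [expKernel_one, hg' _ ht0, h1, h2]
      field_simp)
  simpa [hg0, hd0, div_eq_mul_inv] using h

theorem tendsto_one_sub_exp_div_one_sub_exp {a b : ℂ} (ha : a ≠ 0) :
    Tendsto (fun t : ℝ => (1 - exp (-(b * t))) / (1 - exp (-(a * t)))) (𝓝[>] 0) (𝓝 (b / a)) := by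
  obtain ⟨d, hd, hd0, hd'⟩ := exists_analyticAt_one_sub_exp_div a
  obtain ⟨e, he, he0, he'⟩ := exists_analyticAt_one_sub_exp_div b
  have h1 := hd.continuousAt.tendsto.comp tendsto_ofReal_nhdsGT_zero
  have h2 := he.continuousAt.tendsto.comp tendsto_ofReal_nhdsGT_zero
  rw [hd0] at h1
  rw [he0] at h2
  refine (h2.div h1 ha).congr' ?_
  filter_upwards [self_mem_nhdsWithin] with t ht
  have ht0 : (t : ℂ) ≠ 0 := ofReal_ne_zero.mpr (ne_of_gt ht)
  rw [hd', he', mul_div_mul_left _ _ ht0]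
  rfl

/-- The scaling limit of a ratio of `q`-Pochhammer symbols is a ratio of Gamma functions. -/
theorem tendsto_coneProd_div {ω a b : ℂ} (hω : 0 < ω.re) (ha : ∀ n : ℕ, a + n * ω ≠ 0)
    (hb : ∀ n : ℕ, b + n * ω ≠ 0) :
    Tendsto (fun t : ℝ => (t : ℂ) ^ (-((a - b) / ω)) * (coneProd ![ω] b t / coneProd ![ω] a t))
      (𝓝[>] 0) (𝓝 (Gamma1 a ω / Gamma1 b ω)) := by
  have hω' : ∀ i, 0 < ((![ω] : Fin 1 → ℂ) i).re := by simpa using hω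
  have key : ∀ k : ℕ, ∀ a b : ℂ, (∀ n : ℕ, a + n * ω ≠ 0) → (∀ n : ℕ, b + n * ω ≠ 0) →
      0 < (a + k * ω).re → 0 < (b + k * ω).re →
      Tendsto (fun t : ℝ => (t : ℂ) ^ (-((a - b) / ω)) * (coneProd ![ω] b t / coneProd ![ω] a t))
        (𝓝[>] 0) (𝓝 (Gamma1 a ω / Gamma1 b ω)) := by
    intro k
    induction k with
    | zero =>
      intro a b _ _ ha hb
      have h := tendsto_prod_coneProd (ω := ![ω]) (ι := Fin 2) (m := ![1, -1]) (x := ![b, a])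
        (c := (a - b) / ω) hω' (by
          intro i
          fin_cases i
          · simpa using hb
          · simpa using ha)
        ((expKernel_sub_isBigO hω a b).congr_left fun t => by
          simp [kernelSum, Fin.sum_univ_two]
          ring)
      simpa [Fin.prod_univ_two, Gamma1, div_eq_mul_inv, mul_comm] using h
    -- moving both apices by `-ω` multiplies both sides by `b / a`
    | succ k ih =>
      intro a b ha hb hak hbk
      have hshift : ∀ y : ℂ, y + (k + 1 : ℕ) * ω = y + ω + k * ω := fun y => by push_cast; ring
      rw [hshift] at hak hbk
      have hs : ∀ y : ℂ, (∀ n : ℕ, y + n * ω ≠ 0) → ∀ n : ℕ, y + ω + n * ω ≠ 0 := by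
        intro y hy n
        convert hy (n + 1) using 1
        push_cast
        ring
      have h1 := ih (a + ω) (b + ω) (hs a ha) (hs b hb) hak hbk
      have ha0 : a ≠ 0 := by simpa using ha 0
      have hb0 : b ≠ 0 := by simpa using hb 0
      have h2 := (tendsto_one_sub_exp_div_one_sub_exp (b := b) ha0).mul h1
      have h3 : b / a * (Gamma1 (a + ω) ω / Gamma1 (b + ω) ω) = Gamma1 a ω / Gamma1 b ω := by
        have := Gamma1_ne_zero a ω
        have := Gamma1_ne_zero b ω
        rw [Gamma1_add hω ha0, Gamma1_add hω hb0]
        field_simp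
      rw [h3] at h2
      refine h2.congr' ?_
      filter_upwards [self_mem_nhdsWithin] with t ht
      rw [coneProd_one_eq hω ht (y := a), coneProd_one_eq hω ht (y := b), add_sub_add_right_eq_sub,
        mul_div_mul_comm]
      ring
  obtain ⟨k, hk⟩ := exists_nat_re_pos hω a
  obtain ⟨l, hl⟩ := exists_nat_re_pos hω b
  exact key (max k l) a b ha hb (hk _ (le_max_left _ _)) (hl _ (le_max_right _ _))

/-- The second difference `e^{-yt} (1 - e^{-t}) / ((1 - e^{-rt}) (1 + e^{-t}))` of the kernels with
periods `r, 2` tends to `1 / (2r)`. -/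
theorem expKernel_two_isBigO {r : ℂ} (hr : 0 < r.re) (y : ℂ) :
    (fun t => expKernel ![r, 2] y t + expKernel ![r, 2] (y + 2) t
      - 2 * expKernel ![r, 2] (y + 1) t - 1 / (2 * r)) =O[𝓝[>] 0] fun t => t := by
  have hr0 : r ≠ 0 := fun h => by simp [h] at hr
  obtain ⟨g, hg, hg0, hg'⟩ := exists_analyticAt_div_one_sub_exp hr0
  obtain ⟨d, hd, hd0, hd'⟩ := exists_analyticAt_one_sub_exp_div 1
  have hA : AnalyticAt ℂ (fun z : ℂ => (1 + exp (-z))⁻¹) 0 := by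
    refine AnalyticAt.inv (by fun_prop) ?_
    norm_num
  have h := isBigO_sub_of_analyticAt (g := fun z => exp (-(y * z)) * d z * g z * (1 + exp (-z))⁻¹)
    ((((by fun_prop : AnalyticAt ℂ (fun z => exp (-(y * z))) 0).mul hd).mul hg).mul hA)
    (h := fun t => expKernel ![r, 2] y t + expKernel ![r, 2] (y + 2) t
      - 2 * expKernel ![r, 2] (y + 1) t) (fun t ht => by
      have ht0 : (t : ℂ) ≠ 0 := ofReal_ne_zero.mpr ht.ne'
      have h1 : exp (-((y + 1) * t)) = exp (-(y * t)) * exp (-t) := by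
        rw [← exp_add]
        congr 1
        ring
      have h2 : exp (-((y + 2) * t)) = exp (-(y * t)) * exp (-t) ^ 2 := by
        rw [← exp_nat_mul, ← exp_add]
        congr 1
        push_cast
        ring
      have h3 : exp (-(2 * (t : ℂ))) = exp (-t) ^ 2 := by
        rw [← exp_nat_mul]
        congr 1
        push_cast
        ring
      have h4 : d t = (1 - exp (-t)) / t := by
        have := hd' t
        rw [one_mul] at this
        rw [this, mul_div_cancel_left₀ _ ht0]
      have h5 : 1 - exp (-(t : ℂ)) ≠ 0 := by
        simpa using one_sub_exp_neg_ne_zero (w := 1) (by simp) ht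
      have h6 : 1 - exp (-(t : ℂ)) ^ 2 ≠ 0 := by
        rw [← h3]
        exact one_sub_exp_neg_ne_zero (w := 2) (by simp) ht
      have h7 : 1 + exp (-(t : ℂ)) ≠ 0 := fun h =>
        h6 (by linear_combination (1 - exp (-(t : ℂ))) * h)
      have h8 := one_sub_exp_neg_ne_zero hr ht
      simp only [expKernel_two, hg' _ ht0, h1, h2, h3, h4]
      generalize exp (-(t : ℂ)) = E at *
      generalize exp (-(r * t)) = R at *
      field_simp
      ring)
  refine h.congr_left fun t => ?_
  simp only [hg0, hd0]
  norm_num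

/-- The scaling limit of the second difference of double `q`-Pochhammer symbols. -/
theorem tendsto_coneProd_two {r y : ℂ} (hr : 0 < r.re)
    (hy : ∀ m n : ℕ, y + m + n * r ≠ 0) :
    Tendsto (fun t : ℝ => (t : ℂ) ^ (-(1 / (2 * r))) *
        (coneProd ![r, 2] y t * coneProd ![r, 2] (y + 2) t / coneProd ![r, 2] (y + 1) t ^ 2))
      (𝓝[>] 0) (𝓝 (Gamma2 (y + 1) r 2 ^ 2 / (Gamma2 y r 2 * Gamma2 (y + 2) r 2))) := by
  have h2 : 0 < (2 : ℂ).re := by simp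
  have hω' : ∀ i, 0 < ((![r, 2] : Fin 2 → ℂ) i).re := by
    simpa [Fin.forall_fin_two] using hr
  have key : ∀ k : ℕ, ∀ y : ℂ, (∀ m n : ℕ, y + m + n * r ≠ 0) → 0 < (y + k * r).re →
      Tendsto (fun t : ℝ => (t : ℂ) ^ (-(1 / (2 * r))) *
        (coneProd ![r, 2] y t * coneProd ![r, 2] (y + 2) t / coneProd ![r, 2] (y + 1) t ^ 2))
      (𝓝[>] 0) (𝓝 (Gamma2 (y + 1) r 2 ^ 2 / (Gamma2 y r 2 * Gamma2 (y + 2) r 2))) := by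
    intro k
    induction k with
    | zero =>
      intro y _ hy0
      have hy0' : 0 < y.re := by simpa using hy0
      have h := tendsto_prod_coneProd (ω := ![r, 2]) (ι := Fin 3) (m := ![1, 1, -2])
        (x := ![y, y + 2, y + 1]) (c := 1 / (2 * r)) hω' (by
          intro i
          fin_cases i <;> simp <;> linarith)
        ((expKernel_two_isBigO hr y).congr_left fun t => by
          simp [kernelSum, Fin.sum_univ_three]
          ring)
      have e1 : ∀ f : ℂ → ℂ, ∏ i, f ((![y, y + 2, y + 1] : Fin 3 → ℂ) i) ^
          ((![1, 1, -2] : Fin 3 → ℤ) i) = f y * f (y + 2) / f (y + 1) ^ 2 := by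
        intro f
        simp only [Fin.prod_univ_three, Matrix.cons_val_zero, Matrix.cons_val_one, Matrix.cons_val,
          zpow_one]
        rw [zpow_neg, div_eq_mul_inv]
        norm_cast
      rw [e1 (fun z => multiGamma ![r, 2] z), inv_div] at h
      exact h.congr fun t => congrArg _ (e1 fun z => coneProd ![r, 2] z t)
    -- moving `y` by `-r` brings in the second difference for the single period `2`, whose powers
    -- of `t` cancel
    | succ k ih =>
      intro y hy hyk
      rw [show y + (k + 1 : ℕ) * r = y + r + k * r by push_cast; ring] at hyk
      have h1 := ih (y + r) (fun m n => by
        convert hy m (n + 1) using 1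
        push_cast
        ring) hyk
      have hA : ∀ j : ℕ, ∀ n : ℕ, y + j + n * 2 ≠ 0 := fun j n => by
        convert hy (j + n * 2) 0 using 1
        push_cast
        ring
      have hA0 : ∀ n : ℕ, y + n * 2 ≠ 0 := by simpa using hA 0
      have hA1 : ∀ n : ℕ, y + 1 + n * 2 ≠ 0 := by simpa using hA 1
      have hA2 : ∀ n : ℕ, y + 2 + n * 2 ≠ 0 := by simpa using hA 2
      have h3 := ((tendsto_coneProd_div h2 hA1 hA0).mul (tendsto_coneProd_div h2 hA1 hA2)).mul h1
      have e1 := Gamma2_eq (y := y) hr h2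
      have e2 := Gamma2_eq (y := y + 1) hr h2
      have e3 := Gamma2_eq (y := y + 2) hr h2
      have c1 : y + r + 1 = y + 1 + r := by ring
      have c2 : y + r + 2 = y + 2 + r := by ring
      rw [c1, c2] at h3
      convert h3.congr' ?_ using 2
      · rw [e1, e2, e3]
        have := Gamma1_ne_zero y 2
        have := Gamma1_ne_zero (y + 2) 2
        have := Gamma2_ne_zero (y + r) r 2
        have := Gamma2_ne_zero (y + 2 + r) r 2
        field_simp
      · filter_upwards [self_mem_nhdsWithin] with t ht
        have ht' : (0 : ℝ) < t := ht
        have ht0 : (t : ℂ) ≠ 0 := ofReal_ne_zero.mpr ht'.ne'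
        have h5 : (t : ℂ) ^ (-((y + 1 - y) / 2)) * (t : ℂ) ^ (-((y + 1 - (y + 2)) / 2)) = 1 := by
          rw [← cpow_add _ _ ht0, show -((y + 1 - y) / 2) + -((y + 1 - (y + 2)) / 2) = 0 by ring,
            cpow_zero]
        rw [coneProd_two_eq hr h2 ht' (y := y), coneProd_two_eq hr h2 ht' (y := y + 1),
          coneProd_two_eq hr h2 ht' (y := y + 2)]
        linear_combination (exp := 1) (coneProd ![2] y t / coneProd ![2] (y + 1) t *
          (coneProd ![2] (y + 2) t / coneProd ![2] (y + 1) t) * ((t : ℂ) ^ (-(1 / (2 * r))) *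
          (coneProd ![r, 2] (y + r) t * coneProd ![r, 2] (y + 2 + r) t /
            coneProd ![r, 2] (y + 1 + r) t ^ 2))) * h5
  obtain ⟨k, hk⟩ := exists_nat_re_pos hr y
  exact key k y hy (hk k le_rfl)

/-! ### The reflection formula for `Γ₁` -/

theorem kernelSum_shift {N : ℕ} (ω : Fin N → ℂ) {ι : Type*} [Fintype ι] (m : ι → ℤ) (x : ι → ℂ)
    (y : ℂ) (t : ℝ) :
    kernelSum ω m (fun i => x i + y) t = exp (-(y * t)) * kernelSum ω m x t := by
  simp only [kernelSum, expKernel_shift, Finset.mul_sum]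
  exact Finset.sum_congr rfl fun i _ => by ring

/-- A combination of multiple Gamma functions whose kernel vanishes at the origin tends to `1` as
the apices go to infinity. -/
theorem tendsto_prod_multiGamma_shift {N : ℕ} {ω : Fin N → ℂ} {ι : Type*} [Fintype ι] {m : ι → ℤ}
    {x : ι → ℂ} (hω : ∀ i, 0 < (ω i).re) (hx : ∀ i, 0 < (x i).re)
    (hc : kernelSum ω m x =O[𝓝[>] 0] fun t => t) {δ : ℂ} (hδ : 0 < δ.re) :
    Tendsto (fun n : ℕ => ∏ i, multiGamma ω (x i + n * δ) ^ m i) atTop (𝓝 1) := by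
  have hle : ∀ n : ℕ, ∀ t : ℝ, 0 < t → ‖exp (-(n * δ * t))‖ ≤ 1 := by
    intro n t ht
    have : 0 ≤ (n : ℝ) * δ.re * t := by positivity
    rw [norm_exp, Real.exp_le_one_iff]
    simpa using this
  have hreg : ∀ y : ι → ℂ, kernelReg ω m y 0 = kernelSum ω m y := by
    intro y
    funext t
    simp [kernelReg]
  obtain ⟨a, ha, htop⟩ := exists_kernelReg_isBigO_atTop (m := m) (c := 0) hω hx
  have hcont := continuousOn_kernelReg (m := m) (x := x) (c := 0) hω
  rw [hreg] at htop hcont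
  have hint : MellinConvergent (kernelSum ω m x) 0 :=
    mellinConvergent_of_isBigO_id ha hcont htop hc (by simp)
  have hM : ∀ n : ℕ, ∏ i, multiGamma ω (x i + n * δ) ^ m i =
      exp (∫ t in Set.Ioi (0 : ℝ), exp (-(n * δ * t)) * ((t : ℂ) ^ ((0 : ℂ) - 1) •
        kernelSum ω m x t)) := by
    intro n
    have h := prod_multiGamma_zpow (m := m) (x := fun i => x i + n * δ) (c := 0) hω (fun i => by
      have h1 := hx i
      have h2 : 0 ≤ (n : ℝ) * δ.re := by positivity
      simp
      linarith) (by
      refine Asymptotics.IsBigO.trans ?_ hc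
      refine Asymptotics.IsBigO.of_bound 1 ?_
      filter_upwards [self_mem_nhdsWithin] with t ht
      rw [sub_zero, kernelSum_shift, norm_mul]
      exact mul_le_mul_of_nonneg_right (hle n t ht) (norm_nonneg _))
    rw [h, hreg, mellin]
    congr 1
    refine setIntegral_congr_fun measurableSet_Ioi fun t _ => ?_
    simp only [kernelSum_shift, smul_eq_mul]
    ring
  simp only [hM]
  have hlim : Tendsto (fun n : ℕ => ∫ t in Set.Ioi (0 : ℝ), exp (-(n * δ * t)) *
      ((t : ℂ) ^ ((0 : ℂ) - 1) • kernelSum ω m x t)) atTop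
      (𝓝 (∫ _t in Set.Ioi (0 : ℝ), (0 : ℂ))) := by
    refine tendsto_integral_of_dominated_convergence
      (fun t => ‖(t : ℂ) ^ ((0 : ℂ) - 1) • kernelSum ω m x t‖) (fun n => ?_) hint.norm
      (fun n => ?_) ?_
    · exact (Continuous.aestronglyMeasurable (by fun_prop)).mul hint.aestronglyMeasurable
    · filter_upwards [ae_restrict_mem measurableSet_Ioi] with t ht
      rw [norm_mul]
      exact mul_le_of_le_one_left (norm_nonneg _) (hle n t ht)
    · filter_upwards [ae_restrict_mem measurableSet_Ioi] with t ht
      have ht' : (0 : ℝ) < t := ht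
      suffices h : Tendsto (fun n : ℕ => exp (-(n * δ * t))) atTop (𝓝 0) by
        simpa only [zero_mul] using h.mul_const ((t : ℂ) ^ ((0 : ℂ) - 1) • kernelSum ω m x t)
      rw [tendsto_zero_iff_norm_tendsto_zero]
      have h1 : ∀ n : ℕ, ‖exp (-(n * δ * t))‖ = Real.exp (-(δ.re * t)) ^ n := by
        intro n
        rw [norm_exp, ← Real.exp_nat_mul]
        congr 1
        simp
        ring
      simp only [h1]
      refine tendsto_pow_atTop_nhds_zero_of_lt_one (Real.exp_pos _).le ?_
      rw [Real.exp_lt_one_iff]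
      have := mul_pos hδ ht'
      linarith
  rw [integral_zero] at hlim
  have h := (continuous_exp.tendsto _).comp hlim
  rw [exp_zero] at h
  exact h

/-- The partial products of the two sides of the reflection formula, in terms of Euler's product
for the sine. -/
theorem prod_add_mul_one_sub_add (α : ℂ) (n : ℕ) :
    Real.pi * (α + n) * ∏ k ∈ Finset.range n, ((α + k) * (1 - α + k)) =
      (Real.pi * α * ∏ j ∈ Finset.range n, ((1 : ℂ) - α ^ 2 / ((j : ℂ) + 1) ^ 2)) *
        ∏ k ∈ Finset.range n, ((k : ℂ) + 1) ^ 2 := by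
  induction n with
  | zero => simp
  | succ n ih =>
    have hn : (n : ℂ) + 1 ≠ 0 := Nat.cast_add_one_ne_zero n
    have h1 : (1 - α ^ 2 / ((n : ℂ) + 1) ^ 2) * ((n : ℂ) + 1) ^ 2 = (n + 1) ^ 2 - α ^ 2 := by
      field_simp
    simp only [Finset.prod_range_succ]
    push_cast
    linear_combination ((1 - α + n) * (α + n + 1)) * ih -
      Real.pi * α * (∏ j ∈ Finset.range n, ((1 : ℂ) - α ^ 2 / ((j : ℂ) + 1) ^ 2)) *
        (∏ k ∈ Finset.range n, ((k : ℂ) + 1) ^ 2) * h1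

/-- Reflection formula: `Γ₁(y | ω) Γ₁(ω - y | ω) sin(πy/ω)` does not depend on `y`. -/
theorem Gamma1_mul_Gamma1_sub_mul_sin {ω a b : ℂ} (hω : 0 < ω.re) (ha : ∀ k : ℤ, a ≠ k * ω)
    (hb : ∀ k : ℤ, b ≠ k * ω) :
    Gamma1 a ω * Gamma1 (ω - a) ω * sin (Real.pi * (a / ω)) =
      Gamma1 b ω * Gamma1 (ω - b) ω * sin (Real.pi * (b / ω)) := by
  have hω0 : ω ≠ 0 := fun h => by simp [h] at hω
  have hpi : (Real.pi : ℂ) ≠ 0 := ofReal_ne_zero.mpr Real.pi_ne_zero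
  have hω' : ∀ i, 0 < ((![ω] : Fin 1 → ℂ) i).re := by simpa using hω
  have hadd : ∀ y : ℂ, (∀ k : ℤ, y ≠ k * ω) → ∀ n : ℕ, y + n * ω ≠ 0 := by
    intro y hy n h
    refine hy (-n) ?_
    push_cast
    linear_combination h
  have hsub : ∀ y : ℂ, (∀ k : ℤ, y ≠ k * ω) → ∀ n : ℕ, ω - y + n * ω ≠ 0 := by
    intro y hy n h
    refine hy (n + 1) ?_
    push_cast
    linear_combination -h
  have hsin : ∀ y : ℂ, (∀ k : ℤ, y ≠ k * ω) → sin (Real.pi * (y / ω)) ≠ 0 := by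
    intro y hy h
    obtain ⟨k, hk⟩ := Complex.sin_eq_zero_iff.mp h
    refine hy k ?_
    rw [mul_comm (k : ℂ)] at hk
    rw [← mul_left_cancel₀ hpi hk, div_mul_cancel₀ _ hω0]
  -- the ratio of Gamma functions tends to `1` along the translations by multiples of `ω`
  have hratio : Tendsto (fun n : ℕ => Gamma1 (a + n * ω) ω * Gamma1 (ω - a + n * ω) ω /
      (Gamma1 (b + n * ω) ω * Gamma1 (ω - b + n * ω) ω)) atTop (𝓝 1) := by
    obtain ⟨k₁, h₁⟩ := exists_nat_re_pos hω a
    obtain ⟨k₂, h₂⟩ := exists_nat_re_pos hω (ω - a)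
    obtain ⟨k₃, h₃⟩ := exists_nat_re_pos hω b
    obtain ⟨k₄, h₄⟩ := exists_nat_re_pos hω (ω - b)
    set K : ℕ := k₁ + k₂ + k₃ + k₄ with hK
    have hO := (expKernel_sub_isBigO hω (b + K * ω) (a + K * ω)).add
      (expKernel_sub_isBigO hω (ω - b + K * ω) (ω - a + K * ω))
    have h := tendsto_prod_multiGamma_shift (ω := ![ω]) (ι := Fin 4) (m := ![1, 1, -1, -1])
      (x := ![a + K * ω, ω - a + K * ω, b + K * ω, ω - b + K * ω]) hω' (by
        intro i
        fin_cases i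
        · exact h₁ K (by omega)
        · exact h₂ K (by omega)
        · exact h₃ K (by omega)
        · exact h₄ K (by omega)) (hO.congr_left fun t => by
        simp [kernelSum, Fin.sum_univ_four]
        field_simp
        ring) hω
    rw [← tendsto_add_atTop_iff_nat K]
    refine h.congr fun n => ?_
    have hc : ∀ y : ℂ, y + ((n + K : ℕ) : ℂ) * ω = y + K * ω + n * ω := fun y => by
      push_cast
      ring
    simp only [hc, Gamma1, Fin.prod_univ_four, Matrix.cons_val_zero, Matrix.cons_val_one,
      Matrix.cons_val, zpow_one, zpow_neg]
    rw [div_eq_mul_inv, mul_inv, ← mul_assoc]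
  have hE : ∀ y : ℂ, Tendsto (fun n : ℕ => Real.pi * (y / ω) *
      ∏ j ∈ Finset.range n, ((1 : ℂ) - (y / ω) ^ 2 / ((j : ℂ) + 1) ^ 2)) atTop
      (𝓝 (sin (Real.pi * (y / ω)))) := fun y => tendsto_euler_sin_prod (y / ω)
  have hfrac : Tendsto (fun n : ℕ => (b / ω + n) / (a / ω + n)) atTop (𝓝 1) := by
    have h1 := (tendsto_natCast_div_add_atTop (𝕜 := ℂ) (a / ω)).div
      (tendsto_natCast_div_add_atTop (b / ω)) one_ne_zero
    rw [div_one] at h1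
    refine h1.congr' ?_
    filter_upwards [eventually_gt_atTop 0] with n hn
    have hn0 : (n : ℂ) ≠ 0 := Nat.cast_ne_zero.mpr hn.ne'
    simp only [Pi.div_apply]
    rw [div_div_div_cancel_left' _ _ hn0, add_comm, add_comm (n : ℂ)]
  have hprod : ∀ y : ℂ, ∀ n : ℕ, (∏ k ∈ Finset.range n, (y + k * ω)) *
      ∏ k ∈ Finset.range n, (ω - y + k * ω) =
      ω ^ (2 * n) * ∏ k ∈ Finset.range n, ((y / ω + k) * (1 - y / ω + k)) := by
    intro y n
    rw [← Finset.prod_mul_distrib, pow_mul, ← Finset.card_range n, ← Finset.prod_const,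
      Finset.card_range, ← Finset.prod_mul_distrib]
    refine Finset.prod_congr rfl fun k _ => ?_
    field_simp
  have hlim := (((hE a).div (hE b) (hsin b hb)).mul hfrac).mul_const
    (Gamma1 a ω * Gamma1 (ω - a) ω / (Gamma1 b ω * Gamma1 (ω - b) ω))
  -- by the functional equation the same ratio converges to the quotient of the two sides
  have huniq := tendsto_nhds_unique (hratio.congr fun n => ?_) hlim
  · have := hsin b hb
    have := Gamma1_ne_zero b ω
    have := Gamma1_ne_zero (ω - b) ω
    generalize sin (Real.pi * (a / ω)) = sa at *
    generalize sin (Real.pi * (b / ω)) = sb at *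
    field_simp at huniq
    linear_combination -huniq
  · have hne : ∀ y : ℂ, (∀ k : ℤ, y ≠ k * ω) → y / ω + n ≠ 0 := by
      intro y hy h
      refine hadd y hy n ?_
      field_simp at h
      linear_combination h
    have hP : ∀ y : ℂ, (∀ k : ℤ, y ≠ k * ω) →
        ∏ k ∈ Finset.range n, ((y / ω + k) * (1 - y / ω + k)) ≠ 0 := by
      intro y hy
      have h := hprod y n
      intro h0
      rw [h0, mul_zero] at h
      rcases mul_eq_zero.mp h with h | h
      · obtain ⟨k, -, hk⟩ := Finset.prod_eq_zero_iff.mp h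
        exact hadd y hy k hk
      · obtain ⟨k, -, hk⟩ := Finset.prod_eq_zero_iff.mp h
        exact hsub y hy k hk
    have hfact : ∏ k ∈ Finset.range n, ((k : ℂ) + 1) ^ 2 ≠ 0 :=
      Finset.prod_ne_zero_iff.mpr fun k _ => pow_ne_zero _ (Nat.cast_add_one_ne_zero k)
    have hEq : ∀ y : ℂ, Real.pi * (y / ω) *
        ∏ j ∈ Finset.range n, ((1 : ℂ) - (y / ω) ^ 2 / ((j : ℂ) + 1) ^ 2) =
        Real.pi * (y / ω + n) * (∏ k ∈ Finset.range n, ((y / ω + k) * (1 - y / ω + k))) /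
          ∏ k ∈ Finset.range n, ((k : ℂ) + 1) ^ 2 := fun y => by
      rw [prod_add_mul_one_sub_add, mul_div_cancel_right₀ _ hfact]
    have hsplit : ∀ y : ℂ, (∀ k : ℤ, y ≠ k * ω) →
        Gamma1 (y + n * ω) ω * Gamma1 (ω - y + n * ω) ω =
        ω ^ (2 * n) * (∏ k ∈ Finset.range n, ((y / ω + k) * (1 - y / ω + k))) *
          (Gamma1 y ω * Gamma1 (ω - y) ω) := by
      intro y hy
      rw [Gamma1_add_nat hω (hadd y hy), Gamma1_add_nat hω (hsub y hy), ← hprod]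
      ring
    simp only [Pi.div_apply]
    rw [hsplit a ha, hsplit b hb, hEq, hEq]
    have h1 := hne a ha
    have h2 := hne b hb
    have h3 := hP a ha
    have h4 := hP b hb
    have h5 := Gamma1_ne_zero b ω
    have h6 := Gamma1_ne_zero (ω - b) ω
    generalize a / ω + (n : ℂ) = A at *
    generalize b / ω + (n : ℂ) = B at *
    field_simp

/-! ### The scaling limit of the elliptic twist -/

theorem exp_mul_prod_pow {m : ℕ} (ω : Fin m → ℂ) (y : ℂ) (t : ℝ) {p : Fin m → ℂ}
    (hp : ∀ i, p i = exp (-(ω i * t))) (n : Fin m → ℕ) :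
    exp (-(y * t)) * ∏ i, p i ^ n i = exp (-(conePoint ω y n * t)) := by
  have h : ∏ i, p i ^ n i = exp (-(∑ i, (n i : ℂ) * ω i) * t) := by
    rw [← Finset.sum_neg_distrib, Finset.sum_mul, exp_sum]
    refine Finset.prod_congr rfl fun i _ => ?_
    rw [hp, ← exp_nat_mul]
    congr 1
    ring
  rw [h, ← exp_add, conePoint]
  congr 1
  ring

theorem qProd_exp {m : ℕ} (ω : Fin m → ℂ) (y : ℂ) (t : ℝ) {p : Fin m → ℂ}
    (hp : ∀ i, p i = exp (-(ω i * t))) : qProd (exp (-(y * t))) p = coneProd ω y t :=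
  tprod_congr fun n => by rw [exp_mul_prod_pow ω y t hp]

/-- `∏ (1 + e^{-tw}) ∏ (1 - e^{-tw}) = ∏ (1 - e^{-2tw})`. -/
theorem qProd_neg_exp_mul {m : ℕ} {ω : Fin m → ℂ} (hω : ∀ i, 0 < (ω i).re) (y : ℂ) {t : ℝ}
    (ht : 0 < t) {p : Fin m → ℂ} (hp : ∀ i, p i = exp (-(ω i * t))) :
    qProd (-exp (-(y * t))) p * coneProd ω y t = coneProd ω y (2 * t) := by
  have h1 : qProd (-exp (-(y * t))) p =
      ∏' n : Fin m → ℕ, (1 + exp (-(conePoint ω y n * t))) := by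
    refine tprod_congr fun n => ?_
    rw [neg_mul, exp_mul_prod_pow ω y t hp, sub_neg_eq_add]
  have h2 : Multipliable fun n : Fin m → ℕ => (1 + exp (-(conePoint ω y n * t))) :=
    Complex.multipliable_one_add_of_summable (hasSum_expKernel hω y ht).summable
  rw [h1, coneProd, ← h2.tprod_mul (multipliable_coneProd hω y ht)]
  refine tprod_congr fun n => ?_
  have h3 : exp (-(conePoint ω y n * (2 * t : ℝ))) = exp (-(conePoint ω y n * t)) ^ 2 := by
    rw [← exp_nat_mul]
    congr 1
    push_cast
    ring
  rw [h3]
  ring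

theorem tendsto_two_mul_nhdsGT : Tendsto (fun t : ℝ => 2 * t) (𝓝[>] 0) (𝓝[>] 0) := by
  refine tendsto_nhdsWithin_iff.mpr ⟨?_, ?_⟩
  · have h := ((by fun_prop : Continuous fun t : ℝ => 2 * t).tendsto 0).mono_left
      (nhdsWithin_le_nhds (s := Set.Ioi 0))
    simpa using h
  · filter_upwards [self_mem_nhdsWithin] with t ht
    have ht' : (0 : ℝ) < t := ht
    simpa using ht'

theorem ofReal_two_mul_cpow {t : ℝ} (ht : 0 < t) (c : ℂ) :
    ((2 * t : ℝ) : ℂ) ^ c = 2 ^ c * (t : ℂ) ^ c := by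
  have h := mul_cpow_ofReal_nonneg (a := 2) (b := t) zero_le_two ht.le c
  push_cast at h ⊢
  exact h

/-- A function that behaves like a power `t^c` changes by the factor `2^c` under `t ↦ 2t`. -/
theorem tendsto_div_two_mul {R : ℝ → ℂ} {c L : ℂ} (hL : L ≠ 0)
    (h : Tendsto (fun t : ℝ => (t : ℂ) ^ (-c) * R t) (𝓝[>] 0) (𝓝 L)) :
    Tendsto (fun t : ℝ => R (2 * t) / R t) (𝓝[>] 0) (𝓝 (2 ^ c)) := by
  have h1 := ((h.comp tendsto_two_mul_nhdsGT).div h hL).const_mul (2 ^ c : ℂ)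
  rw [div_self hL, mul_one] at h1
  refine h1.congr' ?_
  filter_upwards [self_mem_nhdsWithin] with t ht
  have ht0 : (t : ℂ) ≠ 0 := ofReal_ne_zero.mpr (ne_of_gt ht)
  have h2 : (t : ℂ) ^ (-c) ≠ 0 := cpow_ne_zero_iff.mpr (Or.inl ht0)
  have h3 : (2 : ℂ) ^ c ≠ 0 := cpow_ne_zero_iff.mpr (Or.inl two_ne_zero)
  simp only [Pi.div_apply, Function.comp]
  rw [ofReal_two_mul_cpow ht, cpow_neg 2]
  field_simp

/-- The scaling limits of the two eigenvalues of a block of the gauged elliptic twist. With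
`T = t^{1/(2r)}` and `w = 2^{1/(2r)}` the gauge is `u = T / w`, the normalization is asymptotic to
`ρ w T`, and the eigenvalues are asymptotic to `w⁻²` and `T⁻² Γ₁(a | 2r) / Γ₁(a + 2 | 2r)`. -/
theorem tendsto_gauged_eigenvalues {r a ρ : ℂ} (hr : 0 < r.re) (ha : ∀ n : ℕ, a + n * (2 * r) ≠ 0)
    (hb : ∀ n : ℕ, a + 2 + n * (2 * r) ≠ 0) {G : ℝ → ℂ}
    (hG : Tendsto (fun t : ℝ => ((2 * t : ℝ) : ℂ) ^ (-(1 / (2 * r))) * G t) (𝓝[>] 0) (𝓝 ρ)) :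
    Tendsto (fun t : ℝ => G t * ((((t / 2 : ℝ) : ℂ) ^ (1 / (2 * r)))⁻¹ *
        (qProd (-exp (-((a + 2) * t))) ![exp (-(2 * r * t))] /
          qProd (-exp (-(a * t))) ![exp (-(2 * r * t))]))) (𝓝[>] 0) (𝓝 ρ) ∧
      Tendsto (fun t : ℝ => G t * (((t / 2 : ℝ) : ℂ) ^ (1 / (2 * r)) *
        (qProd (exp (-((a + 2) * t))) ![exp (-(2 * r * t))] /
          qProd (exp (-(a * t))) ![exp (-(2 * r * t))]))) (𝓝[>] 0)
        (𝓝 (ρ * (Gamma1 a (2 * r) / Gamma1 (a + 2) (2 * r)))) := by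
  have hr0 : r ≠ 0 := fun h => by simp [h] at hr
  have h2r : 0 < (2 * r).re := by simpa using hr
  have h2r' : ∀ i, 0 < ((![2 * r] : Fin 1 → ℂ) i).re := by simpa using hr
  set R : ℝ → ℂ := fun t => coneProd ![2 * r] (a + 2) t / coneProd ![2 * r] a t with hR
  have hRlim := tendsto_coneProd_div h2r ha hb
  have hLne : Gamma1 a (2 * r) / Gamma1 (a + 2) (2 * r) ≠ 0 :=
    div_ne_zero (Gamma1_ne_zero _ _) (Gamma1_ne_zero _ _)
  have hq : ∀ (y : ℂ) (t : ℝ), qProd (exp (-(y * t))) ![exp (-(2 * r * t))] =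
      coneProd ![2 * r] y t := fun y t => qProd_exp _ y t (by simp)
  have hqn : ∀ (y : ℂ) (t : ℝ), 0 < t → qProd (-exp (-(y * t))) ![exp (-(2 * r * t))] *
      coneProd ![2 * r] y t = coneProd ![2 * r] y (2 * t) := fun y t ht =>
    qProd_neg_exp_mul h2r' y ht (by simp)
  set w : ℂ := 2 ^ (1 / (2 * r)) with hw
  have hw0 : w ≠ 0 := cpow_ne_zero_iff.mpr (Or.inl two_ne_zero)
  have hT0 : ∀ t : ℝ, 0 < t → (t : ℂ) ^ (1 / (2 * r)) ≠ 0 := fun t ht =>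
    cpow_ne_zero_iff.mpr (Or.inl (ofReal_ne_zero.mpr ht.ne'))
  have hu : ∀ t : ℝ, 0 < t → ((t / 2 : ℝ) : ℂ) ^ (1 / (2 * r)) = (t : ℂ) ^ (1 / (2 * r)) / w := by
    intro t ht
    have h := ofReal_two_mul_cpow (half_pos ht) (1 / (2 * r))
    rw [mul_div_cancel₀ _ (two_ne_zero' ℝ)] at h
    rw [h, mul_div_cancel_left₀ _ hw0]
  have hv : ∀ t : ℝ, 0 < t → ((2 * t : ℝ) : ℂ) ^ (-(1 / (2 * r))) =
      (w * (t : ℂ) ^ (1 / (2 * r)))⁻¹ := by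
    intro t ht
    rw [cpow_neg, ofReal_two_mul_cpow ht]
  have hc : -((a - (a + 2)) / (2 * r)) = 1 / (2 * r) + 1 / (2 * r) := by
    field_simp
    ring
  have hRlim' := hRlim
  rw [hc] at hRlim'
  constructor
  · have hA := tendsto_div_two_mul (R := R) (c := (a - (a + 2)) / (2 * r)) hLne hRlim
    have hA2 : (2 : ℂ) ^ ((a - (a + 2)) / (2 * r)) = (w * w)⁻¹ := by
      rw [← neg_neg ((a - (a + 2)) / (2 * r)), hc, cpow_neg, cpow_add _ _ two_ne_zero]
    rw [hA2] at hA
    have h := (hG.mul hA).mul_const (w * w)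
    rw [mul_assoc, inv_mul_cancel₀ (mul_ne_zero hw0 hw0), mul_one] at h
    refine h.congr' ?_
    filter_upwards [self_mem_nhdsWithin, hRlim.eventually_ne hLne] with t ht hne
    have ht' : (0 : ℝ) < t := ht
    have hne' : coneProd ![2 * r] (a + 2) t / coneProd ![2 * r] a t ≠ 0 := right_ne_zero_of_mul hne
    have h1 : coneProd ![2 * r] (a + 2) t ≠ 0 := fun h0 => hne' (by rw [h0, zero_div])
    have h2 : coneProd ![2 * r] a t ≠ 0 := fun h0 => hne' (by rw [h0, div_zero])
    simp only [hR]
    rw [← hqn _ t ht', ← hqn _ t ht', hu t ht', hv t ht']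
    have := hT0 t ht'
    field_simp
  · refine (hG.mul hRlim').congr' ?_
    filter_upwards [self_mem_nhdsWithin] with t ht
    have ht' : (0 : ℝ) < t := ht
    rw [hq, hq, hu t ht', hv t ht', cpow_add _ _ (ofReal_ne_zero.mpr ht'.ne')]
    have := hT0 t ht'
    field_simp

theorem eightVertex_mul (a b c d a' b' c' d' : ℂ) :
    eightVertex a b c d * eightVertex a' b' c' d' =
      eightVertex (a * a' + d * d') (b * b' + c * c') (b * c' + c * b') (a * d' + d * a') := by
  ext i j
  fin_cases i <;> fin_cases j <;> simp [eightVertex, Matrix.mul_apply, Fin.sum_univ_four] <;> ring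

theorem smul_eightVertex (k a b c d : ℂ) :
    k • eightVertex a b c d = eightVertex (k * a) (k * b) (k * c) (k * d) := by
  ext i j
  fin_cases i <;> fin_cases j <;> simp [eightVertex]

theorem tendsto_eightVertex {α : Type*} {l : Filter α} {a b c d : α → ℂ} {A B C D : ℂ}
    (ha : Tendsto a l (𝓝 A)) (hb : Tendsto b l (𝓝 B)) (hc : Tendsto c l (𝓝 C))
    (hd : Tendsto d l (𝓝 D)) :
    Tendsto (fun x => eightVertex (a x) (b x) (c x) (d x)) l
      (𝓝 (eightVertex A B C D)) := by
  refine tendsto_pi_nhds.mpr fun i => tendsto_pi_nhds.mpr fun j => ?_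
  fin_cases i <;> fin_cases j <;> simp [eightVertex] <;>
    first | assumption | exact tendsto_const_nhds

theorem exp_neg_ofReal_cpow (t : ℝ) (c : ℂ) : ((Real.exp (-t) : ℝ) : ℂ) ^ c = exp (-(c * t)) := by
  rw [cpow_def_of_ne_zero (ofReal_ne_zero.mpr (Real.exp_pos _).ne'),
    ← ofReal_log (Real.exp_pos _).le, Real.log_exp]
  congr 1
  push_cast
  ring

/-- For small `t` the principal square root of `p = e^{-2rt}` is `e^{-rt}`. -/
theorem eventually_exp_cpow_half (r : ℂ) :
    ∀ᶠ t : ℝ in 𝓝[>] 0, exp (-(2 * r * t)) ^ (1 / 2 : ℂ) = exp (-(r * t)) := by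
  have h : Tendsto (fun t : ℝ => (-(2 * r * t)).im) (𝓝[>] 0) (𝓝 0) := by
    have h := ((by fun_prop : Continuous fun t : ℝ => (-(2 * r * (t : ℂ))).im).tendsto 0).mono_left
      (nhdsWithin_le_nhds (s := Set.Ioi 0))
    simpa using h
  filter_upwards [h.eventually_const_lt (neg_lt_zero.mpr Real.pi_pos),
    h.eventually_lt_const Real.pi_pos] with t h1 h2
  rw [cpow_def_of_ne_zero (exp_ne_zero _), log_exp h1 h2.le]
  congr 1
  ring

theorem Generic.ne {β r : ℂ} (h : Generic β r) (m n : ℕ) :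
    spec β + m + n * r ≠ 0 ∧ spec β - m - n * r ≠ 0 ∧ spec β - 1 + n * r ≠ 0 ∧
      spec β + 1 - n * r ≠ 0 := by
  obtain ⟨h1, h2, h3, h4⟩ := h m n
  exact ⟨fun h => h2 (by linear_combination h), fun h => h1 (by linear_combination h),
    fun h => h3 (by linear_combination h), fun h => h4 (by linear_combination h)⟩

/-- The elliptic twist, gauged by the constant matrix `scalingGauge`, tends to the scaled twist. -/
theorem tendsto_scalingGauge_mul_E1 {β r : ℂ} (hr : 0 < r.re) (hβ : Generic β r) :
    Tendsto (fun q : ℝ => scalingGauge q r *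
        E1 ((q : ℂ) ^ (I * β / Real.pi)) ((q : ℂ) ^ (2 * r)) (q : ℂ))
      (𝓝[<] 1) (𝓝 (E2 β r)) := by
  set x : ℂ := spec β with hx
  have hx' : I * β / Real.pi = x := rfl
  have hlog : Tendsto (fun q : ℝ => -Real.log q) (𝓝[<] 1) (𝓝[>] 0) := by
    refine tendsto_nhdsWithin_iff.mpr ⟨?_, ?_⟩
    · have h := ((Real.continuousAt_log one_ne_zero).tendsto.neg).mono_left
        (nhdsWithin_le_nhds (s := Set.Iio 1))
      simpa using h
    · filter_upwards [self_mem_nhdsWithin, mem_nhdsWithin_of_mem_nhds (Ioi_mem_nhds one_pos)]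
        with q h1 h2
      have := Real.log_neg h2 h1
      simpa using this
  suffices hmain : Tendsto (fun t : ℝ => scalingGauge (Real.exp (-t)) r *
      E1 (((Real.exp (-t) : ℝ) : ℂ) ^ x) (((Real.exp (-t) : ℝ) : ℂ) ^ (2 * r))
        ((Real.exp (-t) : ℝ) : ℂ)) (𝓝[>] 0) (𝓝 (E2 β r)) by
    refine (hmain.comp hlog).congr' ?_
    filter_upwards [mem_nhdsWithin_of_mem_nhds (Ioi_mem_nhds one_pos)] with q hq
    simp only [Function.comp, neg_neg, Real.exp_log hq, hx']
  -- the normalization has periods `p` and `q⁴`, that is `e^{-ωT}` with `T = 2t` and `ω = r, 2`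
  set G : ℝ → ℂ := fun t => ellRho (exp (-(x * t))) (exp (-(2 * r * t))) (exp (-t)) with hGdef
  have hGeq : ∀ t : ℝ, G t = coneProd ![r, 2] (r + x) (2 * t) * coneProd ![r, 2] (r + x + 2) (2 * t)
      / coneProd ![r, 2] (r + x + 1) (2 * t) ^ 2 := by
    intro t
    have hp : ∀ i, (![exp (-(2 * r * t)), exp (-t) ^ 4] : Fin 2 → ℂ) i =
        exp (-((![r, 2] : Fin 2 → ℂ) i * ((2 * t : ℝ) : ℂ))) := by
      intro i
      fin_cases i
      · simp only [Fin.zero_eta, Matrix.cons_val_zero]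
        congr 1
        push_cast
        ring
      · simp only [Fin.mk_one, Matrix.cons_val_one, Matrix.cons_val_zero]
        rw [← exp_nat_mul]
        congr 1
        push_cast
        ring
    have e0 : exp (-(2 * r * t)) * exp (-(x * t)) ^ 2 = exp (-((r + x) * ((2 * t : ℝ) : ℂ))) := by
      rw [← exp_nat_mul, ← exp_add]
      congr 1
      push_cast
      ring
    have e2 : exp (-(2 * r * t)) * exp (-t) ^ 4 * exp (-(x * t)) ^ 2 =
        exp (-((r + x + 2) * ((2 * t : ℝ) : ℂ))) := by
      rw [← exp_nat_mul, ← exp_nat_mul, ← exp_add, ← exp_add]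
      congr 1
      push_cast
      ring
    have e1 : exp (-(2 * r * t)) * exp (-t) ^ 2 * exp (-(x * t)) ^ 2 =
        exp (-((r + x + 1) * ((2 * t : ℝ) : ℂ))) := by
      rw [← exp_nat_mul, ← exp_nat_mul, ← exp_add, ← exp_add]
      congr 1
      push_cast
      ring
    simp only [hGdef, ellRho]
    rw [e0, e1, e2, qProd_exp _ _ _ hp, qProd_exp _ _ _ hp, qProd_exp _ _ _ hp]
  have hG : Tendsto (fun t : ℝ => ((2 * t : ℝ) : ℂ) ^ (-(1 / (2 * r))) * G t) (𝓝[>] 0)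
      (𝓝 (rhoE β r)) := by
    have h := (tendsto_coneProd_two (y := r + x) hr fun m n => by
      convert (hβ.ne m (n + 1)).1 using 1
      push_cast
      ring).comp tendsto_two_mul_nhdsGT
    simp only [Function.comp_def, ← hGeq] at h
    convert h using 2
    simp only [rhoE, ← hx]
    rw [show r + 1 + x = r + x + 1 by ring, show r + 2 + x = r + x + 2 by ring]
  obtain ⟨hA1, hA2⟩ := tendsto_gauged_eigenvalues (a := r - 1 + x) hr
    (fun n => by
      convert (hβ.ne 0 (2 * n + 1)).2.2.1 using 1
      push_cast
      ring)
    (fun n => by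
      convert (hβ.ne 1 (2 * n + 1)).1 using 1
      push_cast
      ring) hG
  obtain ⟨hB1, hB2⟩ := tendsto_gauged_eigenvalues (a := 2 * r - 1 + x) hr
    (fun n => by
      convert (hβ.ne 0 (2 * n + 2)).2.2.1 using 1
      push_cast
      ring)
    (fun n => by
      convert (hβ.ne 1 (2 * n + 2)).1 using 1
      push_cast
      ring) hG
  have hE2 : E2 β r = eightVertex ((rhoE β r + rhoE β r * aMinus β r) / 2)
      ((rhoE β r + rhoE β r * bMinus β r) / 2) ((rhoE β r - rhoE β r * bMinus β r) / 2)
      ((rhoE β r - rhoE β r * aMinus β r) / 2) := by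
    rw [E2, smul_eightVertex, aE, bE, cE, dE]
    congr 1 <;> ring
  have ha : Gamma1 (r - 1 + x) (2 * r) / Gamma1 (r - 1 + x + 2) (2 * r) = aMinus β r := by
    rw [aMinus, ← hx, show r - 1 + x + 2 = r + 1 + x by ring]
  have hb : Gamma1 (2 * r - 1 + x) (2 * r) / Gamma1 (2 * r - 1 + x + 2) (2 * r) = bMinus β r := by
    rw [bMinus, ← hx, show 2 * r - 1 + x + 2 = 2 * r + 1 + x by ring]
  rw [ha] at hA2
  rw [hb] at hB2
  rw [hE2]
  refine (tendsto_eightVertex ((hA1.add hA2).div_const 2) ((hB1.add hB2).div_const 2)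
    ((hB1.sub hB2).div_const 2) ((hA1.sub hA2).div_const 2)).congr' ?_
  filter_upwards [eventually_exp_cpow_half r] with t ht
  have hq : ((Real.exp (-t) : ℝ) : ℂ) = exp (-t) := by push_cast; rfl
  have hqi : (exp (-(t : ℂ)))⁻¹ = exp t := by rw [exp_neg, inv_inv]
  have c1 : exp (-(r * t)) * exp (-t) * exp (-(x * t)) = exp (-((r - 1 + x + 2) * t)) := by
    rw [← exp_add, ← exp_add]
    congr 1
    ring
  have c2 : exp (-(r * t)) * exp t * exp (-(x * t)) = exp (-((r - 1 + x) * t)) := by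
    rw [← exp_add, ← exp_add]
    congr 1
    ring
  have c3 : exp (-(2 * r * t)) * exp (-t) * exp (-(x * t)) =
      exp (-((2 * r - 1 + x + 2) * t)) := by
    rw [← exp_add, ← exp_add]
    congr 1
    ring
  have c4 : exp (-(2 * r * t)) * exp t * exp (-(x * t)) = exp (-((2 * r - 1 + x) * t)) := by
    rw [← exp_add, ← exp_add]
    congr 1
    ring
  rw [exp_neg_ofReal_cpow, exp_neg_ofReal_cpow, hq, E1, scalingGauge, Real.log_exp, neg_neg]
  simp only [ellAPlus, ellAMinus, ellBPlus, ellBMinus, ht, hqi, c1, c2, c3, c4]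
  rw [Matrix.mul_smul, eightVertex_mul, smul_eightVertex]
  simp only [hGdef]
  congr 1 <;> ring

/-! ### Scalar identities for the normalizations and matrix entries -/

theorem spec_neg (β : ℂ) : spec (-β) = -spec β := by
  simp only [spec]
  ring

theorem pi_mul_spec (β : ℂ) : Real.pi * spec β = I * β := by
  rw [spec, mul_div_cancel₀ _ (ofReal_ne_zero.mpr Real.pi_ne_zero)]

theorem Generic.ne_int_mul {β r : ℂ} (h : Generic β r) (k : ℤ) :
    spec β ≠ k ∧ spec β + 1 ≠ k * r ∧ spec β - 1 ≠ k * r := by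
  obtain ⟨n, rfl | rfl⟩ := k.eq_nat_or_neg
  · have h1 := h.ne n 0
    have h2 := h.ne 1 n
    have h3 := h.ne 0 n
    push_cast at *
    exact ⟨fun h => h1.2.1 (by linear_combination h), fun h => h3.2.2.2 (by linear_combination h),
      fun h => h2.2.1 (by linear_combination h)⟩
  · have h1 := h.ne n 0
    have h2 := h.ne 1 n
    have h3 := h.ne 0 n
    push_cast at *
    exact ⟨fun h => h1.1 (by linear_combination h), fun h => h2.1 (by linear_combination h),
      fun h => h3.2.2.1 (by linear_combination h)⟩

section Scalars

variable {β r : ℂ}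

theorem sin_add_div_ne_zero (hr : r ≠ 0) (hβ : Generic β r) :
    sin ((Real.pi + I * β) / (2 * r)) ≠ 0 ∧ cos ((Real.pi + I * β) / (2 * r)) ≠ 0 := by
  have hpi : (Real.pi : ℂ) ≠ 0 := ofReal_ne_zero.mpr Real.pi_ne_zero
  rw [← pi_mul_spec]
  constructor
  · intro h
    obtain ⟨k, hk⟩ := Complex.sin_eq_zero_iff.mp h
    refine (hβ.ne_int_mul (2 * k)).2.1 (mul_left_cancel₀ hpi ?_)
    rw [div_eq_iff (mul_ne_zero two_ne_zero hr)] at hk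
    push_cast
    linear_combination hk
  · intro h
    obtain ⟨k, hk⟩ := Complex.cos_eq_zero_iff.mp h
    refine (hβ.ne_int_mul (2 * k + 1)).2.1 (mul_left_cancel₀ hpi ?_)
    rw [div_eq_iff (mul_ne_zero two_ne_zero hr)] at hk
    push_cast
    linear_combination hk

/-- The ratio `aMinus (-β) r / aMinus β r`, from the reflection formula with period `2r`. -/
theorem aMinus_neg_mul_cos (hr : 0 < r.re) (hβ : Generic β r) :
    aMinus (-β) r * cos ((Real.pi + I * β) / (2 * r)) =
      aMinus β r * cos ((Real.pi - I * β) / (2 * r)) := by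
  have hr0 : r ≠ 0 := fun h => by simp [h] at hr
  have h := Gamma1_mul_Gamma1_sub_mul_sin (ω := 2 * r) (a := r - 1 - spec β)
    (b := r + 1 - spec β) (by simpa using hr)
    (fun k h => (hβ.ne_int_mul (1 - 2 * k)).2.1 (by push_cast; linear_combination -h))
    (fun k h => (hβ.ne_int_mul (1 - 2 * k)).2.2 (by push_cast; linear_combination -h))
  have e1 : sin (Real.pi * ((r - 1 - spec β) / (2 * r))) =
      cos ((Real.pi + I * β) / (2 * r)) := by
    rw [← Complex.sin_pi_div_two_sub, ← pi_mul_spec]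
    congr 1
    field_simp
    ring
  have e2 : sin (Real.pi * ((r + 1 - spec β) / (2 * r))) =
      cos ((Real.pi - I * β) / (2 * r)) := by
    rw [← Complex.sin_pi_div_two_sub, ← Complex.sin_pi_sub, ← pi_mul_spec]
    congr 1
    field_simp
    ring
  rw [e1, e2, show 2 * r - (r - 1 - spec β) = r + 1 + spec β by ring,
    show 2 * r - (r + 1 - spec β) = r - 1 + spec β by ring] at h
  have h1 := Gamma1_ne_zero (r + 1 + spec β) (2 * r)
  have h2 := Gamma1_ne_zero (r + 1 - spec β) (2 * r)
  simp only [aMinus, spec_neg, ← sub_eq_add_neg]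
  rw [div_mul_eq_mul_div, div_mul_eq_mul_div, div_eq_div_iff h2 h1]
  linear_combination h

/-- The ratio `bMinus (-β) r / bMinus β r`, from the reflection formula with period `2r`. -/
theorem bMinus_neg_mul_sin (hr : 0 < r.re) (hβ : Generic β r) :
    bMinus (-β) r * (1 - spec β) * sin ((Real.pi + I * β) / (2 * r)) =
      bMinus β r * (1 + spec β) * sin ((Real.pi - I * β) / (2 * r)) := by
  have hr0 : r ≠ 0 := fun h => by simp [h] at hr
  have h2r : 0 < (2 * r).re := by simpa using hr
  have h := Gamma1_mul_Gamma1_sub_mul_sin (ω := 2 * r) (a := 1 + spec β)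
    (b := 1 - spec β) h2r
    (fun k h => (hβ.ne_int_mul (2 * k)).2.1 (by push_cast; linear_combination h))
    (fun k h => (hβ.ne_int_mul (-2 * k)).2.2 (by push_cast; linear_combination -h))
  have hp : 1 + spec β ≠ 0 := fun h => (hβ.ne_int_mul 0).2.1 (by push_cast; linear_combination h)
  have hm : 1 - spec β ≠ 0 := fun h => (hβ.ne_int_mul 0).2.2 (by push_cast; linear_combination -h)
  have e1 : Real.pi * ((1 + spec β) / (2 * r)) = (Real.pi + I * β) / (2 * r) := by
    rw [← pi_mul_spec]
    ring
  have e2 : Real.pi * ((1 - spec β) / (2 * r)) = (Real.pi - I * β) / (2 * r) := by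
    rw [← pi_mul_spec]
    ring
  have g1 := Gamma1_add h2r hp
  have g2 := Gamma1_add h2r hm
  rw [e1, e2, show 2 * r - (1 + spec β) = 2 * r - 1 - spec β by ring,
    show 2 * r - (1 - spec β) = 2 * r - 1 + spec β by ring] at h
  have h1 := Gamma1_ne_zero (1 + spec β) (2 * r)
  have h2 := Gamma1_ne_zero (1 - spec β) (2 * r)
  simp only [bMinus, spec_neg, ← sub_eq_add_neg]
  rw [show 2 * r + 1 + spec β = 1 + spec β + 2 * r by ring,
    show 2 * r + 1 - spec β = 1 - spec β + 2 * r by ring, g1, g2]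
  generalize sin ((Real.pi + I * β) / (2 * r)) = A at *
  generalize sin ((Real.pi - I * β) / (2 * r)) = B at *
  generalize 1 + spec β = P at *
  generalize 1 - spec β = M at *
  field_simp
  linear_combination h

theorem Gamma2_add (hr : 0 < r.re) (y : ℂ) :
    Gamma2 (r + y) r 2 = Gamma2 y r 2 / Gamma1 y 2 := by
  rw [Gamma2_eq (y := y) hr (by simp), add_comm r y, mul_div_cancel_left₀ _ (Gamma1_ne_zero _ _)]

/-- The scalar factor of the twist from `RDY` to `RV8`: after shifting all arguments by `r` the
`Γ₂` factors cancel, and the `Γ₁(· | 2)` factors combine by the reflection formula. -/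
theorem rhoV8_eq (hr : 0 < r.re) (hβ : Generic β r) :
    rhoV8 β r = rhoE (-β) r * rhoDY β / rhoE β r := by
  have hint : ∀ k : ℤ, spec β ≠ k := fun k => (hβ.ne_int_mul k).1
  have hpi : (Real.pi : ℂ) ≠ 0 := ofReal_ne_zero.mpr Real.pi_ne_zero
  have h := Gamma1_mul_Gamma1_sub_mul_sin (ω := 2) (a := 1 + spec β) (b := 2 + spec β) (by simp)
    (fun k h => hint (2 * k - 1) (by push_cast; linear_combination h))
    (fun k h => hint (2 * k - 2) (by push_cast; linear_combination h))
  have e1 : sin (Real.pi * ((1 + spec β) / 2)) = cos (I * β / 2) := by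
    rw [← pi_mul_spec, ← Complex.sin_add_pi_div_two]
    congr 1
    ring
  have e2 : sin (Real.pi * ((2 + spec β) / 2)) = -sin (I * β / 2) := by
    rw [← pi_mul_spec, ← Complex.sin_add_pi]
    congr 1
    ring
  have hs : sin (I * β / 2) ≠ 0 := by
    intro h0
    obtain ⟨k, hk⟩ := Complex.sin_eq_zero_iff.mp h0
    refine hint (2 * k) (mul_left_cancel₀ hpi ?_)
    rw [pi_mul_spec]
    push_cast
    linear_combination 2 * hk
  rw [e1, e2, show 2 - (1 + spec β) = 1 - spec β by ring,
    show 2 - (2 + spec β) = -spec β by ring] at h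
  have s1 : r + 2 - -spec β = r + (2 + spec β) := by ring
  have s2 : r + 2 - (1 + spec β) = r + (1 - spec β) := by ring
  have s3 : r + 2 - spec β = r + (2 - spec β) := by ring
  have s4 : r + 2 - (1 - spec β) = r + (1 + spec β) := by ring
  have s5 : r + 1 + -spec β = r + (1 - spec β) := by ring
  have s6 : r + 2 + -spec β = r + (2 - spec β) := by ring
  simp only [rhoV8, rhoE, rhoDY, S2, spec_neg, s1, s2, s3, s4, s5, s6, add_assoc r, Gamma2_add hr,
    cot]
  have n1 := fun y => Gamma1_ne_zero y 2
  have n2 := fun y => Gamma2_ne_zero y r 2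
  have := n1 (spec β)
  have := n1 (1 + spec β)
  have := n1 (2 + spec β)
  have := n1 (1 - spec β)
  have := n1 (2 - spec β)
  have := n1 (-spec β)
  have := n2 (spec β)
  have := n2 (1 + spec β)
  have := n2 (2 + spec β)
  have := n2 (1 - spec β)
  have := n2 (2 - spec β)
  have := n2 (-spec β)
  generalize sin (I * β / 2) = s at *
  generalize cos (I * β / 2) = c at *
  generalize Gamma1 (spec β) 2 = a1 at *
  generalize Gamma1 (1 + spec β) 2 = a2 at *
  generalize Gamma1 (2 + spec β) 2 = a3 at *
  generalize Gamma1 (1 - spec β) 2 = a4 at *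
  generalize Gamma1 (2 - spec β) 2 = a5 at *
  generalize Gamma1 (-spec β) 2 = a6 at *
  generalize Gamma2 (spec β) r 2 = b1 at *
  generalize Gamma2 (1 + spec β) r 2 = b2 at *
  generalize Gamma2 (2 + spec β) r 2 = b3 at *
  generalize Gamma2 (1 - spec β) r 2 = b4 at *
  generalize Gamma2 (2 - spec β) r 2 = b5 at *
  generalize Gamma2 (-spec β) r 2 = b6 at *
  field_simp
  linear_combination (exp := 1) -h

/-- The normalizations `rhoF` and `rhoV8` agree; here the shift by `r` suffices. -/
theorem rhoF_eq (hr : 0 < r.re) : rhoF β r = rhoE (-β) r * rhoDY β / rhoE β r := by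
  have s1 : r + 2 - (1 + spec β) = r + (1 - spec β) := by ring
  have s2 : r + 2 - spec β = r + (2 - spec β) := by ring
  have s3 : r + 2 - (2 + spec β) = r + -spec β := by ring
  have s4 : r + 1 + -spec β = r + (1 - spec β) := by ring
  have s5 : r + 2 + -spec β = r + (2 - spec β) := by ring
  simp only [rhoF, rhoE, rhoDY, S2, spec_neg, s1, s2, s3, s4, s5, add_assoc r, Gamma2_add hr]
  have n1 := fun y => Gamma1_ne_zero y 2
  have n2 := fun y => Gamma2_ne_zero y r 2
  have := n1 (spec β)
  have := n1 (1 + spec β)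
  have := n1 (2 + spec β)
  have := n1 (1 - spec β)
  have := n1 (2 - spec β)
  have := n1 (-spec β)
  have := n2 (spec β)
  have := n2 (1 + spec β)
  have := n2 (2 + spec β)
  have := n2 (1 - spec β)
  have := n2 (2 - spec β)
  have := n2 (-spec β)
  field_simp

end Scalars

/-! ### Matrix identities -/

/-- The eight-vertex matrix with eigenvalues `p, m` on `e₁⊗e₁ ± e₂⊗e₂` and `p', m'` on
`e₁⊗e₂ ± e₂⊗e₁`. -/
noncomputable def eigenVertex (p m p' m' : ℂ) : Mat4 :=
  eightVertex ((p + m) / 2) ((p' + m') / 2) ((p' - m') / 2) ((p - m) / 2)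

theorem eigenVertex_mul (p m p' m' s n s' n' : ℂ) :
    eigenVertex p m p' m' * eigenVertex s n s' n' =
      eigenVertex (p * s) (m * n) (p' * s') (m' * n') := by
  rw [eigenVertex, eigenVertex, eightVertex_mul, eigenVertex]
  congr 1 <;> ring

theorem smul_eigenVertex (k p m p' m' : ℂ) :
    k • eigenVertex p m p' m' = eigenVertex (k * p) (k * m) (k * p') (k * m') := by
  rw [eigenVertex, smul_eightVertex, eigenVertex]
  congr 1 <;> ring

theorem eigenVertex_one : eigenVertex 1 1 1 1 = 1 := by
  ext i j
  fin_cases i <;> fin_cases j <;> simp [eigenVertex, eightVertex]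

theorem isUnit_det_eigenVertex {p m p' m' : ℂ} (hp : p ≠ 0) (hm : m ≠ 0) (hp' : p' ≠ 0)
    (hm' : m' ≠ 0) : IsUnit (eigenVertex p m p' m').det := by
  refine Matrix.isUnit_det_of_right_inverse (B := eigenVertex p⁻¹ m⁻¹ p'⁻¹ m'⁻¹) ?_
  rw [eigenVertex_mul, mul_inv_cancel₀ hp, mul_inv_cancel₀ hm, mul_inv_cancel₀ hp',
    mul_inv_cancel₀ hm', eigenVertex_one]

theorem eightVertex_mul_comm (a b c d a' b' c' d' : ℂ) :
    eightVertex a b c d * eightVertex a' b' c' d' =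
      eightVertex a' b' c' d' * eightVertex a b c d := by
  rw [eightVertex_mul, eightVertex_mul]
  congr 1 <;> ring

theorem flipP_mul_flipP : flipP * flipP = 1 := by
  ext i j
  fin_cases i <;> fin_cases j <;> simp [flipP, Matrix.mul_apply, Fin.sum_univ_four]

theorem op21_mul (A B : Mat4) : op21 (A * B) = op21 A * op21 B := by
  have h : flipP * A * flipP * (flipP * B * flipP) = flipP * A * (flipP * flipP) * B * flipP := by
    simp only [Matrix.mul_assoc]
  rw [op21, op21, op21, h, flipP_mul_flipP, Matrix.mul_one]
  simp only [Matrix.mul_assoc]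

theorem op21_one : op21 1 = 1 := by
  rw [op21, Matrix.mul_one, flipP_mul_flipP]

theorem op21_smul (k : ℂ) (A : Mat4) : op21 (k • A) = k • op21 A := by
  rw [op21, op21, Matrix.mul_smul, Matrix.smul_mul]

theorem op21_eightVertex (a b c d : ℂ) : op21 (eightVertex a b c d) = eightVertex a b c d := by
  ext i j
  fin_cases i <;> fin_cases j <;>
    simp [op21, flipP, eightVertex, Matrix.mul_apply, Fin.sum_univ_four]

theorem sixVertex_eq_eigenVertex (b c : ℂ) :
    sixVertex b c c = eigenVertex 1 1 (b + c) (b - c) := by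
  ext i j
  fin_cases i <;> fin_cases j <;> simp [sixVertex, eigenVertex, eightVertex]

theorem E2_eq_eigenVertex (β r : ℂ) :
    E2 β r = eigenVertex (rhoE β r) (rhoE β r * aMinus β r) (rhoE β r) (rhoE β r * bMinus β r) := by
  rw [E2, smul_eightVertex, eigenVertex, aE, bE, cE, dE]
  congr 1 <;> ring

theorem rhoE_ne_zero (β r : ℂ) : rhoE β r ≠ 0 :=
  div_ne_zero (pow_ne_zero _ (Gamma2_ne_zero _ _ _))
    (mul_ne_zero (Gamma2_ne_zero _ _ _) (Gamma2_ne_zero _ _ _))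

theorem isUnit_det_E2 (β r : ℂ) : IsUnit (E2 β r).det := by
  have h := rhoE_ne_zero β r
  have ha : aMinus β r ≠ 0 := div_ne_zero (Gamma1_ne_zero _ _) (Gamma1_ne_zero _ _)
  have hb : bMinus β r ≠ 0 := div_ne_zero (Gamma1_ne_zero _ _) (Gamma1_ne_zero _ _)
  rw [E2_eq_eigenVertex]
  exact isUnit_det_eigenVertex h (mul_ne_zero h ha) h (mul_ne_zero h hb)

theorem op21_eigenVertex (p m p' m' : ℂ) : op21 (eigenVertex p m p' m') = eigenVertex p m p' m' :=
  op21_eightVertex _ _ _ _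

theorem eq_mul_inv_of_mul_eq {A B C : Mat4} (hC : IsUnit C.det) (h : A * C = B) : A = B * C⁻¹ := by
  rw [← h, Matrix.mul_assoc, Matrix.mul_nonsing_inv _ hC, Matrix.mul_one]

section Twists

variable {β r : ℂ}

theorem RV8_eq_eigenVertex (hr : r ≠ 0) (hβ : Generic β r) :
    RV8 β r = eigenVertex (rhoV8 β r)
      (rhoV8 β r * (cos ((Real.pi - I * β) / (2 * r)) / cos ((Real.pi + I * β) / (2 * r))))
      (rhoV8 β r)
      (-(rhoV8 β r * (sin ((Real.pi - I * β) / (2 * r)) / sin ((Real.pi + I * β) / (2 * r))))) := by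
  obtain ⟨hs, hc⟩ := sin_add_div_ne_zero hr hβ
  rw [add_div] at hs hc
  have ea := cos_sub (Real.pi / (2 * r)) (I * β / (2 * r))
  have eb := sin_sub (Real.pi / (2 * r)) (I * β / (2 * r))
  have ec := cos_add (Real.pi / (2 * r)) (I * β / (2 * r))
  have ed := sin_add (Real.pi / (2 * r)) (I * β / (2 * r))
  rw [RV8, smul_eightVertex, eigenVertex, add_div, sub_div]
  generalize cos (Real.pi / (2 * r) + I * β / (2 * r)) = C at *
  generalize sin (Real.pi / (2 * r) + I * β / (2 * r)) = S at *
  generalize cos (Real.pi / (2 * r) - I * β / (2 * r)) = C' at *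
  generalize sin (Real.pi / (2 * r) - I * β / (2 * r)) = S' at *
  have hC : C / C = 1 := div_self hc
  have hS : S / S = 1 := div_self hs
  congr 1
  · linear_combination (rhoV8 β r / 2) * hC - (rhoV8 β r / 2 / C) * ec - (rhoV8 β r / 2 / C) * ea
  · linear_combination (rhoV8 β r / 2) * hS - (rhoV8 β r / 2 / S) * ed + (rhoV8 β r / 2 / S) * eb
  · linear_combination (rhoV8 β r / 2) * hS - (rhoV8 β r / 2 / S) * ed - (rhoV8 β r / 2 / S) * eb
  · linear_combination (rhoV8 β r / 2) * hC - (rhoV8 β r / 2 / C) * ec + (rhoV8 β r / 2 / C) * ea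

theorem RV8_twist (hr : 0 < r.re) (hβ : Generic β r) :
    RV8 β r = op21 (E2 (-β) r) * RDY β * (E2 β r)⁻¹ := by
  have hr0 : r ≠ 0 := fun h => by simp [h] at hr
  obtain ⟨hs, hc⟩ := sin_add_div_ne_zero hr0 hβ
  have hpi : (Real.pi : ℂ) ≠ 0 := ofReal_ne_zero.mpr Real.pi_ne_zero
  have hp : 1 + spec β ≠ 0 := fun h => (hβ.ne_int_mul 0).2.1 (by push_cast; linear_combination h)
  have hm : 1 - spec β ≠ 0 := fun h => (hβ.ne_int_mul 0).2.2 (by push_cast; linear_combination -h)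
  have hρ := rhoV8_eq hr hβ
  have hρ0 := rhoE_ne_zero β r
  have ha := aMinus_neg_mul_cos hr hβ
  have hb := bMinus_neg_mul_sin hr hβ
  refine eq_mul_inv_of_mul_eq (isUnit_det_E2 β r) ?_
  rw [RV8_eq_eigenVertex hr0 hβ, E2_eq_eigenVertex, E2_eq_eigenVertex, op21_eigenVertex, RDY,
    sixVertex_eq_eigenVertex, smul_eigenVertex, eigenVertex_mul, eigenVertex_mul, ← pi_mul_spec]
  rw [← pi_mul_spec] at hs hc ha hb
  have hden : Real.pi * spec β + Real.pi ≠ 0 := by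
    intro h
    apply mul_ne_zero hpi hp
    linear_combination h
  have e0 : Real.pi * spec β / (Real.pi * spec β + Real.pi) +
      Real.pi / (Real.pi * spec β + Real.pi) = 1 := by
    rw [← add_div, div_self hden]
  have e1 : Real.pi * spec β / (Real.pi * spec β + Real.pi) -
      Real.pi / (Real.pi * spec β + Real.pi) = -((1 - spec β) / (1 + spec β)) := by
    rw [← sub_div, ← neg_div, div_eq_div_iff hden hp]
    ring
  rw [hρ, e0, e1]
  generalize cos ((Real.pi - Real.pi * spec β) / (2 * r)) = cm at *
  generalize cos ((Real.pi + Real.pi * spec β) / (2 * r)) = cp at *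
  generalize sin ((Real.pi - Real.pi * spec β) / (2 * r)) = sm at *
  generalize sin ((Real.pi + Real.pi * spec β) / (2 * r)) = sp at *
  have hb' : (1 + spec β) * (bMinus β r * sm) = bMinus (-β) r * (1 - spec β) * sp := by
    linear_combination -hb
  congr 1
  · field_simp
  · field_simp
    linear_combination (-(rhoE (-β) r * rhoDY β)) * ha
  · field_simp
  · have e2 : bMinus β r * (sm / sp) = bMinus (-β) r * ((1 - spec β) / (1 + spec β)) := by
      rw [mul_div_assoc', mul_div_assoc', div_eq_div_iff hs hp]
      linear_combination hb'
    have e3 : rhoE (-β) r * rhoDY β / rhoE β r * rhoE β r = rhoE (-β) r * rhoDY β :=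
      div_mul_cancel₀ _ hρ0
    linear_combination (-(bMinus β r * (sm / sp))) * e3 - rhoE (-β) r * rhoDY β * e2

/-- The inverse (and conjugate transpose) of the unitary matrix `K`. -/
theorem K_inv : K⁻¹ = (1 / 2 : ℂ) • !![1, -1, -1, 1; I, I, -I, -I; I, -I, I, -I; -1, -1, -1, -1] ∧
    IsUnit K.det := by
  have h : K * ((1 / 2 : ℂ) •
      !![1, -1, -1, 1; I, I, -I, -I; I, -I, I, -I; -1, -1, -1, -1]) = 1 := by
    ext i j
    fin_cases i <;> fin_cases j <;> simp [K, Matrix.mul_apply, Fin.sum_univ_four] <;> ring_nf <;>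
      simp [I_sq] <;> ring
  exact ⟨Matrix.inv_eq_right_inv h, Matrix.isUnit_det_of_right_inverse h⟩

/-- Conjugation by `K` diagonalizes the six-vertex matrices in the eight-vertex basis. -/
theorem op21_K_mul_sixVertex_mul (b c : ℂ) :
    op21 K * sixVertex b c c = eigenVertex 1 (b + c) 1 (b - c) * K := by
  ext i j
  fin_cases i <;> fin_cases j <;>
    simp [op21, flipP, K, sixVertex, eigenVertex, eightVertex, Matrix.mul_apply,
      Fin.sum_univ_four] <;> ring

theorem RV8_eq_K (hr : 0 < r.re) (hβ : Generic β r) :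
    RV8 β r = op21 K * RV6 β r * K⁻¹ := by
  have hr0 : r ≠ 0 := fun h => by simp [h] at hr
  obtain ⟨hs, hc⟩ := sin_add_div_ne_zero hr0 hβ
  refine eq_mul_inv_of_mul_eq K_inv.2 ?_
  rw [RV6, Matrix.mul_smul, op21_K_mul_sixVertex_mul, ← Matrix.smul_mul, smul_eigenVertex,
    RV8_eq_eigenVertex hr0 hβ]
  have d1 : (Real.pi + I * β) / r = 2 * ((Real.pi + I * β) / (2 * r)) := by
    field_simp
  have d2 : I * β / r = (Real.pi + I * β) / (2 * r) - (Real.pi - I * β) / (2 * r) := by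
    field_simp
    ring
  have d3 : Real.pi / r = (Real.pi + I * β) / (2 * r) + (Real.pi - I * β) / (2 * r) := by
    field_simp
    ring
  rw [d1, d2, d3, sin_two_mul, sin_sub, sin_add]
  generalize sin ((Real.pi + I * β) / (2 * r)) = sp at *
  generalize cos ((Real.pi + I * β) / (2 * r)) = cp at *
  generalize sin ((Real.pi - I * β) / (2 * r)) = sm at *
  generalize cos ((Real.pi - I * β) / (2 * r)) = cm at *
  congr 2
  · ring
  · field_simp
    ring
  · ring
  · field_simp
    ring

/-- Twists compose: if `A` twists `R` to `S` and `B` twists `S` to `T`, then `BA` twists `R` to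
`T`. -/
theorem twist_comp {A A' B B' R S T : Mat4} (h₁ : S = op21 A' * R * A⁻¹)
    (h₂ : T = op21 B' * S * B⁻¹) : T = op21 (B' * A') * R * (B * A)⁻¹ := by
  rw [h₂, h₁, op21_mul, Matrix.mul_inv_rev]
  simp only [Matrix.mul_assoc]

theorem twist_inv {B R S : Mat4} (hB : IsUnit B.det) (h : R = op21 B * S * B⁻¹) :
    S = op21 B⁻¹ * R * (B⁻¹)⁻¹ := by
  have h1 : op21 B⁻¹ * op21 B = 1 := by
    rw [← op21_mul, Matrix.nonsing_inv_mul _ hB, op21_one]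
  have h2 : op21 B⁻¹ * (op21 B * S * B⁻¹) * B = (op21 B⁻¹ * op21 B) * S * (B⁻¹ * B) := by
    simp only [Matrix.mul_assoc]
  rw [Matrix.nonsing_inv_nonsing_inv _ hB, h, h2, h1, Matrix.nonsing_inv_mul _ hB, Matrix.one_mul,
    Matrix.mul_one]

theorem K6_mul_neg (β r : ℂ) : K6 β r * K6 (-β) r = 1 := by
  have h1 : exp (β / (2 * r)) * exp (-β / (2 * r)) = 1 := by
    rw [← exp_add, ← add_div]
    simp
  have h2 : exp (-(β / (2 * r))) * exp (-(-β / (2 * r))) = 1 := by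
    rw [← exp_add, ← neg_add, ← add_div]
    simp
  ext i j
  fin_cases i <;> fin_cases j <;> simp [K6, Matrix.mul_apply, Fin.sum_univ_four, h1, h2]

theorem RF_eq_K6 (hr : 0 < r.re) (hβ : Generic β r) :
    RF β r = op21 (K6 (-β) r) * RV6 β r * (K6 β r)⁻¹ := by
  rw [Matrix.inv_eq_right_inv (K6_mul_neg β r), RF, RV6, rhoF_eq hr, rhoV8_eq hr hβ,
    Matrix.mul_smul, Matrix.smul_mul]
  congr 1
  have e1 : exp (β / r) = exp (β / (2 * r)) * exp (β / (2 * r)) := by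
    rw [← exp_add]
    congr 1
    ring
  have e2 : exp (-(β / r)) = exp (-(β / (2 * r))) * exp (-(β / (2 * r))) := by
    rw [← exp_add]
    congr 1
    ring
  have e3 : exp (β / (2 * r)) * exp (-(β / (2 * r))) = 1 := by
    rw [← exp_add]
    simp
  rw [e1, e2]
  generalize sin (I * β / r) / sin ((Real.pi + I * β) / r) = b
  generalize sin (Real.pi / r) / sin ((Real.pi + I * β) / r) = c
  ext i j
  fin_cases i <;> fin_cases j <;>
    simp [op21, flipP, K6, sixVertex, Matrix.mul_apply, Fin.sum_univ_four, neg_div] <;>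
    first | done | ring1 | linear_combination (-b) * e3

theorem E3_eq (β r : ℂ) :
    E3 β r = (1 / 2 * rhoE β r : ℂ) • !![1, -1, -1, 1;
      I * (aE β r - dE β r), I * (bE β r - cE β r), I * (cE β r - bE β r), I * (dE β r - aE β r);
      I * (aE β r - dE β r), I * (cE β r - bE β r), I * (bE β r - cE β r), I * (dE β r - aE β r);
      -1, -1, -1, -1] := by
  have had : aE β r + dE β r = 1 := by
    rw [aE, dE]
    ring
  have hbc : bE β r + cE β r = 1 := by
    rw [bE, cE]
    ring
  rw [E3, K_inv.1, E2, Matrix.smul_mul, Matrix.mul_smul, smul_smul]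
  congr 1
  rw [← eq_sub_iff_add_eq'] at had hbc
  rw [had, hbc]
  ext i j
  fin_cases i <;> fin_cases j <;>
    simp [eightVertex, Matrix.mul_apply, Fin.sum_univ_four] <;> ring

theorem F7_eq (β r : ℂ) : F7 β r = K6 β r * E3 β r := by
  rw [F7, K8, E3, Matrix.mul_assoc]

end Twists

/-- Eight-vertex matrices commute, so a gauge of this form cancels from the twisted matrix. The
inverses need not exist: `(C E)⁻¹ = (E C)⁻¹ = C⁻¹ E⁻¹` holds for the totalized inverse as well. -/
theorem gauge_cancel {C E E' R : Mat4} (hC : IsUnit C.det) (hCE : C * E = E * C)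
    (hCE' : C * E' = E' * C) (hCR : C * R = R * C) (hopC : op21 C = C) (hopE : op21 E' = E') :
    op21 (C * E') * R * (C * E)⁻¹ = op21 E' * R * E⁻¹ := by
  rw [op21_mul, hopC, hopE, hCE', hCE, Matrix.mul_inv_rev, Matrix.mul_assoc E' C R, hCR,
    ← Matrix.mul_assoc E' R C, ← Matrix.mul_assoc, Matrix.mul_assoc (E' * R) C C⁻¹,
    Matrix.mul_nonsing_inv _ hC, Matrix.mul_one]

theorem scalingGauge_eq_eigenVertex (q : ℝ) (r : ℂ) :
    scalingGauge q r = eigenVertex ((((-Real.log q / 2 : ℝ) : ℂ) ^ (1 / (2 * r)))⁻¹)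
      (((-Real.log q / 2 : ℝ) : ℂ) ^ (1 / (2 * r)))
      ((((-Real.log q / 2 : ℝ) : ℂ) ^ (1 / (2 * r)))⁻¹)
      (((-Real.log q / 2 : ℝ) : ℂ) ^ (1 / (2 * r))) := rfl

theorem isUnit_det_scalingGauge {q : ℝ} (hq : 0 < q) (hq' : q < 1) (r : ℂ) :
    IsUnit (scalingGauge q r).det := by
  have hlog := Real.log_neg hq hq'
  have h : (((-Real.log q / 2 : ℝ) : ℂ) ^ (1 / (2 * r))) ≠ 0 :=
    cpow_ne_zero_iff.mpr (Or.inl (ofReal_ne_zero.mpr (by linarith)))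
  rw [scalingGauge_eq_eigenVertex]
  exact isUnit_det_eigenVertex (inv_ne_zero h) h (inv_ne_zero h) h

theorem scalingGauge_twist {q : ℝ} (hq : 0 < q) (hq' : q < 1) (r z p : ℂ) :
    op21 (scalingGauge q r * E1 z⁻¹ p q) * RUq z q * (scalingGauge q r * E1 z p q)⁻¹ =
      op21 (E1 z⁻¹ p q) * RUq z q * (E1 z p q)⁻¹ := by
  have hcomm : ∀ (k a b c d : ℂ), scalingGauge q r * (k • eightVertex a b c d) =
      (k • eightVertex a b c d) * scalingGauge q r := by
    intro k a b c d
    rw [smul_eightVertex, scalingGauge, eightVertex_mul_comm]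
  refine gauge_cancel (isUnit_det_scalingGauge hq hq' r) (hcomm _ _ _ _ _) (hcomm _ _ _ _ _) ?_
    (op21_eightVertex _ _ _ _) ?_
  · rw [RUq, sixVertex_eq_eigenVertex]
    exact hcomm _ _ _ _ _
  · rw [E1, op21_smul, op21_eightVertex]

end DoubleYangian

theorem mainTheorem10 (β r : ℂ) (hr : 0 < r.re) (hβ : DoubleYangian.Generic β r) :
    -- the twist from DY to the eight-vertex deformed double Yangian
    (IsUnit (DoubleYangian.E2 β r).det ∧
      DoubleYangian.RV8 β r =
        DoubleYangian.op21 (DoubleYangian.E2 (-β) r) * DoubleYangian.RDY β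
          * (DoubleYangian.E2 β r)⁻¹) ∧
    -- it is the scaling limit of the elliptic twist, in the gauge which drops out of the twist
    (Filter.Tendsto
        (fun q : ℝ => DoubleYangian.scalingGauge q r *
          DoubleYangian.E1 ((q : ℂ) ^ (Complex.I * β / Real.pi)) ((q : ℂ) ^ (2 * r)) (q : ℂ))
        (nhdsWithin 1 (Set.Iio 1)) (nhds (DoubleYangian.E2 β r)) ∧
      ∀ q : ℝ, 0 < q → q < 1 → IsUnit (DoubleYangian.scalingGauge q r).det ∧ ∀ z p : ℂ,
        DoubleYangian.op21 (DoubleYangian.scalingGauge q r * DoubleYangian.E1 z⁻¹ p q)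
            * DoubleYangian.RUq z q
            * (DoubleYangian.scalingGauge q r * DoubleYangian.E1 z p q)⁻¹ =
          DoubleYangian.op21 (DoubleYangian.E1 z⁻¹ p q) * DoubleYangian.RUq z q
            * (DoubleYangian.E1 z p q)⁻¹) ∧
    -- the rigid twist, and the twist from DY to the six-vertex deformed double Yangian
    (IsUnit DoubleYangian.K.det ∧
      DoubleYangian.RV8 β r =
        DoubleYangian.op21 DoubleYangian.K * DoubleYangian.RV6 β r * DoubleYangian.K⁻¹ ∧
      DoubleYangian.RV6 β r =
        DoubleYangian.op21 (DoubleYangian.E3 (-β) r) * DoubleYangian.RDY β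
          * (DoubleYangian.E3 β r)⁻¹ ∧
      DoubleYangian.E3 β r =
        (1 / 2 * DoubleYangian.rhoE β r : ℂ) •
          !![1, -1, -1, 1;
             Complex.I * (DoubleYangian.aE β r - DoubleYangian.dE β r),
             Complex.I * (DoubleYangian.bE β r - DoubleYangian.cE β r),
             Complex.I * (DoubleYangian.cE β r - DoubleYangian.bE β r),
             Complex.I * (DoubleYangian.dE β r - DoubleYangian.aE β r);
             Complex.I * (DoubleYangian.aE β r - DoubleYangian.dE β r),
             Complex.I * (DoubleYangian.cE β r - DoubleYangian.bE β r),
             Complex.I * (DoubleYangian.bE β r - DoubleYangian.cE β r),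
             Complex.I * (DoubleYangian.dE β r - DoubleYangian.aE β r);
             -1, -1, -1, -1]) ∧
    -- the twists from the vertex type algebras and from DY to the face type one
    (DoubleYangian.RF β r =
        DoubleYangian.op21 (DoubleYangian.K6 (-β) r) * DoubleYangian.RV6 β r
          * (DoubleYangian.K6 β r)⁻¹ ∧
      DoubleYangian.RF β r =
        DoubleYangian.op21 (DoubleYangian.K8 (-β) r) * DoubleYangian.RV8 β r
          * (DoubleYangian.K8 β r)⁻¹ ∧
      DoubleYangian.RF β r =
        DoubleYangian.op21 (DoubleYangian.F7 (-β) r) * DoubleYangian.RDY β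
          * (DoubleYangian.F7 β r)⁻¹ ∧
      DoubleYangian.F7 β r =
        (1 / 2 * DoubleYangian.rhoE β r : ℂ) •
          !![1, -1, -1, 1;
             Complex.I * (DoubleYangian.aE β r - DoubleYangian.dE β r)
               * Complex.exp (β / (2 * r)),
             Complex.I * (DoubleYangian.bE β r - DoubleYangian.cE β r)
               * Complex.exp (β / (2 * r)),
             Complex.I * (DoubleYangian.cE β r - DoubleYangian.bE β r)
               * Complex.exp (β / (2 * r)),
             Complex.I * (DoubleYangian.dE β r - DoubleYangian.aE β r)
               * Complex.exp (β / (2 * r));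
             Complex.I * (DoubleYangian.aE β r - DoubleYangian.dE β r)
               * Complex.exp (-(β / (2 * r))),
             Complex.I * (DoubleYangian.cE β r - DoubleYangian.bE β r)
               * Complex.exp (-(β / (2 * r))),
             Complex.I * (DoubleYangian.bE β r - DoubleYangian.cE β r)
               * Complex.exp (-(β / (2 * r))),
             Complex.I * (DoubleYangian.dE β r - DoubleYangian.aE β r)
               * Complex.exp (-(β / (2 * r)));
             -1, -1, -1, -1]) := by
  have hV8 := DoubleYangian.RV8_twist hr hβ
  have hK := DoubleYangian.RV8_eq_K hr hβ
  have hKdet := DoubleYangian.K_inv.2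
  have hE3 : DoubleYangian.RV6 β r = DoubleYangian.op21 (DoubleYangian.E3 (-β) r) *
      DoubleYangian.RDY β * (DoubleYangian.E3 β r)⁻¹ :=
    DoubleYangian.twist_comp hV8 (DoubleYangian.twist_inv hKdet hK)
  have hF := DoubleYangian.RF_eq_K6 hr hβ
  refine ⟨⟨DoubleYangian.isUnit_det_E2 β r, hV8⟩,
    ⟨DoubleYangian.tendsto_scalingGauge_mul_E1 hr hβ, fun q hq hq' =>
      ⟨DoubleYangian.isUnit_det_scalingGauge hq hq' r, DoubleYangian.scalingGauge_twist hq hq' r⟩⟩,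
    ⟨hKdet, hK, hE3, DoubleYangian.E3_eq β r⟩, hF,
    DoubleYangian.twist_comp (DoubleYangian.twist_inv hKdet hK) hF, ?_, ?_⟩
  · rw [DoubleYangian.F7_eq, DoubleYangian.F7_eq]
    exact DoubleYangian.twist_comp hE3 hF
  · rw [DoubleYangian.F7_eq, DoubleYangian.E3_eq, Matrix.mul_smul]
    congr 1
    ext i j
    fin_cases i <;> fin_cases j <;>
      simp [DoubleYangian.K6, Matrix.mul_apply, Fin.sum_univ_four] <;> ring
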